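/- **Definitions.** For a partition $\pi$ let $\sigma(\pi)$ be the sum of its parts and $m(\pi)$ the number of its parts plus the number of its even parts. A *Schur partition* is a partition whose consecutive parts differ by at least $3$ and that does not contain two consecutive multiples of $3$ (i.e. both $3k$ and $3k+3$). For integers $m,n$: - $\mathcal D(m,n)$ is the set of Schur partitions $\pi$ of $n$ with $m(\pi)=m$; $\mathcal D^*(m,n)$ is the subset of those whose odd parts are all $\ge 3$ and whose even parts are all $\ge 6$. - $\mathcal C(m,n)$ is the set of partitions of $n$ into $m$ odd parts, each repeated at most twice; $\mathcal C^*(m,n)$ is the subset of those with all parts $>1$. - $[\mathcal D(m,n)]_0=\mathcal D^*(m,n)$; $[\mathcal D(m,n)]_1$ consists of the $\pi\in\mathcal D(m,n)$ containing $1$ or $4$ but not both; $[\mathcal D(m,n)]_2$ of the $\pi\in\mathcal D(m,n)$ containing $2$ or both $1$ and $4$. $[\mathcal C(m,n)]_g$ consists of the $\pi\in\mathcal C(m,n)$ with exactly $g$ ones. (These sets are empty if $m<0$ or $n<0$.) On the $\mathcal C$ side, $G'$ removes all parts equal to $1$, $\psi'$ subtracts $2$ from every part, and $\phi'=\psi'\circ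 G'$. On the $\mathcal D$ side, $G$ removes all parts less than $3$ and replaces a part $4$ by $3$. The map $\psi$ is defined as follows. A part $x$ of $\pi$ is in an *upper pair* if $x+3$ or $x-3$ is also a part, except when $x$ is odd and is the largest, or $x$ is even and is the smallest, term of a maximal arithmetic progression of parts with difference $3$ and odd length; every other part is an *upper singleton*. Let $\mathcal U$ be the smallest collection of finite sets that contains, for odd $o>3$, 1. $\{o,o+4,\dots,o+4x,\;o+4x+5,o+4x+9,\dots,o+4(x+y)+5\}$ with $x,y\ge0$, 2. $\{o,o+4,\dots,o+4x,\;q+3,q+6,\dots,q+3p,\;q+3p+4,\dots,q+3p+4y\}$ with $q=o+4x+1\not\equiv0\pmod 3$, $x\ge 0$, $y,p>0$, $p$ even, and is closed under: (suffix rule) if the largest element $e$ of $\Sigma\in\mathcal U$ is even and $3\nmid e$, adjoin $e+3,e+6,\dots,e+3p,\;e+3p+4,\dots,e+3p+4y$ with $p,y>0$, $p$ even; (prefix rule) if the smallest element of $\Sigma\in\mathcal U$ is $o=o'+4k+3(p+1)+1$ with $3\nmid o$, $o'>3$ odd, $k\ge0$, $p>0$ even, adjoin $o',o'+4,\dots,o'+4k,\;o'+4k+4,o'+4k+7,\dots,o'+4k+3p+1$.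 An *upper minimal segment* of $\pi$ is a subset $\Sigma\in\mathcal U$ of the parts of $\pi$ whose smallest and largest elements are upper singletons of $\pi$; it is *longest* if it is not properly contained in another one. The map $\rho$ on an upper minimal segment with $\omega'$ odd and $\varepsilon'$ even singletons subtracts $2$ from the $\omega'-\varepsilon'$ largest odd singletons if $\omega'>\varepsilon'$, subtracts $4$ from the $\varepsilon'-\omega'$ smallest even singletons if $\varepsilon'>\omega'$, and subtracts $3$ from all its other parts. Then $\psi(\pi)$ is obtained by applying $\rho$ to every longest upper minimal segment of $\pi$ and, among the remaining parts, subtracting $3$ from those in an upper pair, $2$ from the odd upper singletons and $4$ from the even upper singletons. Put $\phi=\psi\circ G$. Let $r$ add $2$ to every part and $g(\pi)=\sigma(\pi)-\sigma(G(\pi))$. The map $f$ sends the empty partition to itself and is defined recursively by $f(\pi)=1^{g(\pi)}\oplus r(f(\phi(\pi)))$ for nonempty $\pi$, where $1^{g}$ stands for $g$ parts equal to $1$ (so $f(1)=1$ and $f(2)=1\oplus1$). **Statement.** For all integers $m,n$, the map $f$ is a bijection $\mathcal D(m,n)\to\mathcal C(m,n)$ and - $f(\phi(\pi))=\phi'(f(\pi))$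 for all $\pi\in\mathcal D(m,n)$; - $f([\mathcal D(m,n)]_g)=[\mathcal C(m,n)]_g$ for $g=0,1,2$; - $f$ and $\psi$ map $\mathcal D^*(m,n)$ into $\mathcal C^*(m,n)$ and $\mathcal D(m,n-2m)$ respectively, $f$ maps $\mathcal D(m,n-2m)$ into $\mathcal C(m,n-2m)$, $\psi'$ maps $\mathcal C^*(m,n)$ into $\mathcal C(m,n-2m)$, and $f\circ\psi=\psi'\circ f$ on $\mathcal D^*(m,n)$; - with $\mathcal D^{\cup}=\mathcal D^*(m,n)\cup\mathcal D^*(m-1,n-1)\cup\mathcal D^*(m-2,n-2)$ and $\mathcal C^{\cup}=\mathcal C^*(m,n)\cup\mathcal C^*(m-1,n-1)\cup\mathcal C^*(m-2,n-2)$, the map $f$ sends $\mathcal D(m,n)$ into $\mathcal C(m,n)$ and $\mathcal D^{\cup}$ into $\mathcal C^{\cup}$, $G$ maps $\mathcal D(m,n)$ into $\mathcal D^{\cup}$, $G'$ maps $\mathcal C(m,n)$ into $\mathcal C^{\cup}$, and $f\circ G=G'\circ f$ on $\mathcal D(m,n)$. -/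

import Mathlib

namespace AlladiSchur

/-! Schur partitions have distinct parts and are represented by finite sets of
positive integers; Alladi partitions (odd parts, each used at most twice) are represented by
multisets of positive integers. The empty set / multiset is the empty partition of `0`. -/

/-- Consecutive (hence all distinct) parts differ by at least `3`, and no two consecutive
multiples of `3` occur. -/
def IsSchur (π : Finset ℕ) : Prop :=
  (∀ x ∈ π, 0 < x) ∧
  (∀ x ∈ π, ∀ y ∈ π, x < y → x + 3 ≤ y) ∧
  (∀ x ∈ π, 3 ∣ x → x + 3 ∉ π)

/-- The sum `σ(π)` of the parts. -/
def weight (π : Finset ℕ) : ℕ := ∑ x ∈ π, x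

/-- `m(π)`: the number of parts plus the number of even parts. -/
def partCount (π : Finset ℕ) : ℕ := π.card + (π.filter (fun x => Even x)).card

/-- `𝒟(m,n)`: Schur partitions `π` of `n` with `m(π) = m`. The indices are integers, and the set
is empty when one of them is negative. -/
def schurSet (m n : ℤ) : Set (Finset ℕ) :=
  {π | IsSchur π ∧ (partCount π : ℤ) = m ∧ (weight π : ℤ) = n}

/-- `𝒟*(m,n)`: members of `𝒟(m,n)` with all odd parts `≥ 3` and all even parts `≥ 6`. -/
def schurStarSet (m n : ℤ) : Set (Finset ℕ) :=
  {π | π ∈ schurSet m n ∧ (∀ x ∈ π, Odd x → 3 ≤ x) ∧ (∀ x ∈ π, Even x → 6 ≤ x)}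

/-- `𝒞(m,n)`: partitions of `n` into `m` odd parts, each repeated at most twice. -/
def alladiSet (m n : ℤ) : Set (Multiset ℕ) :=
  {π | (∀ x ∈ π, Odd x) ∧ (∀ x, π.count x ≤ 2) ∧ (π.card : ℤ) = m ∧ (π.sum : ℤ) = n}

/-- `𝒞*(m,n)`: members of `𝒞(m,n)` all of whose parts are greater than `1`. -/
def alladiStarSet (m n : ℤ) : Set (Multiset ℕ) :=
  {π | π ∈ alladiSet m n ∧ ∀ x ∈ π, 1 < x}

/-- `[𝒟(m,n)]_g` for `g = 0, 1, 2`. -/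
def schurGradedSet (m n : ℤ) : ℕ → Set (Finset ℕ)
  | 0 => schurStarSet m n
  | 1 => {π | π ∈ schurSet m n ∧ ((1 ∈ π ∧ 4 ∉ π) ∨ (4 ∈ π ∧ 1 ∉ π))}
  | 2 => {π | π ∈ schurSet m n ∧ (2 ∈ π ∨ (1 ∈ π ∧ 4 ∈ π))}
  | _ => ∅

/-- `[𝒞(m,n)]_g`: members of `𝒞(m,n)` with exactly `g` ones. -/
def alladiGradedSet (m n : ℤ) (g : ℕ) : Set (Multiset ℕ) :=
  {π | π ∈ alladiSet m n ∧ π.count 1 = g}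

/-! ### The maps on Alladi partitions -/

/-- `G'`: remove every part `1`. -/
def alladiGroup (π : Multiset ℕ) : Multiset ℕ := π.filter (fun x => x ≠ 1)

/-- `ψ'`: subtract `2` from every part. -/
def alladiReduce (π : Multiset ℕ) : Multiset ℕ := π.map (fun x => x - 2)

/-- `φ' = ψ' ∘ G'`. -/
def alladiPhi (π : Multiset ℕ) : Multiset ℕ := alladiReduce (alladiGroup π)

/-! ### The grouping map on Schur partitions -/

/-- `G`: remove the parts less than `3` and replace a part `4` by `3`. -/
def schurGroup (π : Finset ℕ) : Finset ℕ :=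
  (π.filter (fun x => 3 ≤ x)).image (fun x => if x = 4 then 3 else x)

/-! ### Upper factorizations -/

/-- `a, a + 3, …, a + 3 (l - 1)` is a maximal arithmetic progression with common difference `3`
among the parts of `π`. -/
def IsMaxProgression (π : Finset ℕ) (a l : ℕ) : Prop :=
  0 < l ∧ (∀ i < l, a + 3 * i ∈ π) ∧ a + 3 * l ∉ π ∧ ∀ b ∈ π, b + 3 ≠ a

/-- The part `x` of `π` belongs to an upper pair: `x + 3` or `x - 3` is also a part, except that
`x` is odd and is the largest term, or `x` is even and is the smallest term, of a maximal
progression of odd length. -/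
def IsUpperPaired (π : Finset ℕ) (x : ℕ) : Prop :=
  x ∈ π ∧ (x + 3 ∈ π ∨ ∃ y ∈ π, y + 3 = x) ∧
  ¬ (Odd x ∧ ∃ a l, IsMaxProgression π a l ∧ Odd l ∧ x = a + 3 * (l - 1)) ∧
  ¬ (Even x ∧ ∃ l, IsMaxProgression π x l ∧ Odd l)

/-- A part that is not in an upper pair. -/
def IsUpperSingleton (π : Finset ℕ) (x : ℕ) : Prop := x ∈ π ∧ ¬ IsUpperPaired π x

/-- The progression `a, a + d, …` with `k` terms. -/
def prog (a d k : ℕ) : Finset ℕ := (Finset.range k).image (fun i => a + d * i)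

/-- The set `𝒰`: the smallest collection that contains the two forms of primitive upper minimal
segments and is closed under the suffix rule and the prefix rule. -/
inductive IsUpperSegment : Finset ℕ → Prop
  /-- `o, o+4, …, o+4x, o+4x+5, o+4x+9, …, o+4(x+y)+5`. -/
  | primitiveOne (o x y : ℕ) (ho : Odd o) (ho3 : 3 < o) :
      IsUpperSegment (prog o 4 (x + 1) ∪ prog (o + 4 * x + 5) 4 (y + 1))
  /-- `o, o+4, …, o+4x, [q+3, q+6], …, [q+3(p-1), q+3p], q+3p+4, …, q+3p+4y`
  with `q = o+4x+1`. -/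
  | primitiveTwo (o x p y q : ℕ) (ho : Odd o) (ho3 : 3 < o) (hq : q = o + 4 * x + 1)
      (hq3 : ¬ 3 ∣ q) (hp : 0 < p) (hpe : Even p) (hy : 0 < y) :
      IsUpperSegment (prog o 4 (x + 1) ∪ prog (q + 3) 3 p ∪ prog (q + 3 * p + 4) 4 y)
  /-- Append `[e+3, e+6], …, [e+3(p-1), e+3p], e+3p+4, …, e+3p+4y`, where `e` is the largest
  part. -/
  | extendRight (S : Finset ℕ) (e p y : ℕ) (hS : IsUpperSegment S) (heS : e ∈ S)
      (hmax : ∀ z ∈ S, z ≤ e) (he : Even e) (he3 : ¬ 3 ∣ e)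
      (hp : 0 < p) (hpe : Even p) (hy : 0 < y) :
      IsUpperSegment (S ∪ prog (e + 3) 3 p ∪ prog (e + 3 * p + 4) 4 y)
  /-- Prepend `o', o'+4, …, o'+4k, [o'+4k+3+1, o'+4k+6+1], …, [o'+4k+3(p-1)+1, o'+4k+3p+1]`, where
  the smallest part is `o = o'+4k+3(p+1)+1`. -/
  | extendLeft (S : Finset ℕ) (o o' k p : ℕ) (hS : IsUpperSegment S) (hoS : o ∈ S)
      (hmin : ∀ z ∈ S, o ≤ z) (ho : o = o' + 4 * k + 3 * (p + 1) + 1) (ho3 : ¬ 3 ∣ o)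
      (ho' : Odd o') (ho3' : 3 < o') (hp : 0 < p) (hpe : Even p) :
      IsUpperSegment (prog o' 4 (k + 1) ∪ prog (o' + 4 * k + 3 + 1) 3 p ∪ S)

/-- `S` is an upper minimal segment of `π`: `S ∈ 𝒰`, `S ⊆ π`, and the smallest and the largest
part of `S` are singletons in the generic upper factorization of `π`. -/
def IsSegmentOf (π S : Finset ℕ) : Prop :=
  IsUpperSegment S ∧ S ⊆ π ∧
  ∀ x ∈ S, ((∀ z ∈ S, x ≤ z) ∨ (∀ z ∈ S, z ≤ x)) → IsUpperSingleton π x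

/-- `S` is a longest upper minimal segment of `π`: it is not properly contained in another one. -/
def IsLongestSegmentOf (π S : Finset ℕ) : Prop :=
  IsSegmentOf π S ∧ ∀ T, IsSegmentOf π T → S ⊆ T → T = S

open Classical in
/-- The odd singletons of a segment. -/
noncomputable def oddSingletons (S : Finset ℕ) : Finset ℕ :=
  S.filter (fun x => Odd x ∧ IsUpperSingleton S x)

open Classical in
/-- The even singletons of a segment. -/
noncomputable def evenSingletons (S : Finset ℕ) : Finset ℕ :=
  S.filter (fun x => Even x ∧ IsUpperSingleton S x)

open Classical in
/-- The amount by which the reduction map `ρ` on minimal segments decreases the part `x` of the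
segment `S`, which has `ω'` odd and `ε'` even singletons: it is `2` for the `ω' - ε'` largest odd
singletons if `ω' > ε'`, it is `4` for the `ε' - ω'` smallest even singletons if `ω' < ε'`, and it
is `3` for all the other parts. -/
noncomputable def rhoShift (S : Finset ℕ) (x : ℕ) : ℕ :=
  if x ∈ oddSingletons S ∧
      ((oddSingletons S).filter (fun y => x < y)).card + (evenSingletons S).card
        < (oddSingletons S).card then 2
  else if x ∈ evenSingletons S ∧
      ((evenSingletons S).filter (fun y => y < x)).card + (oddSingletons S).card
        < (evenSingletons S).card then 4
  else 3

open Classical in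
/-- The amount by which the Schur reduction map decreases the part `x` of `π`. A part of a
longest upper minimal segment (there is only one such segment for a given part) is decreased as
prescribed by `ρ`, a part of a pair by `3`, a free odd singleton by `2` and a free even singleton
by `4`. -/
noncomputable def schurShift (π : Finset ℕ) (x : ℕ) : ℕ :=
  if h : ∃ S, IsLongestSegmentOf π S ∧ x ∈ S then rhoShift h.choose x
  else if IsUpperPaired π x then 3
  else if Odd x then 2
  else 4

/-- `ψ`: the Schur reduction map. -/
noncomputable def schurReduce (π : Finset ℕ) : Finset ℕ :=
  π.image (fun x => x - schurShift π x)

/-- `φ = ψ ∘ G`. -/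
noncomputable def schurPhi (π : Finset ℕ) : Finset ℕ := schurReduce (schurGroup π)

theorem schurShift_pos (π : Finset ℕ) (x : ℕ) : 0 < schurShift π x := by
  unfold schurShift rhoShift
  split_ifs <;> norm_num

theorem weight_image_le (π : Finset ℕ) (h : ℕ → ℕ) :
    weight (π.image h) ≤ ∑ x ∈ π, h x := by
  classical
  unfold weight
  induction π using Finset.induction_on with
  | empty => simp
  | insert a s ha ih =>
    rw [Finset.image_insert, Finset.sum_insert ha]
    by_cases hm : h a ∈ s.image h
    · rw [Finset.insert_eq_of_mem hm]; omega
    · rw [Finset.sum_insert hm]; omega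

theorem weight_schurGroup_le (π : Finset ℕ) : weight (schurGroup π) ≤ weight π := by
  refine (weight_image_le _ _).trans ?_
  refine (Finset.sum_le_sum (g := fun x => x) ?_).trans
    (Finset.sum_le_sum_of_subset (Finset.filter_subset _ _))
  intro x _
  split_ifs <;> omega

/-- The recursion that defines `f` terminates. -/
theorem weight_schurPhi_lt (π : Finset ℕ) (h : weight π ≠ 0) :
    weight (schurPhi π) < weight π := by
  by_cases hG : schurGroup π = ∅
  · have : weight (schurPhi π) = 0 := by simp [schurPhi, hG, schurReduce, weight]
    omega
  · refine lt_of_lt_of_le ?_ (weight_schurGroup_le π)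
    refine lt_of_le_of_lt (weight_image_le _ _) ?_
    refine Finset.sum_lt_sum_of_nonempty (Finset.nonempty_iff_ne_empty.mpr hG) ?_
    intro x hx
    have h0 := schurShift_pos (schurGroup π) x
    have h3 : 3 ≤ x := by
      simp only [schurGroup, Finset.mem_image, Finset.mem_filter] at hx
      obtain ⟨y, ⟨_, hy⟩, rfl⟩ := hx
      split_ifs <;> omega
    omega

/-- The bijection `f`, defined recursively by `f(π) = f(g(π)) ⊕ r(f(φ(π)))`, where
`g(π) = σ(π) - σ(G(π))`, where `r` adds `2` to every part, and where `f(0) = 0` (the empty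
partition), `f(1) = 1`, `f(2) = 1 ⊕ 1`, so that `f(g(π))` consists of `g(π)` ones. -/
noncomputable def bij (π : Finset ℕ) : Multiset ℕ :=
  if h : weight π = 0 then 0
  else Multiset.replicate (weight π - weight (schurGroup π)) 1
    + (bij (schurPhi π)).map (fun x => x + 2)
termination_by weight π
decreasing_by exact weight_schurPhi_lt π h

end AlladiSchur

open AlladiSchur

namespace AlladiSchur

/-! Both sides are built by the same recursion: split off `g ≤ 2` units, reduce what is left by
twice its number of (weighted) parts, and repeat. For multisets of odd parts this is visible: `g` is
the number of ones, and the other parts drop by 2. For Schur partitions two facts are needed. First,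
grouping together with `g` identifies Schur partitions with pairs of a starred partition and a
number `g ≤ 2` (`IsStar.ungroup_spec`, `IsSchur.exists_ungroup`). Second, `schurReduce` maps starred
partitions bijectively onto all Schur partitions, preserving `partCount` and lowering the weight by
`2 * partCount` (`IsStar.partCount_schurReduce`, `IsStar.schurReduce_inj`,
`IsSchur.exists_schurReduce_eq`). Induction on the weight then shows that `bij` is well-behaved,
injective and surjective, and both diagrams follow from the recursion.

The second fact is the hard one. A Schur partition with parts at least 5 is encoded by a `Skeleton`,
namely its upper pairs and the cells `{2c+1, 2c+2}` of its singletons, together with the set `A` of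
cells whose singleton is odd. Call two cells linked if nothing but tightly packed pairs with odd
bottoms lies between them. An even singleton linked to an odd one above it would form with these
pairs a progression of difference 3, even length and even bottom, all of whose terms would be
paired. So `A` is admissible: along every chain of linked cells the odd singletons precede the even
ones. Conversely every admissible `A` gives a Schur partition with exactly these pairs and
singletons (`Admissible.isSchur`, `Admissible.isUpperSingleton_iff`, `IsSchur.exists_skeleton`).

In these terms the longest upper minimal segments run from the lowest odd to the highest even
singleton of a chain containing both kinds, and the rule `ρ` says: after translation by 3, reduction
leaves the skeleton alone and exchanges the numbers of odd and even singletons in every chain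
(`Admissible.image_schurReduce`). This exchange is an involution (`Admissible.flip_flip`), hence
reduction is invertible. A part 3 lies in no segment and interacts with nothing, so it is treated
apart. -/

/-! ### Parities of runs and the recognition of singletons -/

/-- The run `x - 3, x - 6, …` of parts of `π` strictly below `x` has even length. -/
def BelowEven (π : Finset ℕ) : ℕ → Prop
  | n + 3 => n ∈ π → ¬ BelowEven π n
  | _ => True

/-- `x + 3, …, x + 3 l` is the run of parts of `π` strictly above `x`. -/
def IsRunAbove (π : Finset ℕ) (x l : ℕ) : Prop :=
  (∀ i < l, x + 3 * (i + 1) ∈ π) ∧ x + 3 * (l + 1) ∉ π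

/-- The run `x + 3, x + 6, …` of parts of `π` strictly above `x` has even length. -/
def AboveEven (π : Finset ℕ) (x : ℕ) : Prop := ∃ l, Even l ∧ IsRunAbove π x l

theorem belowEven_add_three (π : Finset ℕ) (n : ℕ) :
    BelowEven π (n + 3) ↔ (n ∈ π → ¬ BelowEven π n) := by
  rw [BelowEven]

theorem belowEven_of_lt (π : Finset ℕ) {n : ℕ} (h : n < 3) : BelowEven π n := by
  match n, h with
  | 0, _ => simp [BelowEven]
  | 1, _ => simp [BelowEven]
  | 2, _ => simp [BelowEven]

theorem belowEven_iff (π : Finset ℕ) (x : ℕ) :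
    BelowEven π x ↔ ∀ n, n + 3 = x → n ∈ π → ¬ BelowEven π n := by
  constructor
  · rintro h n rfl
    exact (belowEven_add_three π n).1 h
  · intro h
    by_cases hx : x < 3
    · exact belowEven_of_lt π hx
    · obtain ⟨n, rfl⟩ := Nat.exists_eq_add_of_le' (not_lt.1 hx)
      exact (belowEven_add_three π n).2 (h n rfl)

theorem exists_isRunAbove (π : Finset ℕ) (x : ℕ) : ∃ l, IsRunAbove π x l := by
  classical
  have h : ∃ l, x + 3 * (l + 1) ∉ π := by
    by_contra! h
    have := Finset.le_sup (f := id) (h (π.sup id))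
    simp only [id] at this
    omega
  refine ⟨Nat.find h, fun i hi => ?_, Nat.find_spec h⟩
  simpa using Nat.find_min h hi

theorem IsRunAbove.unique {π : Finset ℕ} {x k l : ℕ} (hk : IsRunAbove π x k)
    (hl : IsRunAbove π x l) : k = l := by
  by_contra h
  rcases lt_or_gt_of_ne h with h | h
  · exact hk.2 (hl.1 k h)
  · exact hl.2 (hk.1 l h)

theorem IsRunAbove.succ {π : Finset ℕ} {x l : ℕ} (hx : x + 3 ∈ π)
    (hl : IsRunAbove π (x + 3) l) : IsRunAbove π x (l + 1) := by
  refine ⟨fun i hi => ?_, ?_⟩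
  · rcases i with _ | i
    · simpa using hx
    · have := hl.1 i (by omega)
      rwa [show x + 3 * (i + 1 + 1) = x + 3 + 3 * (i + 1) by ring]
  · have := hl.2
    rwa [show x + 3 * (l + 1 + 1) = x + 3 + 3 * (l + 1) by ring]

/-- The run above `x` is one longer than the run above `x + 3` when `x + 3` is a part, and empty
otherwise. This gives the upward analogue of the recursion defining `BelowEven`. -/
theorem aboveEven_iff (π : Finset ℕ) (x : ℕ) :
    AboveEven π x ↔ (x + 3 ∈ π → ¬ AboveEven π (x + 3)) := by
  constructor
  · rintro ⟨k, hk, hr⟩ hx ⟨l, hl, hl'⟩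
    have := hr.unique (hl'.succ hx)
    subst this
    grind
  · intro h
    by_cases hx : x + 3 ∈ π
    · obtain ⟨l, hl⟩ := exists_isRunAbove π (x + 3)
      refine ⟨l + 1, ?_, hl.succ hx⟩
      have : ¬ Even l := fun he => h hx ⟨l, he, hl⟩
      grind
    · exact ⟨0, by simp, by simp, by simpa using hx⟩

theorem exists_run_bottom (π : Finset ℕ) (x : ℕ) (hx : x ∈ π) :
    ∃ a k, x = a + 3 * k ∧ (∀ i ≤ k, a + 3 * i ∈ π) ∧ ∀ b ∈ π, b + 3 ≠ a := by
  induction x using Nat.strong_induction_on with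
  | _ x ih =>
    by_cases h : ∃ b ∈ π, b + 3 = x
    · obtain ⟨b, hb, rfl⟩ := h
      obtain ⟨a, k, rfl, hk, ha⟩ := ih b (by omega) hb
      refine ⟨a, k + 1, by ring, fun i hi => ?_, ha⟩
      rcases Nat.lt_or_ge i (k + 1) with h | h
      · exact hk i (by omega)
      · obtain rfl : i = k + 1 := by omega
        rwa [show a + 3 * (k + 1) = a + 3 * k + 3 by ring]
    · push Not at h
      exact ⟨x, 0, by simp, fun i hi => by simpa [Nat.le_zero.1 hi] using hx, h⟩

theorem belowEven_run {π : Finset ℕ} {a k : ℕ} (hk : ∀ i < k, a + 3 * i ∈ π)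
    (ha : ∀ b ∈ π, b + 3 ≠ a) : BelowEven π (a + 3 * k) ↔ Even k := by
  induction k with
  | zero =>
    simp only [mul_zero, add_zero, Even.zero, iff_true]
    exact (belowEven_iff π a).2 fun n hn hm => absurd hn (ha n hm)
  | succ k ih =>
    rw [show a + 3 * (k + 1) = a + 3 * k + 3 by ring, belowEven_add_three,
      ih fun i hi => hk i (by omega)]
    have := hk k (by omega)
    grind

/-- A part is a singleton if and only if it is the odd top of a run with an even rest, or the even
bottom of a run with an even rest. -/
theorem isUpperSingleton_iff (π : Finset ℕ) (x : ℕ) :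
    IsUpperSingleton π x ↔ x ∈ π ∧ ((Odd x ∧ x + 3 ∉ π ∧ BelowEven π x) ∨
      (Even x ∧ (∀ b ∈ π, b + 3 ≠ x) ∧ AboveEven π x)) := by
  unfold IsUpperSingleton
  refine and_congr_right fun hx => ?_
  have h1 : (Odd x ∧ ∃ a l, IsMaxProgression π a l ∧ Odd l ∧ x = a + 3 * (l - 1)) ↔
      (Odd x ∧ x + 3 ∉ π ∧ BelowEven π x) := by
    refine and_congr_right fun _ => ⟨?_, ?_⟩
    · rintro ⟨a, l, ⟨hl, hm, ht, ha⟩, ho, rfl⟩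
      obtain ⟨k, rfl⟩ := Nat.exists_eq_add_of_lt hl
      simp only [zero_add, Nat.add_sub_cancel] at *
      refine ⟨by rwa [show a + 3 * k + 3 = a + 3 * (k + 1) by ring], ?_⟩
      rw [belowEven_run (fun i hi => hm i (by omega)) ha]
      grind
    · rintro ⟨ht, hb⟩
      obtain ⟨a, k, rfl, hk, ha⟩ := exists_run_bottom π x hx
      rw [belowEven_run (fun i hi => hk i (by omega)) ha] at hb
      refine ⟨a, k + 1, ⟨by omega, fun i hi => hk i (by omega), ?_, ha⟩, hb.add_one, by simp⟩
      rwa [show a + 3 * (k + 1) = a + 3 * k + 3 by ring]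
  have h2 : (Even x ∧ ∃ l, IsMaxProgression π x l ∧ Odd l) ↔
      (Even x ∧ (∀ b ∈ π, b + 3 ≠ x) ∧ AboveEven π x) := by
    refine and_congr_right fun _ => ⟨?_, ?_⟩
    · rintro ⟨l, ⟨hl, hm, ht, ha⟩, ho⟩
      obtain ⟨k, rfl⟩ := Nat.exists_eq_add_of_lt hl
      refine ⟨ha, k, by grind, fun i hi => hm _ (by omega), by simpa using ht⟩
    · rintro ⟨hb, l, hl, hr⟩
      refine ⟨l + 1, ⟨by omega, fun i hi => ?_, hr.2, hb⟩, hl.add_one⟩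
      rcases i with _ | i
      · simpa using hx
      · exact hr.1 i (by omega)
  unfold IsUpperPaired
  rw [h1, h2]
  by_cases h3 : x + 3 ∈ π ∨ ∃ y ∈ π, y + 3 = x
  · simp only [hx, h3, true_and]
    rw [← not_or, not_not]
  -- An isolated part has empty runs on both sides, so the alternative belonging to its parity
  -- holds.
  · have h4 := h3
    push Not at h4
    have hb : BelowEven π x := (belowEven_iff π x).2 fun n hn hm => absurd hn (h4.2 n hm)
    have ha : AboveEven π x := (aboveEven_iff π x).2 fun h => absurd h h4.1
    simp only [h3, false_and, and_false, not_false_eq_true, true_iff]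
    rcases Nat.even_or_odd x with h | h
    · exact .inr ⟨h, h4.2, ha⟩
    · exact .inl ⟨h, h4.1, hb⟩

/-! ### Skeletons: pairs, cells and tight links -/

/-- The parts of the pairs `x, x + 3` with `x ∈ B`. -/
def pairParts (B : Finset ℕ) : Finset ℕ := B ∪ B.image (· + 3)

theorem mem_pairParts {B : Finset ℕ} {x : ℕ} :
    x ∈ pairParts B ↔ x ∈ B ∨ ∃ y ∈ B, y + 3 = x := by
  simp [pairParts]

theorem mem_pairParts_of_mem {B : Finset ℕ} {x : ℕ} (h : x ∈ B) : x ∈ pairParts B :=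
  mem_pairParts.2 (.inl h)

theorem add_three_mem_pairParts {B : Finset ℕ} {x : ℕ} (h : x ∈ B) : x + 3 ∈ pairParts B :=
  mem_pairParts.2 (.inr ⟨x, h, rfl⟩)

/-- The pairs of a Schur partition, and the cells of its singletons: the cell `c` consists of
the odd number `2 c + 1` and of the even number `2 c + 2`. -/
structure Skeleton where
  /-- The smaller parts of the pairs. -/
  bottoms : Finset ℕ
  /-- The cells of the singletons. -/
  cells : Finset ℕ
  five_le : ∀ x ∈ bottoms, 5 ≤ x
  two_le : ∀ c ∈ cells, 2 ≤ c
  pair_sep : ∀ x ∈ pairParts bottoms, ∀ y ∈ pairParts bottoms, x < y → x + 3 ≤ y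
  not_dvd : ∀ x ∈ pairParts bottoms, ¬ 3 ∣ x
  disj : ∀ x ∈ bottoms, x + 3 ∉ bottoms
  cell_sep : ∀ c ∈ cells, ∀ d ∈ cells, c < d → c + 2 ≤ d
  cell_pair : ∀ c ∈ cells, ∀ f ∈ pairParts bottoms, f + 2 ≤ 2 * c ∨ 2 * c + 5 ≤ f

/-- The cells from `a` up to `b` are filled tightly by pairs with an odd bottom. -/
inductive Gap (B : Finset ℕ) : ℕ → ℕ → Prop
  | refl (a : ℕ) : Gap B a a
  | step (a b : ℕ) (h : 2 * a + 1 ∈ B) (hg : Gap B (a + 3) b) : Gap B a b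

theorem Gap.le {B : Finset ℕ} {a b : ℕ} (h : Gap B a b) : a ≤ b := by
  induction h with
  | refl a => exact le_rfl
  | step a b h hg ih => omega

theorem Gap.trans {B : Finset ℕ} {a b c : ℕ} (h : Gap B a b) (h' : Gap B b c) : Gap B a c := by
  induction h with
  | refl a => exact h'
  | step a b h hg ih => exact .step a c h (ih h')

theorem Gap.snoc {B : Finset ℕ} {a b : ℕ} (h : Gap B a b) (h' : 2 * b + 1 ∈ B) :
    Gap B a (b + 3) := h.trans (.step b _ h' (.refl _))

theorem Gap.eq_or_snoc {B : Finset ℕ} {a b : ℕ} (h : Gap B a b) :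
    a = b ∨ ∃ d, Gap B a d ∧ 2 * d + 1 ∈ B ∧ d + 3 = b := by
  induction h with
  | refl a => exact .inl rfl
  | step a b h hg ih =>
    rcases ih with rfl | ⟨d, hd, hd', rfl⟩
    · exact .inr ⟨a, .refl _, h, rfl⟩
    · exact .inr ⟨d, .step _ _ h hd, hd', rfl⟩

namespace Skeleton

variable (K : Skeleton)

/-- The parts that belong to pairs. -/
def paired : Finset ℕ := pairParts K.bottoms

/-- The partition with the given pairs and cells whose singletons are odd in the cells of `A` and
even in the other ones. -/
def parts (A : Finset ℕ) : Finset ℕ :=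
  K.paired ∪ A.image (fun c => 2 * c + 1) ∪ (K.cells \ A).image (fun c => 2 * c + 2)

/-- Two cells are tightly linked by pairs with odd bottoms. -/
def Link (c d : ℕ) : Prop := c ∈ K.cells ∧ d ∈ K.cells ∧ Gap K.bottoms (c + 2) d

/-- No singleton is even and tightly linked to an odd one above it. -/
def Admissible (A : Finset ℕ) : Prop :=
  A ⊆ K.cells ∧ ∀ c d, K.Link c d → c ∉ A → d ∉ A

variable {K} {A : Finset ℕ}

theorem mem_parts {x : ℕ} : x ∈ K.parts A ↔
    x ∈ K.paired ∨ (∃ c ∈ A, 2 * c + 1 = x) ∨ ∃ c ∈ K.cells, c ∉ A ∧ 2 * c + 2 = x := by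
  simp [parts, and_assoc]

theorem paired_subset : K.paired ⊆ K.parts A := fun _ h => mem_parts.2 (.inl h)

theorem odd_mem_parts {c : ℕ} (h : c ∈ A) : 2 * c + 1 ∈ K.parts A :=
  mem_parts.2 (.inr (.inl ⟨c, h, rfl⟩))

theorem even_mem_parts {c : ℕ} (h : c ∈ K.cells) (hA : c ∉ A) : 2 * c + 2 ∈ K.parts A :=
  mem_parts.2 (.inr (.inr ⟨c, h, hA, rfl⟩))

theorem cell_pair' {c f : ℕ} (hc : c ∈ K.cells) (hf : f ∈ K.paired) :
    f + 2 ≤ 2 * c ∨ 2 * c + 5 ≤ f := K.cell_pair c hc f hf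

theorem cell_bottom {c f : ℕ} (hc : c ∈ K.cells) (hf : f ∈ K.bottoms) :
    f + 5 ≤ 2 * c ∨ 2 * c + 5 ≤ f := by
  have h1 := K.cell_pair c hc f (mem_pairParts_of_mem hf)
  have h2 := K.cell_pair c hc _ (add_three_mem_pairParts hf)
  omega

theorem Link.lt {c d : ℕ} (h : K.Link c d) : c + 2 ≤ d := h.2.2.le

/-- Cells at distance 2 are linked by the empty gap, so admissibility forbids an even singleton
followed by an odd one at that distance. This supplies the separation of parts and excludes
consecutive multiples of 3 among singletons. -/
theorem Admissible.add_three_le (hA : K.Admissible A) {c d : ℕ} (hc : c ∈ K.cells)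
    (hcA : c ∉ A) (hd : d ∈ A) (hcd : c < d) : c + 3 ≤ d := by
  have h1 := K.cell_sep c hc d (hA.1 hd) hcd
  rcases Nat.lt_or_ge (c + 2) d with h | h
  · exact h
  · obtain rfl : d = c + 2 := by omega
    exact absurd hd (hA.2 c _ ⟨hc, hA.1 hd, .refl _⟩ hcA)

theorem Admissible.isSchur (hA : K.Admissible A) : IsSchur (K.parts A) := by
  refine ⟨fun x hx => ?_, fun x hx y hy hxy => ?_, fun x hx h3 hy => ?_⟩
  · rcases mem_parts.1 hx with h | ⟨c, _, rfl⟩ | ⟨c, _, _, rfl⟩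
    · rcases mem_pairParts.1 h with h | ⟨y, _, rfl⟩
      · have := K.five_le x h
        omega
      · omega
    · omega
    · omega
  · rcases mem_parts.1 hx with h | ⟨c, hc, rfl⟩ | ⟨c, hc, hcA, rfl⟩ <;>
    rcases mem_parts.1 hy with h' | ⟨d, hd, rfl⟩ | ⟨d, hd, hdA, rfl⟩
    · exact K.pair_sep x h y h' hxy
    · have := cell_pair' (hA.1 hd) h
      omega
    · have := cell_pair' hd h
      omega
    · have := cell_pair' (hA.1 hc) h'
      omega
    · have := K.cell_sep c (hA.1 hc) d (hA.1 hd) (by omega)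
      omega
    · rcases Nat.lt_or_ge c d with h | h
      · have := K.cell_sep c (hA.1 hc) d hd h
        omega
      · have : c ≠ d := fun h => hdA (h ▸ hc)
        omega
    · have := cell_pair' hc h'
      omega
    · have := hA.add_three_le hc hcA hd (by omega)
      omega
    · have := K.cell_sep c hc d hd (by omega)
      omega
  · rcases mem_parts.1 hx with h | ⟨c, hc, rfl⟩ | ⟨c, hc, hcA, rfl⟩
    · exact K.not_dvd x h h3
    all_goals
      rcases mem_parts.1 hy with h' | ⟨d, hd, hd'⟩ | ⟨d, hd, hdA, hd'⟩
    · exact K.not_dvd _ h' (by omega)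
    · omega
    · have := K.cell_sep c (hA.1 hc) d hd (by omega)
      omega
    · exact K.not_dvd _ h' (by omega)
    · have := hA.add_three_le hc hcA hd (by omega)
      omega
    · omega

/-- The run below the odd bottom of a pair that is tightly linked to an odd singleton. -/
theorem Admissible.belowEven_of_gap (hA : K.Admissible A) {c : ℕ} (hc : c ∈ A) (a : ℕ)
    (hg : Gap K.bottoms a c) : BelowEven (K.parts A) (2 * a + 1) := by
  induction a using Nat.strong_induction_on with
  | _ a ih =>
    rw [belowEven_iff]
    intro n hn hmem
    -- The part `n = 2 * a - 2` below `2 * a + 1` is either the top of a pair, which prolongs the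
    -- gap downwards, or an even singleton linked to `c`, which admissibility excludes.
    have hnb : n ∉ K.bottoms := by
      intro h
      cases hg with
      | refl =>
        have := cell_bottom (hA.1 hc) h
        omega
      | step _ _ h' _ => exact K.disj n h (hn ▸ h')
    rcases mem_parts.1 hmem with h | ⟨d, hd, rfl⟩ | ⟨d, hd, hdA, rfl⟩
    · rcases mem_pairParts.1 h with h | ⟨y, hy, rfl⟩
      · exact absurd h hnb
      · have h5 := K.five_le y hy
        obtain ⟨b, rfl⟩ : ∃ b, a = b + 3 := ⟨a - 3, by omega⟩
        obtain rfl : y = 2 * b + 1 := by omega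
        have h1 := ih b (by omega) (.step _ _ hy hg)
        rw [belowEven_add_three, Classical.not_imp, not_not]
        exact ⟨paired_subset (mem_pairParts_of_mem hy), h1⟩
    · omega
    · obtain rfl : a = d + 2 := by omega
      exact absurd hc (hA.2 d c ⟨hd, hA.1 hc, hg⟩ hdA)

/-- Mirror image of `Admissible.belowEven_of_gap`: the run above an even singleton consists of whole
pairs, since ending in an odd singleton would need a forbidden link. The equation for `x` stands for
`x = 2 * a - 2`. -/
theorem Admissible.aboveEven_of_gap (hA : K.Admissible A) {c : ℕ} (hc : c ∈ K.cells)
    (hcA : c ∉ A) (a : ℕ) (ha : c + 2 ≤ a) (hg : Gap K.bottoms (c + 2) a) :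
    ∀ x, x + 2 = 2 * a → AboveEven (K.parts A) x := by
  obtain ⟨N, hN⟩ : ∃ N, ∀ b, N < b → 2 * b + 1 ∉ K.bottoms :=
    ⟨K.bottoms.sup id, fun b hb h => by
      have := Finset.le_sup (f := id) h
      simp only [id] at this
      omega⟩
  -- Each pair raises `a` by 3, and no bottom `2 * b + 1` has `b > N`, so this difference decreases.
  induction hk : N + 3 - a using Nat.strong_induction_on generalizing a with
  | _ k ih =>
    intro x hx
    rw [aboveEven_iff]
    intro hmem
    rcases mem_parts.1 hmem with h | ⟨d, hd, hd'⟩ | ⟨d, hd, hdA, hd'⟩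
    · rcases mem_pairParts.1 h with h | ⟨y, hy, hyx⟩
      · have h' : 2 * a + 1 ∈ K.bottoms := by convert h using 1; omega
        have haN : a ≤ N := by
          by_contra hlt
          exact hN a (by omega) h'
        have h1 := ih (N + 3 - (a + 3)) (by omega) (a + 3) (by omega) (hg.snoc h') rfl (x + 6)
          (by omega)
        rw [aboveEven_iff, Classical.not_imp, not_not]
        exact ⟨paired_subset (add_three_mem_pairParts h), h1⟩
      · exfalso
        obtain rfl : y = x := by omega
        have h1 := cell_bottom hc hy
        rcases hg.eq_or_snoc with h | ⟨b, -, hb, rfl⟩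
        · omega
        · exact K.disj _ hb (by convert hy using 1; omega)
    · obtain rfl : d = a := by omega
      exact absurd hd (hA.2 c d ⟨hc, hA.1 hd, hg⟩ hcA)
    · omega

/-- What continues the run after a pair with even bottom is again a pair with even bottom: the next
term has even parity, so it is no odd singleton, and an even singleton in that cell would be too
close to the pair. -/
theorem aboveEven_of_even_bottom (y : ℕ) (hy : y ∈ K.bottoms)
    (he : Even y) : AboveEven (K.parts A) (y + 3) := by
  obtain ⟨N, hN⟩ : ∃ N, ∀ b ∈ K.bottoms, b ≤ N :=
    ⟨K.bottoms.sup id, fun b hb => Finset.le_sup (f := id) hb⟩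
  induction hk : N - y using Nat.strong_induction_on generalizing y with
  | _ k ih =>
    have h1 := hN y hy
    rw [aboveEven_iff]
    intro hmem
    rcases mem_parts.1 hmem with h | ⟨d, hd, hd'⟩ | ⟨d, hd, hdA, hd'⟩
    · rcases mem_pairParts.1 h with h | ⟨z, hz, hzy⟩
      · have h2 := hN _ h
        have h3 := ih (N - (y + 6)) (by omega) (y + 6) h (by grind) rfl
        rw [aboveEven_iff, Classical.not_imp, not_not]
        exact ⟨paired_subset (add_three_mem_pairParts h), h3⟩
      · obtain rfl : z = y + 3 := by omega
        exact absurd hz (K.disj y hy)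
    · grind
    · have := cell_bottom hd hy
      omega

theorem Admissible.belowEven_of_even_bottom (hA : K.Admissible A) (y : ℕ) (hy : y ∈ K.bottoms)
    (he : Even y) : BelowEven (K.parts A) y := by
  induction y using Nat.strong_induction_on with
  | _ y ih =>
    rw [belowEven_iff]
    rintro n rfl hmem
    rcases mem_parts.1 hmem with h | ⟨d, hd, rfl⟩ | ⟨d, hd, hdA, rfl⟩
    · rcases mem_pairParts.1 h with h | ⟨z, hz, rfl⟩
      · exact absurd hy (K.disj n h)
      · have h3 := ih z (by omega) hz (by grind)
        rw [belowEven_add_three, Classical.not_imp, not_not]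
        exact ⟨paired_subset (mem_pairParts_of_mem hz), h3⟩
    · have := cell_bottom (hA.1 hd) hy
      omega
    · grind

/-- The partner of a paired part adds one to a run whose remainder has even length, or blocks the
end position that a singleton of that parity must occupy. -/
theorem Admissible.not_isUpperSingleton (hA : K.Admissible A) {x : ℕ} (hx : x ∈ K.paired) :
    ¬ IsUpperSingleton (K.parts A) x := by
  rw [isUpperSingleton_iff]
  rintro ⟨-, ⟨ho, ht, hb⟩ | ⟨he, hb, ha⟩⟩
  · rcases mem_pairParts.1 hx with h | ⟨z, hz, rfl⟩
    · exact ht (paired_subset (add_three_mem_pairParts h))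
    · exact (belowEven_add_three _ _).1 hb (paired_subset (mem_pairParts_of_mem hz))
        (hA.belowEven_of_even_bottom z hz (by grind))
  · rcases mem_pairParts.1 hx with h | ⟨z, hz, rfl⟩
    · exact (aboveEven_iff _ _).1 ha (paired_subset (add_three_mem_pairParts h))
        (aboveEven_of_even_bottom x h he)
    · exact hb z (paired_subset (mem_pairParts_of_mem hz)) rfl

theorem Admissible.isUpperSingleton_odd (hA : K.Admissible A) {c : ℕ} (hc : c ∈ A) :
    IsUpperSingleton (K.parts A) (2 * c + 1) := by
  rw [isUpperSingleton_iff]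
  refine ⟨odd_mem_parts hc, .inl ⟨by simp, fun h => ?_, hA.belowEven_of_gap hc c (.refl c)⟩⟩
  rcases mem_parts.1 h with h | ⟨d, hd, hd'⟩ | ⟨d, hd, hdA, hd'⟩
  · have := cell_pair' (hA.1 hc) h
    omega
  · omega
  · have := K.cell_sep c (hA.1 hc) d hd (by omega)
    omega

theorem Admissible.isUpperSingleton_even (hA : K.Admissible A) {c : ℕ} (hc : c ∈ K.cells)
    (hcA : c ∉ A) : IsUpperSingleton (K.parts A) (2 * c + 2) := by
  rw [isUpperSingleton_iff]
  refine ⟨even_mem_parts hc hcA, .inr ⟨by grind, fun b hb h => ?_,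
    hA.aboveEven_of_gap hc hcA (c + 2) le_rfl (.refl _) _ (by omega)⟩⟩
  rcases mem_parts.1 hb with h' | ⟨d, hd, hd'⟩ | ⟨d, hd, hdA, hd'⟩
  · have := cell_pair' hc h'
    omega
  · have := K.cell_sep d (hA.1 hd) c hc (by omega)
    omega
  · omega

theorem Admissible.isUpperSingleton_iff (hA : K.Admissible A) {x : ℕ} :
    IsUpperSingleton (K.parts A) x ↔
      (∃ c ∈ A, 2 * c + 1 = x) ∨ ∃ c ∈ K.cells, c ∉ A ∧ 2 * c + 2 = x := by
  constructor
  · intro h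
    rcases mem_parts.1 h.1 with h' | h'
    · exact absurd h (hA.not_isUpperSingleton h')
    · exact h'
  · rintro (⟨c, hc, rfl⟩ | ⟨c, hc, hcA, rfl⟩)
    · exact hA.isUpperSingleton_odd hc
    · exact hA.isUpperSingleton_even hc hcA

end Skeleton

/-! ### Recovering the skeleton of a Schur partition -/

/-- The part `x` belongs to a maximal progression of even length with an even bottom. -/
def IsEvenBottomRun (π : Finset ℕ) (x : ℕ) : Prop :=
  (Even x ↔ BelowEven π x) ∧ (Even x ↔ ¬ AboveEven π x)

open Classical in
/-- The smaller parts of the upper pairs of `π`. -/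
noncomputable def upperBottoms (π : Finset ℕ) : Finset ℕ :=
  π.filter (fun x => x + 3 ∈ π ∧ (Even x ↔ IsEvenBottomRun π x))

theorem mem_upperBottoms {π : Finset ℕ} {x : ℕ} : x ∈ upperBottoms π ↔
    x ∈ π ∧ x + 3 ∈ π ∧ (Even x ↔ IsEvenBottomRun π x) := by
  simp [upperBottoms]

/-- The parities alternate along a run while `IsEvenBottomRun` is a property of the whole run, so
two neighbours cannot both satisfy the parity condition. -/
theorem upperBottoms_disj {π : Finset ℕ} {x : ℕ} (hx : x ∈ upperBottoms π) :
    x + 3 ∉ upperBottoms π := by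
  intro hy
  simp only [mem_upperBottoms, IsEvenBottomRun] at hx hy
  have h1 := belowEven_add_three π x
  have h2 := aboveEven_iff π x
  have h3 : Even (x + 3) ↔ ¬ Even x := by grind
  rw [h3] at hy
  tauto

theorem mem_of_mem_pairParts_upperBottoms {π : Finset ℕ} {x : ℕ}
    (hx : x ∈ pairParts (upperBottoms π)) : x ∈ π := by
  rcases mem_pairParts.1 hx with h | ⟨y, hy, rfl⟩
  · exact (mem_upperBottoms.1 h).1
  · exact (mem_upperBottoms.1 hy).2.1

/-- Pairs have odd bottoms unless the run has even length and even bottom. With the recursions for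
the two run parities the claim is propositional; the cases are whether or not `x` is the bottom of
its run. -/
theorem mem_pairParts_upperBottoms_iff {π : Finset ℕ} {x : ℕ} (hx : x ∈ π) :
    x ∈ pairParts (upperBottoms π) ↔ ¬ IsUpperSingleton π x := by
  rw [mem_pairParts, isUpperSingleton_iff]
  have h1 := aboveEven_iff π x
  have h2 : Odd x ↔ ¬ Even x := by grind
  by_cases hb : ∃ y ∈ π, y + 3 = x
  · obtain ⟨y, hy, rfl⟩ := hb
    have h3 : Even (y + 3) ↔ ¬ Even y := by grind
    have h4 := aboveEven_iff π y
    have h5 := belowEven_add_three π y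
    have h6 : (∃ z ∈ upperBottoms π, z + 3 = y + 3) ↔ y ∈ upperBottoms π := by simp
    have h7 : ¬ ∀ b ∈ π, b + 3 ≠ y + 3 := fun h => h y hy rfl
    rw [h6]
    clear h6
    simp only [h2, h3, mem_upperBottoms, IsEvenBottomRun, h7, hx, hy, true_and, false_and,
      and_false, or_false, true_imp_iff] at *
    generalize (y + 3 + 3 ∈ π) = p1 at *
    generalize Even y = p2 at *
    generalize AboveEven π (y + 3) = p3 at *
    generalize AboveEven π (y + 3 + 3) = p4 at *
    generalize BelowEven π (y + 3) = p5 at *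
    generalize BelowEven π y = p6 at *
    generalize AboveEven π y = p7 at *
    clear * - h1 h4 h5
    grind
  · push Not at hb
    have h5 : BelowEven π x := (belowEven_iff π x).2 fun n hn hm => absurd hn (hb n hm)
    have h6 : ¬ ∃ z ∈ upperBottoms π, z + 3 = x := by
      rintro ⟨z, hz, hz'⟩
      exact hb z (mem_upperBottoms.1 hz).1 hz'
    rw [or_iff_left h6]
    clear h6
    simp only [h2, mem_upperBottoms, IsEvenBottomRun, hx, true_and, h5, iff_true] at *
    have h7 : (∀ b ∈ π, b + 3 ≠ x) ↔ True := by simpa using hb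
    simp only [h7, true_and]
    generalize (x + 3 ∈ π) = p1 at *
    generalize Even x = p2 at *
    generalize AboveEven π (x + 3) = p3 at *
    generalize AboveEven π x = p4 at *
    clear * - h1
    grind

theorem IsSchur.sep {π : Finset ℕ} (h : IsSchur π) {x y : ℕ} (hx : x ∈ π) (hy : y ∈ π)
    (hxy : x < y) : x + 3 ≤ y := h.2.1 x hx y hy hxy

theorem IsUpperSingleton.mem {π : Finset ℕ} {x : ℕ} (h : IsUpperSingleton π x) : x ∈ π := h.1

theorem IsUpperSingleton.odd {π : Finset ℕ} {c : ℕ} (h : IsUpperSingleton π (2 * c + 1)) :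
    2 * c + 4 ∉ π ∧ BelowEven π (2 * c + 1) := by
  rcases ((isUpperSingleton_iff _ _).1 h).2 with h | h
  · exact h.2
  · grind

theorem IsUpperSingleton.even {π : Finset ℕ} {c : ℕ} (h : IsUpperSingleton π (2 * c + 2)) :
    (∀ b ∈ π, b + 3 ≠ 2 * c + 2) ∧ AboveEven π (2 * c + 2) := by
  rcases ((isUpperSingleton_iff _ _).1 h).2 with h | h
  · grind
  · exact h.2

/-- Every pair in the gap adds two terms to the run, which leaves its parity unchanged. -/
theorem gap_upperBottoms {π : Finset ℕ} {a b : ℕ} (hg : Gap (upperBottoms π) a b)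
    (hb : BelowEven π (2 * b + 1)) : BelowEven π (2 * a + 1) := by
  induction hg with
  | refl a => exact hb
  | step a b h hg ih =>
    have h1 := ih hb
    obtain ⟨h2, h3, -⟩ := mem_upperBottoms.1 h
    have h4 := belowEven_add_three π (2 * a + 1)
    have h5 := belowEven_add_three π (2 * a + 1 + 3)
    rw [show 2 * (a + 3) + 1 = 2 * a + 1 + 3 + 3 by ring] at h1
    tauto

/-- Every Schur partition with parts at least `5` arises from a skeleton. -/
theorem IsSchur.exists_skeleton {π : Finset ℕ} (h : IsSchur π) (h5 : ∀ x ∈ π, 5 ≤ x) :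
    ∃ (K : Skeleton) (A : Finset ℕ), K.Admissible A ∧ K.parts A = π := by
  classical
  set T := (π.filter (IsUpperSingleton π)).image (fun x => (x - 1) / 2) with hT
  set A := (π.filter (fun x => IsUpperSingleton π x ∧ Odd x)).image (fun x => (x - 1) / 2) with hA
  have memT : ∀ c, c ∈ T ↔ IsUpperSingleton π (2 * c + 1) ∨ IsUpperSingleton π (2 * c + 2) := by
    intro c
    simp only [hT, Finset.mem_image, Finset.mem_filter]
    constructor
    · rintro ⟨x, ⟨hx, hs⟩, rfl⟩
      have := h5 x hx
      rcases Nat.even_or_odd' x with ⟨k, rfl | rfl⟩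
      · right
        convert hs using 1
        omega
      · left
        convert hs using 1
        omega
    · rintro (hs | hs)
      · exact ⟨_, ⟨hs.mem, hs⟩, by omega⟩
      · exact ⟨_, ⟨hs.mem, hs⟩, by omega⟩
  have memA : ∀ c, c ∈ A ↔ IsUpperSingleton π (2 * c + 1) := by
    intro c
    simp only [hA, Finset.mem_image, Finset.mem_filter]
    constructor
    · rintro ⟨x, ⟨hx, hs, k, rfl⟩, rfl⟩
      convert hs using 1
      omega
    · rintro hs
      exact ⟨_, ⟨hs.mem, hs, by simp⟩, by omega⟩
  have hAT : A ⊆ T := fun c hc => (memT c).2 (.inl ((memA c).1 hc))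
  have not_both : ∀ c, 2 * c + 1 ∈ π → 2 * c + 2 ∉ π := fun c h1 h2 => by
    have := h.sep h1 h2 (by omega)
    omega
  let K : Skeleton :=
    { bottoms := upperBottoms π
      cells := T
      five_le := fun x hx => h5 x (mem_upperBottoms.1 hx).1
      two_le := fun c hc => by
        rcases (memT c).1 hc with hs | hs <;> have := h5 _ hs.mem <;> omega
      pair_sep := fun x hx y hy => h.2.1 x (mem_of_mem_pairParts_upperBottoms hx) y
        (mem_of_mem_pairParts_upperBottoms hy)
      not_dvd := fun x hx h3 => by
        rcases mem_pairParts.1 hx with h' | ⟨y, hy, rfl⟩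
        · exact h.2.2 x (mem_upperBottoms.1 h').1 h3 (mem_upperBottoms.1 h').2.1
        · exact h.2.2 y (mem_upperBottoms.1 hy).1 (by omega) (mem_upperBottoms.1 hy).2.1
      disj := fun x hx => upperBottoms_disj hx
      cell_sep := fun c hc d hd hcd => by
        rcases (memT c).1 hc with hs | hs <;> rcases (memT d).1 hd with hs' | hs' <;>
          have := h.sep hs.mem hs'.mem (by omega)
        · omega
        · by_contra hlt
          obtain rfl : d = c + 1 := by omega
          exact hs.odd.1 hs'.mem
        · omega
        · omega
      cell_pair := fun c hc f hf => by
        have hf' := mem_of_mem_pairParts_upperBottoms hf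
        have hns := (mem_pairParts_upperBottoms_iff hf').1 hf
        rcases (memT c).1 hc with hs | hs
        · have hne : f ≠ 2 * c + 1 := fun h => hns (h ▸ hs)
          have hne' : f ≠ 2 * c + 4 := fun h => hs.odd.1 (h ▸ hf')
          rcases lt_or_gt_of_ne hne with hlt | hlt
          · have := h.sep hf' hs.mem hlt
            omega
          · have := h.sep hs.mem hf' hlt
            omega
        · have hne : f ≠ 2 * c + 2 := fun h => hns (h ▸ hs)
          have hne' := hs.even.1 f hf'
          rcases lt_or_gt_of_ne hne with hlt | hlt
          · have := h.sep hf' hs.mem hlt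
            omega
          · have := h.sep hs.mem hf' hlt
            omega }
  refine ⟨K, A, ⟨hAT, ?_⟩, ?_⟩
  · rintro c d ⟨hc, hd, hg⟩ hcA hdA
    have h1 : IsUpperSingleton π (2 * c + 2) :=
      ((memT c).1 hc).resolve_left fun hs => hcA ((memA c).2 hs)
    -- The run below an odd singleton is even, and removing the pairs of the gap keeps it even. But
    -- what remains is the single even part `2 * c + 2`, the bottom of its run.
    have h2 := gap_upperBottoms hg ((memA d).1 hdA).odd.2
    rw [show 2 * (c + 2) + 1 = 2 * c + 2 + 3 by ring, belowEven_add_three] at h2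
    exact h2 h1.mem ((belowEven_iff _ _).2 fun n hn hm => absurd hn (h1.even.1 n hm))
  · ext x
    rw [Skeleton.mem_parts]
    constructor
    · rintro (hx | ⟨c, hc, rfl⟩ | ⟨c, hc, hcA, rfl⟩)
      · exact mem_of_mem_pairParts_upperBottoms hx
      · exact ((memA c).1 hc).mem
      · exact (((memT c).1 hc).resolve_left fun hs => hcA ((memA c).2 hs)).mem
    · intro hx
      by_cases hs : IsUpperSingleton π x
      · right
        have := h5 x hx
        rcases Nat.even_or_odd' x with ⟨k, rfl | rfl⟩
        · obtain ⟨c, rfl⟩ : ∃ c, k = c + 1 := ⟨k - 1, by omega⟩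
          refine .inr ⟨c, (memT c).2 (.inr hs), fun hcA => ?_, by ring⟩
          exact not_both c ((memA c).1 hcA).mem hx
        · exact .inl ⟨k, (memA k).2 hs, rfl⟩
      · exact .inl ((mem_pairParts_upperBottoms_iff hx).2 hs)

/-! ### Chains of linked cells and the exchange of parities -/

theorem card_filter_rank_lt (s : Finset ℕ) (k : ℕ) (hk : k ≤ s.card) :
    (s.filter (fun d => (s.filter (· < d)).card < k)).card = k := by
  induction s using Finset.induction_on_max with
  | empty => simp at hk; simp [hk]
  | insert m s hm ih =>
    have hms : m ∉ s := fun h => lt_irrefl _ (hm m h)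
    have h1 : (insert m s).filter (· < m) = s := by
      ext x
      simp only [Finset.mem_filter, Finset.mem_insert]
      grind
    have h2 : ∀ d ∈ s, (insert m s).filter (· < d) = s.filter (· < d) := by
      intro d hd
      have := hm d hd
      ext x
      simp only [Finset.mem_filter, Finset.mem_insert]
      grind
    rw [Finset.card_insert_of_notMem hms] at hk
    rw [Finset.filter_insert, h1, Finset.filter_congr fun d hd => by rw [h2 d hd]]
    rcases Nat.lt_or_ge s.card k with h | h
    · rw [if_pos h, Finset.card_insert_of_notMem (by simp [hms])]
      rw [Finset.filter_true_of_mem]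
      · omega
      · intro d hd
        exact lt_of_le_of_lt (Finset.card_filter_le _ _) h
    · rw [if_neg (by omega), ih h]

namespace Skeleton

variable {K : Skeleton} {A : Finset ℕ}

/-- A pair with bottom `2 * a + 1` blocks the cells `a`, `a + 1` and `a + 2`, so a gap contains no
singleton cell except possibly its end. -/
theorem eq_of_gap {a b t : ℕ} (hg : Gap K.bottoms a b) (ht : t ∈ K.cells) (ha : a ≤ t)
    (hb : t ≤ b) : t = b := by
  induction hg with
  | refl a => omega
  | step a b h hg ih =>
    have := cell_bottom ht h
    exact ih (by omega) hb

theorem Link.between {c d t : ℕ} (h : K.Link c d) (ht : t ∈ K.cells) (hc : c ≤ t) (hd : t ≤ d) :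
    t = c ∨ t = d := by
  rcases Nat.eq_or_lt_of_le hc with h' | h'
  · exact .inl h'.symm
  · exact .inr (eq_of_gap h.2.2 ht (K.cell_sep c h.1 t ht h') hd)

/-- No singleton cell lies strictly between linked cells, so the link upwards goes to the next
singleton cell. With `link_leftUnique` this makes every component a chain. -/
theorem link_rightUnique : Relator.RightUnique K.Link := by
  intro c d e hd he
  have h1 := hd.lt
  have h2 := he.lt
  rcases le_total d e with h | h
  · have := he.between hd.2.1 (by omega) h
    omega
  · have := hd.between he.2.1 (by omega) h
    omega

theorem link_leftUnique : Relator.LeftUnique K.Link := by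
  intro c d e hc hd
  have h1 := hc.lt
  have h2 := hd.lt
  rcases le_total c d with h | h
  · have := hc.between hd.1 h (by omega)
    omega
  · have := hd.between hc.1 h (by omega)
    omega

/-- The cell `d` is reached from the cell `c` by tight links. -/
abbrev Reach (K : Skeleton) : ℕ → ℕ → Prop := Relation.ReflTransGen K.Link

/-- Two cells are in the same tight component. -/
abbrev Conn (K : Skeleton) : ℕ → ℕ → Prop := Relation.EqvGen K.Link

theorem Reach.le {c d : ℕ} (h : K.Reach c d) : c ≤ d := by
  induction h with
  | refl => exact le_rfl
  | tail _ h ih =>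
    have := h.lt
    omega

theorem Reach.conn {c d : ℕ} (h : K.Reach c d) : K.Conn c d := by
  induction h with
  | refl => exact .refl _
  | tail _ h ih => exact .trans _ _ _ ih (.rel _ _ h)

theorem Conn.reach {c d : ℕ} (h : K.Conn c d) : K.Reach c d ∨ K.Reach d c := by
  induction h with
  | rel a b h => exact .inl (.single h)
  | refl a => exact .inl .refl
  | symm a b _ ih => exact ih.symm
  | trans a b c _ _ ih1 ih2 =>
    rcases ih1 with h1 | h1 <;> rcases ih2 with h2 | h2
    · exact .inl (h1.trans h2)
    -- Both paths end in the same cell. Reversing the links turns left uniqueness into right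
    -- uniqueness.
    · have := Relation.ReflTransGen.total_of_right_unique
        (r := Function.swap K.Link) (fun x y z hy hz => link_leftUnique hy hz)
        (Relation.reflTransGen_swap.2 h1) (Relation.reflTransGen_swap.2 h2)
      exact this.symm.imp Relation.reflTransGen_swap.1 Relation.reflTransGen_swap.1
    · exact Relation.ReflTransGen.total_of_right_unique link_rightUnique h1 h2
    · exact .inr (h2.trans h1)

theorem Conn.reach_of_le {c d : ℕ} (h : K.Conn c d) (hle : c ≤ d) : K.Reach c d := by
  rcases h.reach with h | h
  · exact h
  · obtain rfl := le_antisymm hle (Reach.le h)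
    exact .refl

theorem Reach.between {c d t : ℕ} (h : K.Reach c d) (ht : t ∈ K.cells) (hc : c ≤ t)
    (hd : t ≤ d) : K.Reach c t := by
  induction h with
  | refl => obtain rfl := le_antisymm hc hd; exact .refl
  | @tail e f h' hl ih =>
    rcases le_total t e with h1 | h1
    · exact ih h1
    · rcases hl.between ht h1 hd with rfl | rfl
      · exact h'
      · exact h'.tail hl

theorem Admissible.reach (hA : K.Admissible A) {c d : ℕ} (h : K.Reach c d) (hc : c ∉ A) :
    d ∉ A := by
  induction h with
  | refl => exact hc
  | tail _ h ih => exact hA.2 _ _ h ih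

open Classical in
/-- The tight component of a cell. -/
noncomputable def comp (K : Skeleton) (c : ℕ) : Finset ℕ := K.cells.filter (K.Conn c)

theorem mem_comp {c d : ℕ} : d ∈ K.comp c ↔ d ∈ K.cells ∧ K.Conn c d := by
  simp [comp]

theorem Conn.comp_eq {c d : ℕ} (h : K.Conn c d) : K.comp c = K.comp d := by
  ext x
  simp only [mem_comp]
  exact and_congr_right fun _ => ⟨fun h' => .trans _ _ _ (.symm _ _ h) h', fun h' => .trans _ _ _ h h'⟩

theorem comp_eq_iff {c d : ℕ} (hd : d ∈ K.cells) : K.comp c = K.comp d ↔ K.Conn c d := by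
  refine ⟨fun h => ?_, Conn.comp_eq⟩
  have : d ∈ K.comp d := mem_comp.2 ⟨hd, .refl _⟩
  rw [← h] at this
  exact (mem_comp.1 this).2

/-- The number of cells of the component of `c` below `c`. -/
noncomputable def rank (K : Skeleton) (c : ℕ) : ℕ := ((K.comp c).filter (· < c)).card

open Classical in
/-- Exchange the numbers of odd and of even singletons in every tight component. -/
noncomputable def flip (K : Skeleton) (A : Finset ℕ) : Finset ℕ :=
  K.cells.filter (fun c => K.rank c < (K.comp c \ A).card)

theorem mem_flip {c : ℕ} : c ∈ K.flip A ↔ c ∈ K.cells ∧ K.rank c < (K.comp c \ A).card := by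
  simp [flip]

theorem rank_lt_rank {c d : ℕ} (hc : c ∈ K.cells) (h : K.Conn c d) (hlt : c < d) :
    K.rank c < K.rank d := by
  unfold rank
  rw [h.comp_eq]
  refine Finset.card_lt_card ⟨fun x hx => ?_, fun hsub => ?_⟩
  · simp only [Finset.mem_filter] at hx ⊢
    exact ⟨hx.1, hx.2.trans hlt⟩
  · have : c ∈ (K.comp d).filter (· < d) :=
      Finset.mem_filter.2 ⟨mem_comp.2 ⟨hc, .symm _ _ h⟩, hlt⟩
    have := (Finset.mem_filter.1 (hsub this)).2
    omega

/-- The flipped set is an initial part of every chain, so no cell outside it is linked to a higher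
cell inside it. -/
theorem Admissible.flip (_ : K.Admissible A) : K.Admissible (K.flip A) := by
  refine ⟨Finset.filter_subset _ _, fun c d h hc hd => hc ?_⟩
  have hcd : K.Conn c d := .rel _ _ h
  have h1 := h.lt
  have h2 := rank_lt_rank h.1 hcd (by omega)
  rw [mem_flip] at hd ⊢
  rw [hcd.comp_eq]
  exact ⟨h.1, h2.trans hd.2⟩

/-- An admissible set meets each chain in an initial part and is therefore determined by the number
of its cells there. This is why exchanging numbers suffices for an involution. -/
theorem Admissible.mem_iff_rank (hA : K.Admissible A) {c : ℕ} (hc : c ∈ K.cells) :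
    c ∈ A ↔ K.rank c < (K.comp c ∩ A).card := by
  unfold rank
  constructor
  · intro hcA
    refine Finset.card_lt_card ⟨fun d hd => ?_, fun hsub => ?_⟩
    · obtain ⟨hd, hlt⟩ := Finset.mem_filter.1 hd
      refine Finset.mem_inter.2 ⟨hd, by_contra fun hdA => ?_⟩
      exact hA.reach (Conn.reach_of_le (.symm _ _ (mem_comp.1 hd).2) hlt.le) hdA hcA
    · have : c ∈ K.comp c ∩ A := Finset.mem_inter.2 ⟨mem_comp.2 ⟨hc, .refl _⟩, hcA⟩
      have := (Finset.mem_filter.1 (hsub this)).2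
      omega
  · intro hlt
    by_contra hcA
    refine absurd (Finset.card_le_card ?_) (not_le.2 hlt)
    intro d hd
    obtain ⟨hd, hdA⟩ := Finset.mem_inter.1 hd
    refine Finset.mem_filter.2 ⟨hd, ?_⟩
    by_contra hle
    exact hA.reach (Conn.reach_of_le (mem_comp.1 hd).2 (not_lt.1 hle)) hcA hdA

theorem card_comp_inter_flip (c : ℕ) : (K.comp c ∩ K.flip A).card = (K.comp c \ A).card := by
  rw [← card_filter_rank_lt (K.comp c) (K.comp c \ A).card (Finset.card_le_card (Finset.sdiff_subset))]
  congr 1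
  ext d
  simp only [Finset.mem_inter, Finset.mem_filter, mem_flip]
  refine and_congr_right fun hd => ?_
  obtain ⟨hd, hcd⟩ := mem_comp.1 hd
  unfold rank
  rw [hcd.comp_eq]
  simp [hd]

theorem card_comp_sdiff_flip (c : ℕ) : (K.comp c \ K.flip A).card = (K.comp c ∩ A).card := by
  have h1 := Finset.card_inter_add_card_sdiff (K.comp c) A
  have h2 := Finset.card_inter_add_card_sdiff (K.comp c) (K.flip A)
  rw [card_comp_inter_flip] at h2
  omega

theorem Admissible.flip_flip (hA : K.Admissible A) : K.flip (K.flip A) = A := by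
  ext c
  rw [mem_flip, card_comp_sdiff_flip]
  constructor
  · rintro ⟨hc, h⟩
    exact (hA.mem_iff_rank hc).2 h
  · intro h
    exact ⟨hA.1 h, (hA.mem_iff_rank (hA.1 h)).1 h⟩

theorem card_flip : (K.flip A).card = (K.cells \ A).card := by
  classical
  have hf : ∀ X : Finset ℕ, X ⊆ K.cells →
      X.card = ∑ S ∈ K.cells.image K.comp, (X.filter (fun c => K.comp c = S)).card := by
    intro X hX
    exact Finset.card_eq_sum_card_fiberwise fun c hc => Finset.mem_image_of_mem _ (hX hc)
  -- Both cardinalities are summed over the components, where the exchange is known.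
  rw [hf (K.flip A) (Finset.filter_subset _ _), hf (K.cells \ A) Finset.sdiff_subset]
  refine Finset.sum_congr rfl fun S hS => ?_
  obtain ⟨c, hc, rfl⟩ := Finset.mem_image.1 hS
  have h1 : (K.flip A).filter (fun d => K.comp d = K.comp c) = K.comp c ∩ K.flip A := by
    ext d
    simp only [Finset.mem_filter, Finset.mem_inter, mem_comp, mem_flip]
    rw [eq_comm]
    have := @comp_eq_iff K c d
    tauto
  have h2 : (K.cells \ A).filter (fun d => K.comp d = K.comp c) = K.comp c \ A := by
    ext d
    simp only [Finset.mem_filter, Finset.mem_sdiff, mem_comp]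
    rw [eq_comm]
    have := @comp_eq_iff K c d
    tauto
  rw [h1, h2, card_comp_inter_flip]

end Skeleton

/-! ### Prolonging members of 𝒰 by single steps of 4 -/

theorem mem_prog {a d k x : ℕ} : x ∈ prog a d k ↔ ∃ i < k, a + d * i = x := by
  simp [prog]

theorem prog_succ (a d k : ℕ) : prog a d (k + 1) = insert (a + d * k) (prog a d k) := by
  simp [prog, Finset.range_add_one, Finset.image_insert]

theorem prog_succ' (a d k : ℕ) : prog a d (k + 1) = insert a (prog (a + d) d k) := by
  ext x
  simp only [Finset.mem_insert, mem_prog]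
  constructor
  · rintro ⟨i, hi, rfl⟩
    rcases i with _ | i
    · simp
    · exact .inr ⟨i, by omega, by ring⟩
  · rintro (rfl | ⟨i, hi, rfl⟩)
    · exact ⟨0, by omega, by simp⟩
    · exact ⟨i + 1, by omega, by ring⟩

theorem prog_one (a d : ℕ) : prog a d 1 = {a} := by
  simp [prog]

/-- A member of `𝒰` can be prolonged by `e + 4`, where `e` is its largest element. -/
theorem IsUpperSegment.insert_right {S : Finset ℕ} (hS : IsUpperSegment S) :
    ∀ e ∈ S, (∀ z ∈ S, z ≤ e) → IsUpperSegment (insert (e + 4) S) := by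
  induction hS with
  | primitiveOne o x y ho ho3 =>
    intro e he hmax
    have h1 := hmax (o + 4 * x + 5 + 4 * y)
      (Finset.mem_union_right _ (mem_prog.2 ⟨y, by omega, rfl⟩))
    have h2 : e ≤ o + 4 * x + 5 + 4 * y := by
      simp only [Finset.mem_union, mem_prog] at he
      omega
    -- Every form ends with a progression of difference 4 whose length is free, except a prefix
    -- extension, where the top belongs to the inner segment.
    have := IsUpperSegment.primitiveOne o x (y + 1) ho ho3
    rw [prog_succ _ _ (y + 1), Finset.union_insert] at this
    convert this using 2
    omega
  | primitiveTwo o x p y q ho ho3 hq hq3 hp hpe hy =>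
    intro e he hmax
    have h1 := hmax (q + 3 * p + 4 + 4 * (y - 1))
      (Finset.mem_union_right _ (mem_prog.2 ⟨y - 1, by omega, rfl⟩))
    have h2 : e ≤ q + 3 * p + 4 + 4 * (y - 1) := by
      simp only [Finset.mem_union, mem_prog] at he
      omega
    have := IsUpperSegment.primitiveTwo o x p (y + 1) q ho ho3 hq hq3 hp hpe (by omega)
    rw [prog_succ _ _ y, Finset.union_insert] at this
    convert this using 2
    omega
  | extendRight S e p y hS heS hmax he he3 hp hpe hy ih =>
    intro e' he' hmax'
    have h1 := hmax' (e + 3 * p + 4 + 4 * (y - 1))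
      (Finset.mem_union_right _ (mem_prog.2 ⟨y - 1, by omega, rfl⟩))
    have h2 : e' ≤ e + 3 * p + 4 + 4 * (y - 1) := by
      simp only [Finset.mem_union, mem_prog] at he'
      rcases he' with (he' | he') | he'
      · have := hmax e' he'
        omega
      · omega
      · omega
    have := IsUpperSegment.extendRight S e p (y + 1) hS heS hmax he he3 hp hpe (by omega)
    rw [prog_succ _ _ y, Finset.union_insert] at this
    convert this using 2
    omega
  | extendLeft S o o' k p hS hoS hmin ho ho3 ho' ho3' hp hpe ih =>
    intro e he hmax
    have h1 := hmax o (Finset.mem_union_right _ hoS)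
    have h2 : e ∈ S := by
      simp only [Finset.mem_union, mem_prog] at he
      rcases he with (he | he) | he
      · omega
      · omega
      · exact he
    have h3 := ih e h2 fun z hz => hmax z (Finset.mem_union_right _ hz)
    have := IsUpperSegment.extendLeft _ o o' k p h3 (Finset.mem_insert_of_mem hoS)
      (fun z hz => by
        rcases Finset.mem_insert.1 hz with rfl | hz
        · omega
        · exact hmin z hz) ho ho3 ho' ho3' hp hpe
    rwa [Finset.union_insert] at this

/-- A member of `𝒰` with smallest element `o + 4` can be prolonged by `o`. -/
theorem IsUpperSegment.insert_left {S : Finset ℕ} (hS : IsUpperSegment S) :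
    ∀ o, 3 < o → o + 4 ∈ S → (∀ z ∈ S, o + 4 ≤ z) → IsUpperSegment (insert o S) := by
  induction hS with
  | primitiveOne o x y ho ho3 =>
    intro u hu hmem hmin
    have h1 := hmin o (Finset.mem_union_left _ (mem_prog.2 ⟨0, by omega, by simp⟩))
    obtain rfl : u + 4 = o := by
      simp only [Finset.mem_union, mem_prog] at hmem
      omega
    have := IsUpperSegment.primitiveOne u (x + 1) y (by grind) hu
    rw [prog_succ' _ _ (x + 1), Finset.insert_union] at this
    convert this using 4
    ring
  | primitiveTwo o x p y q ho ho3 hq hq3 hp hpe hy =>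
    intro u hu hmem hmin
    have h1 := hmin o (Finset.mem_union_left _ (Finset.mem_union_left _
      (mem_prog.2 ⟨0, by omega, by simp⟩)))
    obtain rfl : u + 4 = o := by
      simp only [Finset.mem_union, mem_prog] at hmem
      omega
    have := IsUpperSegment.primitiveTwo u (x + 1) p y q (by grind) hu (by omega) hq3 hp hpe hy
    rwa [prog_succ' _ _ (x + 1), Finset.insert_union, Finset.insert_union] at this
  | extendRight S e p y hS heS hmax he he3 hp hpe hy ih =>
    intro u hu hmem hmin
    have h1 := hmin e (Finset.mem_union_left _ (Finset.mem_union_left _ heS))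
    have h2 : u + 4 ∈ S := by
      simp only [Finset.mem_union, mem_prog] at hmem
      rcases hmem with (hmem | hmem) | hmem
      · exact hmem
      · omega
      · omega
    have h3 := ih u hu h2 fun z hz =>
      hmin z (Finset.mem_union_left _ (Finset.mem_union_left _ hz))
    have := IsUpperSegment.extendRight _ e p y h3 (Finset.mem_insert_of_mem heS)
      (fun z hz => by
        rcases Finset.mem_insert.1 hz with rfl | hz
        · omega
        · exact hmax z hz) he he3 hp hpe hy
    rwa [Finset.insert_union, Finset.insert_union] at this
  | extendLeft S o o' k p hS hoS hmin ho ho3 ho' ho3' hp hpe ih =>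
    intro u hu hmem hmin'
    have h1 := hmin' o' (Finset.mem_union_left _ (Finset.mem_union_left _
      (mem_prog.2 ⟨0, by omega, by simp⟩)))
    obtain rfl : u + 4 = o' := by
      simp only [Finset.mem_union, mem_prog] at hmem
      rcases hmem with (hmem | hmem) | hmem
      · omega
      · omega
      · have := hmin _ hmem
        omega
    have := IsUpperSegment.extendLeft S o u (k + 1) p hS hoS hmin (by omega) ho3 (by grind) hu
      hp hpe
    rw [prog_succ' _ _ (k + 1), Finset.insert_union, Finset.insert_union] at this
    convert this using 5
    ring

/-! ### Members of 𝒰 as tight chains -/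

/-- The cells from `a` up to `b` are filled tightly by pairs `x, x + 3` with `x` odd. -/
inductive PairGap (S : Finset ℕ) : ℕ → ℕ → Prop
  | refl (a : ℕ) : PairGap S a a
  | step (a b : ℕ) (h : 2 * a + 1 ∈ S) (h' : 2 * a + 4 ∈ S) (hg : PairGap S (a + 3) b) :
      PairGap S a b

/-- A tight chain of elements `2 c + j` of `S`, with pairs in between. -/
inductive TightPath (S : Finset ℕ) (j : ℕ) : ℕ → ℕ → Prop
  | refl (c : ℕ) (h : 2 * c + j ∈ S) : TightPath S j c c
  | step (c d e : ℕ) (h : 2 * c + j ∈ S) (hg : PairGap S (c + 2) d) (hp : TightPath S j d e) :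
      TightPath S j c e

/-- A tight chain of odd elements followed by a tight chain of even elements. -/
def IsTightSegment (S : Finset ℕ) (c f : ℕ) : Prop :=
  ∃ d e, TightPath S 1 c d ∧ PairGap S (d + 2) e ∧ TightPath S 2 e f

section Tight

variable {S π : Finset ℕ} {j c d e f : ℕ}

theorem PairGap.mono (hS : S ⊆ π) (h : PairGap S c d) : PairGap π c d := by
  induction h with
  | refl a => exact .refl a
  | step a b h h' hg ih => exact .step a b (hS h) (hS h') ih

theorem TightPath.mono (hS : S ⊆ π) (h : TightPath S j c d) : TightPath π j c d := by
  induction h with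
  | refl c h => exact .refl c (hS h)
  | step c d e h hg hp ih => exact .step c d e (hS h) (hg.mono hS) ih

theorem IsTightSegment.mono (hS : S ⊆ π) (h : IsTightSegment S c f) : IsTightSegment π c f := by
  obtain ⟨d, e, h1, h2, h3⟩ := h
  exact ⟨d, e, h1.mono hS, h2.mono hS, h3.mono hS⟩

theorem TightPath.append (h : TightPath S j c d) (hg : PairGap S (d + 2) e)
    (h' : TightPath S j e f) : TightPath S j c f := by
  induction h with
  | refl c h => exact .step c e f h hg h'
  | step c d e h hg' hp ih => exact .step _ _ _ h hg' (ih hg)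

theorem PairGap.of_prog (a r : ℕ) (h : ∀ i < 2 * r, 2 * a + 1 + 3 * i ∈ S) :
    PairGap S a (a + 3 * r) := by
  induction r generalizing a with
  | zero => exact .refl a
  | succ r ih =>
    have h0 := h 0 (by omega)
    have h1 := h 1 (by omega)
    refine .step _ _ (by simpa using h0) (by simpa using h1) ?_
    rw [show a + 3 * (r + 1) = a + 3 + 3 * r by ring]
    refine ih (a + 3) fun i hi => ?_
    have := h (i + 2) (by omega)
    rwa [show 2 * (a + 3) + 1 + 3 * i = 2 * a + 1 + 3 * (i + 2) by ring]

theorem TightPath.of_prog (c k : ℕ) (h : ∀ i < k + 1, 2 * c + j + 4 * i ∈ S) :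
    TightPath S j c (c + 2 * k) := by
  induction k generalizing c with
  | zero => exact .refl c (by simpa using h 0)
  | succ k ih =>
    refine .step c (c + 2) _ (by simpa using h 0) (.refl _) ?_
    rw [show c + 2 * (k + 1) = c + 2 + 2 * k by ring]
    refine ih (c + 2) fun i hi => ?_
    have := h (i + 1) (by omega)
    rwa [show 2 * (c + 2) + j + 4 * i = 2 * c + j + 4 * (i + 1) by ring]

theorem TightPath.left_mem (h : TightPath S j c d) : 2 * c + j ∈ S := by
  cases h <;> assumption

theorem TightPath.right_mem (h : TightPath S j c d) : 2 * d + j ∈ S := by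
  induction h with
  | refl c h => exact h
  | step c d e h hg hp ih => exact ih

theorem IsTightSegment.left_mem (h : IsTightSegment S c f) : 2 * c + 1 ∈ S := by
  obtain ⟨d, e, h1, h2, h3⟩ := h
  exact h1.left_mem

theorem IsTightSegment.right_mem (h : IsTightSegment S c f) : 2 * f + 2 ∈ S := by
  obtain ⟨d, e, h1, h2, h3⟩ := h
  exact h3.right_mem

/-- The members of `𝒰` are tight chains from their smallest to their largest element. -/
theorem IsUpperSegment.isTightSegment (hS : IsUpperSegment S) :
    ∃ c f, 2 ≤ c ∧ IsTightSegment S c f ∧ ∀ x ∈ S, 2 * c + 1 ≤ x ∧ x ≤ 2 * f + 2 := by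
  induction hS with
  | primitiveOne o x y ho ho3 =>
    obtain ⟨c, rfl⟩ := ho
    refine ⟨c, c + 2 * x + 2 + 2 * y, by omega, ⟨c + 2 * x, c + 2 * x + 2, ?_, .refl _, ?_⟩, ?_⟩
    · exact .of_prog _ _ fun i hi => Finset.mem_union_left _ (mem_prog.2 ⟨i, hi, rfl⟩)
    · exact .of_prog _ _ fun i hi =>
        Finset.mem_union_right _ (mem_prog.2 ⟨i, hi, by ring⟩)
    · intro z hz
      simp only [Finset.mem_union, mem_prog] at hz
      rcases hz with ⟨i, hi, rfl⟩ | ⟨i, hi, rfl⟩ <;> omega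
  | primitiveTwo o x p y q ho ho3 hq hq3 hp hpe hy =>
    obtain ⟨c, rfl⟩ := ho
    obtain ⟨r, rfl⟩ := hpe
    obtain ⟨y, rfl⟩ : ∃ z, y = z + 1 := ⟨y - 1, by omega⟩
    subst hq
    refine ⟨c, c + 2 * x + 2 + 3 * r + 2 * y, by omega,
      ⟨c + 2 * x, c + 2 * x + 2 + 3 * r, ?_, ?_, ?_⟩, ?_⟩
    · exact .of_prog _ _ fun i hi => Finset.mem_union_left _ (Finset.mem_union_left _
        (mem_prog.2 ⟨i, hi, rfl⟩))
    · exact .of_prog _ _ fun i hi => Finset.mem_union_left _ (Finset.mem_union_right _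
        (mem_prog.2 ⟨i, by omega, by ring⟩))
    · exact .of_prog _ _ fun i hi =>
        Finset.mem_union_right _ (mem_prog.2 ⟨i, hi, by ring⟩)
    · intro z hz
      simp only [Finset.mem_union, mem_prog] at hz
      rcases hz with (⟨i, hi, rfl⟩ | ⟨i, hi, rfl⟩) | ⟨i, hi, rfl⟩ <;> omega
  | extendRight S e p y hS heS hmax he he3 hp hpe hy ih =>
    obtain ⟨c, f, hc, ⟨d, u, h1, h2, h3⟩, hb⟩ := ih
    obtain ⟨r, rfl⟩ := hpe
    obtain ⟨y, rfl⟩ : ∃ z, y = z + 1 := ⟨y - 1, by omega⟩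
    obtain rfl : e = 2 * f + 2 := le_antisymm (hb e heS).2 (hmax _ h3.right_mem)
    have hsub : S ⊆ S ∪ prog (2 * f + 2 + 3) 3 (r + r) ∪
        prog (2 * f + 2 + 3 * (r + r) + 4) 4 (y + 1) :=
      fun z hz => Finset.mem_union_left _ (Finset.mem_union_left _ hz)
    refine ⟨c, f + 2 + 3 * r + 2 * y, hc, ⟨d, u, h1.mono hsub, h2.mono hsub,
      (h3.mono hsub).append (e := f + 2 + 3 * r) ?_ ?_⟩, ?_⟩
    · exact .of_prog _ _ fun i hi => Finset.mem_union_left _ (Finset.mem_union_right _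
        (mem_prog.2 ⟨i, by omega, by ring⟩))
    · exact .of_prog _ _ fun i hi =>
        Finset.mem_union_right _ (mem_prog.2 ⟨i, hi, by ring⟩)
    · intro z hz
      have := (hb _ h3.right_mem).1
      simp only [Finset.mem_union, mem_prog] at hz
      rcases hz with (hz | hz) | hz
      · have := hb z hz
        omega
      · omega
      · omega
  | extendLeft S o o' k p hS hoS hmin ho ho3 ho' ho3' hp hpe ih =>
    obtain ⟨c, f, hc, ⟨d, u, h1, h2, h3⟩, hb⟩ := ih
    obtain ⟨r, rfl⟩ := hpe
    obtain ⟨c', rfl⟩ := ho'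
    obtain rfl : o = 2 * c + 1 := le_antisymm (hmin _ h1.left_mem) (hb o hoS).1
    obtain rfl : c = c' + 2 * k + 2 + 3 * r := by omega
    have hsub : S ⊆ prog (2 * c' + 1) 4 (k + 1) ∪ prog (2 * c' + 1 + 4 * k + 3 + 1) 3 (r + r) ∪ S :=
      Finset.subset_union_right
    refine ⟨c', f, by omega, ⟨d, u, TightPath.append (d := c' + 2 * k) ?_ ?_ (h1.mono hsub),
      h2.mono hsub, h3.mono hsub⟩, ?_⟩
    · exact .of_prog _ _ fun i hi => Finset.mem_union_left _ (Finset.mem_union_left _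
        (mem_prog.2 ⟨i, hi, rfl⟩))
    · exact .of_prog _ _ fun i hi => Finset.mem_union_left _ (Finset.mem_union_right _
        (mem_prog.2 ⟨i, by omega, by ring⟩))
    · intro z hz
      have := (hb _ h3.right_mem).1
      simp only [Finset.mem_union, mem_prog] at hz
      rcases hz with (hz | hz) | hz
      · omega
      · omega
      · have := hb z hz
        omega

theorem PairGap.eq_or_mem (h : PairGap S c d) : c = d ∨ 2 * c + 1 ∈ S := by
  cases h with
  | refl => exact .inl rfl
  | step _ _ h h' hg => exact .inr h

theorem PairGap.eq_or_mem' (h : PairGap S c d) : c = d ∨ ∃ x ∈ S, x + 2 = 2 * d := by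
  induction h with
  | refl => exact .inl rfl
  | step a b h h' hg ih =>
    rcases ih with rfl | ih
    · exact .inr ⟨_, h', by ring⟩
    · exact .inr ih

/-- Tight packing leaves no room: any part of the ambient Schur partition in this range must be one
of the listed ones. The following lemmas extend this, so a tight segment is an interval of the
partition and its end points determine it. -/
theorem PairGap.mem_of_between (hπ : IsSchur π) (hS : S ⊆ π) (h : PairGap S c d) {z : ℕ}
    (hz : z ∈ π) (hc : 2 * c + 1 ≤ z) (hd : z ≤ 2 * d) : z ∈ S := by
  induction h with
  | refl => omega
  | step a b h h' hg ih =>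
    rcases Nat.eq_or_lt_of_le hc with rfl | hlt
    · exact h
    · have h1 := hπ.sep (hS h) hz hlt
      rcases Nat.eq_or_lt_of_le h1 with rfl | hlt'
      · exact h'
      · have h2 := hπ.sep (hS h') hz (by omega)
        exact ih (by omega) hd

theorem mem_of_between_gap (hπ : IsSchur π) (hS : S ⊆ π) {j' : ℕ} (hj : 1 ≤ j) (hj' : 1 ≤ j')
    (hj2 : j ≤ 2) (hj2' : j' ≤ 2) (hc : 2 * c + j ∈ S) (hg : PairGap S (c + 2) d)
    (hd : 2 * d + j' ∈ S) {z : ℕ} (hz : z ∈ π) (hcz : 2 * c + j ≤ z) (hzd : z ≤ 2 * d + j') :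
    z ∈ S := by
  rcases Nat.eq_or_lt_of_le hcz with rfl | h1
  · exact hc
  · rcases Nat.eq_or_lt_of_le hzd with rfl | h2
    · exact hd
    · have h3 := hπ.sep (hS hc) hz h1
      have h4 := hπ.sep hz (hS hd) h2
      refine hg.mem_of_between hπ hS hz ?_ (by omega)
      by_contra h5
      rcases hg.eq_or_mem with rfl | h6
      · omega
      · have := hπ.sep hz (hS h6) (by omega)
        omega

theorem TightPath.mem_of_between (hπ : IsSchur π) (hS : S ⊆ π) (hj : 1 ≤ j) (hj2 : j ≤ 2)
    (h : TightPath S j c d) {z : ℕ} (hz : z ∈ π) (hc : 2 * c + j ≤ z) (hd : z ≤ 2 * d + j) :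
    z ∈ S := by
  induction h with
  | refl c h =>
    obtain rfl := le_antisymm hc hd
    exact h
  | step c d e h hg hp ih =>
    rcases le_total z (2 * d + j) with h1 | h1
    · exact mem_of_between_gap hπ hS hj hj hj2 hj2 h hg hp.left_mem hz hc h1
    · exact ih h1 hd

theorem IsTightSegment.mem_of_between (hπ : IsSchur π) (hS : S ⊆ π) (h : IsTightSegment S c f)
    {z : ℕ} (hz : z ∈ π) (hc : 2 * c + 1 ≤ z) (hd : z ≤ 2 * f + 2) : z ∈ S := by
  obtain ⟨d, e, h1, h2, h3⟩ := h
  rcases le_total z (2 * d + 1) with h4 | h4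
  · exact h1.mem_of_between hπ hS le_rfl (by omega) hz hc h4
  · rcases le_total z (2 * e + 2) with h5 | h5
    · exact mem_of_between_gap hπ hS le_rfl (by omega) (by omega) le_rfl h1.right_mem h2
        h3.left_mem hz h4 h5
    · exact h3.mem_of_between hπ hS (by omega) le_rfl hz h5 hd

end Tight

/-! ### Tight chains in a partition follow the links of its skeleton -/

theorem PairGap.belowEven {π : Finset ℕ} {a b : ℕ} (h : PairGap π a b)
    (ha : BelowEven π (2 * a + 1)) : BelowEven π (2 * b + 1) := by
  induction h with
  | refl => exact ha
  | step a b h h' hg ih =>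
    refine ih ?_
    have h1 := belowEven_add_three π (2 * a + 1)
    have h2 := belowEven_add_three π (2 * a + 1 + 3)
    rw [show 2 * (a + 3) + 1 = 2 * a + 1 + 3 + 3 by ring]
    tauto

theorem PairGap.aboveEven {π : Finset ℕ} {a b : ℕ} (h : PairGap π a b)
    (hb : ∀ x, x + 2 = 2 * b → AboveEven π x) : ∀ x, x + 2 = 2 * a → AboveEven π x := by
  induction h with
  | refl => exact hb
  | step a b h h' hg ih =>
    intro x hx
    have h1 := ih hb (x + 6) (by omega)
    have h2 := aboveEven_iff π x
    have h3 := aboveEven_iff π (x + 3)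
    have h4 : x + 3 ∈ π := by convert h using 1; omega
    have h5 : x + 3 + 3 ∈ π := by convert h' using 1; omega
    tauto

namespace Skeleton

variable {K : Skeleton} {A : Finset ℕ}

theorem Admissible.odd_single_iff (hA : K.Admissible A) {c : ℕ} :
    IsUpperSingleton (K.parts A) (2 * c + 1) ↔ c ∈ A := by
  rw [hA.isUpperSingleton_iff]
  constructor
  · rintro (⟨d, hd, h⟩ | ⟨d, hd, hdA, h⟩)
    · obtain rfl : d = c := by omega
      exact hd
    · omega
  · exact fun h => .inl ⟨c, h, rfl⟩

theorem Admissible.even_single_iff (hA : K.Admissible A) {c : ℕ} :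
    IsUpperSingleton (K.parts A) (2 * c + 2) ↔ c ∈ K.cells ∧ c ∉ A := by
  rw [hA.isUpperSingleton_iff]
  constructor
  · rintro (⟨d, hd, h⟩ | ⟨d, hd, hdA, h⟩)
    · omega
    · obtain rfl : d = c := by omega
      exact ⟨hd, hdA⟩
  · exact fun h => .inr ⟨c, h.1, h.2, rfl⟩

theorem Admissible.not_odd_and_even (hA : K.Admissible A) {c : ℕ} (h1 : 2 * c + 1 ∈ K.parts A)
    (h2 : 2 * c + 2 ∈ K.parts A) : False := by
  have := hA.isSchur.sep h1 h2 (by omega)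
  omega

/-- An odd singleton is the top of its run, so `2 * a + 1` is paired. It may be the upper part of a
pair with even bottom, in which case the progression is paired with the opposite phase; run parity
later excludes this. -/
theorem Admissible.mem_bottoms_or (hA : K.Admissible A) {a : ℕ} (h : 2 * a + 1 ∈ K.parts A)
    (h' : 2 * a + 4 ∈ K.parts A) :
    2 * a + 1 ∈ K.bottoms ∨ ∃ y ∈ K.bottoms, Even y ∧ y + 3 = 2 * a + 1 := by
  rcases mem_parts.1 h with h1 | h1
  · rcases mem_pairParts.1 h1 with h2 | ⟨y, hy, hya⟩
    · exact .inl h2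
    · exact .inr ⟨y, hy, by grind, hya⟩
  · have h2 := hA.isUpperSingleton_iff.2 (h1.imp_right id)
    exact absurd h' h2.odd.1

/-- `PairGap` records only which parts are present, whereas `Gap` requires them to be paired in this
phase. An even run below the start fixes the phase, since above an even-bottom pair's lower part
that run is odd. -/
theorem Admissible.gap_of_belowEven (hA : K.Admissible A) {a b : ℕ}
    (h : PairGap (K.parts A) a b) (ha : BelowEven (K.parts A) (2 * a + 1)) :
    Gap K.bottoms a b := by
  induction h with
  | refl => exact .refl _
  | step a b h h' hg ih =>
    refine .step a b ?_ (ih ?_)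
    · refine (hA.mem_bottoms_or h h').resolve_right ?_
      rintro ⟨y, hy, he, hya⟩
      rw [← hya, belowEven_add_three] at ha
      exact ha (paired_subset (mem_pairParts_of_mem hy)) (hA.belowEven_of_even_bottom y hy he)
    · exact (PairGap.step a (a + 3) h h' (.refl _)).belowEven ha

theorem Admissible.gap_of_aboveEven (hA : K.Admissible A) {a b : ℕ}
    (h : PairGap (K.parts A) a b) (hb : ∀ x, x + 2 = 2 * b → AboveEven (K.parts A) x) :
    Gap K.bottoms a b := by
  induction h with
  | refl => exact .refl _
  | step a b h h' hg ih =>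
    refine .step a b ?_ (ih hb)
    refine (hA.mem_bottoms_or h h').resolve_right ?_
    rintro ⟨y, hy, he, hya⟩
    have h1 := hg.aboveEven hb (2 * a + 1 + 3) (by ring)
    have h2 := aboveEven_of_even_bottom (A := A) y hy he
    rw [hya, aboveEven_iff] at h2
    exact h2 h' h1

theorem Admissible.reach_of_oddPath (hA : K.Admissible A) {c d : ℕ}
    (h : TightPath (K.parts A) 1 c d) (hc : c ∈ A) (hd : 2 * d + 4 ∉ K.parts A) :
    d ∈ A ∧ K.Reach c d := by
  induction h with
  | refl => exact ⟨hc, .refl⟩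
  | step c d e h hg hp ih =>
    have h1 : BelowEven (K.parts A) (2 * (c + 2) + 1) := by
      rw [show 2 * (c + 2) + 1 = 2 * c + 2 + 3 by ring, belowEven_add_three]
      exact fun h' => (hA.not_odd_and_even h h').elim
    -- The path continues with `2 * d + 5`, so a part `2 * d + 4` would be too close. Hence `2 * d +
    -- 1` is the top of its run and an odd singleton.
    have h2 : 2 * d + 4 ∉ K.parts A := by
      intro h2
      cases hp with
      | refl => exact hd h2
      | step _ f _ h' hg' hp' =>
        rcases hg'.eq_or_mem with rfl | h3
        · have := hA.isSchur.sep h2 hp'.left_mem (by omega)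
          omega
        · have := hA.isSchur.sep h2 h3 (by omega)
          omega
    have h3 : d ∈ A := hA.odd_single_iff.1 ((AlladiSchur.isUpperSingleton_iff _ _).2
      ⟨hp.left_mem, .inl ⟨by simp, h2, hg.belowEven h1⟩⟩)
    obtain ⟨h4, h5⟩ := ih h3 hd
    exact ⟨h4, .head ⟨hA.1 hc, hA.1 h3, hA.gap_of_belowEven hg h1⟩ h5⟩

/-- Here the singletons are recognized from above: tightness makes every even element the bottom of
its run, and the run above it consists of pairs only. -/
theorem Admissible.reach_of_evenPath (hA : K.Admissible A) {e f : ℕ}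
    (h : TightPath (K.parts A) 2 e f) (hf : f ∈ K.cells) (hfA : f ∉ A)
    (he : ∀ b ∈ K.parts A, b + 3 ≠ 2 * e + 2) : (e ∈ K.cells ∧ e ∉ A) ∧ K.Reach e f := by
  induction h with
  | refl => exact ⟨⟨hf, hfA⟩, .refl⟩
  | step c d e h hg hp ih =>
    have h1 : ∀ x, x + 2 = 2 * d → AboveEven (K.parts A) x := by
      intro x hx
      rw [aboveEven_iff]
      intro h'
      refine (hA.not_odd_and_even (c := d) ?_ hp.left_mem).elim
      convert h' using 1
      omega
    have h2 : ∀ b ∈ K.parts A, b + 3 ≠ 2 * d + 2 := by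
      intro b hb hbd
      rcases hg.eq_or_mem' with rfl | ⟨x, hx, hxd⟩
      · have := hA.isSchur.sep h hb (by omega)
        omega
      · have := hA.isSchur.sep hx hb (by omega)
        omega
    obtain ⟨h3, h4⟩ := ih hf hfA h2
    have h5 := hA.even_single_iff.1 ((AlladiSchur.isUpperSingleton_iff _ _).2
      ⟨h, .inr ⟨by grind, he, hg.aboveEven h1 _ (by ring)⟩⟩)
    exact ⟨h5, .head ⟨h5.1, h3.1, hA.gap_of_aboveEven hg h1⟩ h4⟩

/-- A tight segment between singletons follows the tight links. -/
theorem Admissible.reach_of_isTightSegment (hA : K.Admissible A) {c f : ℕ}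
    (h : IsTightSegment (K.parts A) c f) (hc : c ∈ A) (hf : f ∈ K.cells) (hfA : f ∉ A) :
    K.Reach c f := by
  obtain ⟨d, e, h1, h2, h3⟩ := h
  have hd : 2 * d + 4 ∉ K.parts A := by
    intro h4
    rcases h2.eq_or_mem with rfl | h5
    · have := hA.isSchur.sep h4 h3.left_mem (by omega)
      omega
    · have := hA.isSchur.sep h4 h5 (by omega)
      omega
  have he : ∀ b ∈ K.parts A, b + 3 ≠ 2 * e + 2 := by
    intro b hb hbd
    rcases h2.eq_or_mem' with rfl | ⟨x, hx, hxd⟩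
    · have := hA.isSchur.sep h1.right_mem hb (by omega)
      omega
    · have := hA.isSchur.sep hx hb (by omega)
      omega
  obtain ⟨h4, h5⟩ := hA.reach_of_oddPath h1 hc hd
  obtain ⟨h6, h7⟩ := hA.reach_of_evenPath h3 hf hfA he
  refine h5.trans (.head ⟨hA.1 h4, h6.1, hA.gap_of_belowEven h2 ?_⟩ h7)
  rw [show 2 * (d + 2) + 1 = 2 * d + 2 + 3 by ring, belowEven_add_three]
  exact fun h' => (hA.not_odd_and_even h1.right_mem h').elim

/-! ### Intervals between linked singletons belong to 𝒰 -/

theorem gap_run {B : Finset ℕ} {a b : ℕ} (h : Gap B a b) :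
    ∃ r, b = a + 3 * r ∧ ∀ i < 2 * r, 2 * a + 1 + 3 * i ∈ pairParts B := by
  induction h with
  | refl a => exact ⟨0, by simp⟩
  | step a b h hg ih =>
    obtain ⟨r, rfl, hr⟩ := ih
    refine ⟨r + 1, by ring, fun i hi => ?_⟩
    match i with
    | 0 => exact mem_pairParts_of_mem h
    | 1 => exact add_three_mem_pairParts h
    | i + 2 =>
      have := hr i (by omega)
      rwa [show 2 * (a + 3) + 1 + 3 * i = 2 * a + 1 + 3 * (i + 2) by ring] at this

/-- The parts between two linked singletons. -/
theorem Link.exists_run (hA : K.Admissible A) {c d j j' : ℕ} (h : K.Link c d) (hj : 1 ≤ j)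
    (hj' : 1 ≤ j') (hj2 : j ≤ 2) (hj2' : j' ≤ 2) (hc : 2 * c + j ∈ K.parts A)
    (hd : 2 * d + j' ∈ K.parts A) : ∃ r, d = c + 2 + 3 * r ∧ (0 < r → ¬ 3 ∣ 2 * c + 2) ∧
      ∀ z, (z ∈ K.parts A ∧ 2 * c + j ≤ z ∧ z ≤ 2 * d + j') ↔
        z = 2 * c + j ∨ z ∈ prog (2 * c + 5) 3 (2 * r) ∨ z = 2 * d + j' := by
  obtain ⟨r, rfl, hr⟩ := gap_run h.2.2
  refine ⟨r, rfl, fun hr0 h3 => ?_, fun z => ?_⟩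
  -- A nonempty gap starts with the paired part `2 * c + 5`, which is congruent to `2 * c + 2`
  -- modulo 3.
  · exact K.not_dvd _ (hr 0 (by omega)) (by omega)
  · have hsub : insert (2 * c + j) (insert (2 * (c + 2 + 3 * r) + j')
        (prog (2 * c + 5) 3 (2 * r))) ⊆ K.parts A := by
      intro z hz
      simp only [Finset.mem_insert, mem_prog] at hz
      rcases hz with rfl | rfl | ⟨i, hi, rfl⟩
      · exact hc
      · exact hd
      · refine paired_subset ?_
        have := hr i hi
        rwa [show 2 * (c + 2) + 1 + 3 * i = 2 * c + 5 + 3 * i by ring] at this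
    constructor
    · rintro ⟨hz, hcz, hzd⟩
      have := mem_of_between_gap (S := insert (2 * c + j) (insert (2 * (c + 2 + 3 * r) + j')
        (prog (2 * c + 5) 3 (2 * r)))) hA.isSchur hsub hj hj' hj2 hj2' (by simp)
        (PairGap.of_prog (c + 2) r fun i hi => Finset.mem_insert_of_mem
          (Finset.mem_insert_of_mem (mem_prog.2 ⟨i, hi, by ring⟩))) (by simp) hz hcz hzd
      simp only [Finset.mem_insert] at this
      tauto
    · intro hz
      refine ⟨hsub (by simp only [Finset.mem_insert]; tauto), ?_⟩
      rw [mem_prog] at hz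
      rcases hz with rfl | ⟨i, hi, rfl⟩ | rfl <;> omega

/-- The parts from the odd singleton in the cell `c` to the even singleton in the cell `f`. -/
def slice (K : Skeleton) (A : Finset ℕ) (c f : ℕ) : Finset ℕ :=
  (K.parts A).filter (fun x => 2 * c + 1 ≤ x ∧ x ≤ 2 * f + 2)

theorem mem_slice {c f x : ℕ} :
    x ∈ K.slice A c f ↔ x ∈ K.parts A ∧ 2 * c + 1 ≤ x ∧ x ≤ 2 * f + 2 := by
  simp [slice]

/-- The link at which the chain changes from odd to even gives a primitive segment, of the first
form when the gap is empty and of the second when it contains `r > 0` pairs. -/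
theorem isUpperSegment_slice_link (hA : K.Admissible A) {c d : ℕ} (h : K.Link c d) (hc : c ∈ A)
    (hd : d ∉ A) : IsUpperSegment (K.slice A c d) := by
  obtain ⟨r, hr, h3, hz⟩ := h.exists_run hA (j := 1) (j' := 2) le_rfl (by omega) (by omega) le_rfl
    (odd_mem_parts hc) (even_mem_parts h.2.1 hd)
  have h2 := K.two_le c h.1
  rcases Nat.eq_zero_or_pos r with rfl | hr0
  · convert IsUpperSegment.primitiveOne (2 * c + 1) 0 0 (by simp) (by omega) using 1
    ext z
    rw [mem_slice, hz]
    have : z ∉ prog (2 * c + 5) 3 (2 * 0) := by simp [prog]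
    simp only [Finset.mem_union, zero_add, prog_one, Finset.mem_singleton]
    rw [show 2 * c + 1 + 4 * 0 + 5 = 2 * d + 2 by omega]
    tauto
  · convert IsUpperSegment.primitiveTwo (2 * c + 1) 0 (2 * r) 1 (2 * c + 2) (by simp) (by omega)
      (by ring) (h3 hr0) (by omega) (by simp) one_pos using 1
    ext z
    rw [mem_slice, hz]
    simp only [Finset.mem_union, zero_add, prog_one, Finset.mem_singleton]
    rw [show 2 * c + 2 + 3 * (2 * r) + 4 = 2 * d + 2 by omega, show 2 * c + 2 + 3 = 2 * c + 5 by ring]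
    tauto

/-- A link between even singletons is a step of 4 if its gap is empty, and otherwise an instance of
the suffix rule with `p = 2 * r` and `y = 1`. -/
theorem isUpperSegment_slice_right (hA : K.Admissible A) {c d e : ℕ} (hcd : c ≤ d)
    (hS : IsUpperSegment (K.slice A c d)) (hd : d ∉ A) (h : K.Link d e) :
    IsUpperSegment (K.slice A c e) := by
  have he := hA.2 d e h hd
  obtain ⟨r, hr, h3, hz⟩ := h.exists_run hA (j := 2) (j' := 2) (by omega) (by omega) le_rfl le_rfl
    (even_mem_parts h.1 hd) (even_mem_parts h.2.1 he)
  have hdS : 2 * d + 2 ∈ K.slice A c d :=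
    mem_slice.2 ⟨even_mem_parts h.1 hd, by omega, le_rfl⟩
  have hmax : ∀ z ∈ K.slice A c d, z ≤ 2 * d + 2 := fun z hz => (mem_slice.1 hz).2.2
  have key : ∀ z, z ∈ K.slice A c e ↔
      z ∈ K.slice A c d ∨ z ∈ prog (2 * d + 5) 3 (2 * r) ∨ z = 2 * e + 2 := by
    intro z
    have h1 := hz z
    rw [mem_slice, mem_slice]
    constructor
    · rintro ⟨hp, hl, hu⟩
      rcases le_or_gt z (2 * d + 2) with h4 | h4
      · exact .inl ⟨hp, hl, h4⟩
      · exact .inr ((h1.1 ⟨hp, h4.le, hu⟩).resolve_left h4.ne')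
    · rintro (⟨hp, hl, hu⟩ | h4)
      · exact ⟨hp, hl, by omega⟩
      · obtain ⟨hp, hl, hu⟩ := h1.2 (.inr h4)
        exact ⟨hp, by omega, hu⟩
  rcases Nat.eq_zero_or_pos r with rfl | hr0
  · convert hS.insert_right (2 * d + 2) hdS hmax using 1
    ext z
    rw [key, Finset.mem_insert]
    simp only [mul_zero, mem_prog, not_lt_zero, false_and, exists_false, false_or]
    rw [show 2 * e + 2 = 2 * d + 2 + 4 by omega]
    tauto
  · convert IsUpperSegment.extendRight _ (2 * d + 2) (2 * r) 1 hS hdS hmax (by grind) (h3 hr0)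
      (by omega) (by simp) one_pos using 1
    ext z
    rw [key]
    simp only [Finset.mem_union, prog_one, Finset.mem_singleton]
    rw [show 2 * d + 2 + 3 * (2 * r) + 4 = 2 * e + 2 by omega, show 2 * d + 2 + 3 = 2 * d + 5 by ring]
    tauto

/-- A link between odd singletons is a step of 4 if its gap is empty, and otherwise an instance of
the prefix rule with `k = 0` and `p = 2 * r`. -/
theorem isUpperSegment_slice_left (hA : K.Admissible A) {c d e : ℕ} (hde : d ≤ e)
    (hS : IsUpperSegment (K.slice A d e)) (hc : c ∈ A) (hd : d ∈ A) (h : K.Link c d) :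
    IsUpperSegment (K.slice A c e) := by
  obtain ⟨r, hr, h3, hz⟩ := h.exists_run hA (j := 1) (j' := 1) le_rfl le_rfl (by omega) (by omega)
    (odd_mem_parts hc) (odd_mem_parts hd)
  have h2 := K.two_le c h.1
  have hdS : 2 * d + 1 ∈ K.slice A d e :=
    mem_slice.2 ⟨odd_mem_parts hd, le_rfl, by omega⟩
  have hmin : ∀ z ∈ K.slice A d e, 2 * d + 1 ≤ z := fun z hz => (mem_slice.1 hz).2.1
  have key : ∀ z, z ∈ K.slice A c e ↔
      z = 2 * c + 1 ∨ z ∈ prog (2 * c + 5) 3 (2 * r) ∨ z ∈ K.slice A d e := by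
    intro z
    have h1 := hz z
    rw [mem_slice, mem_slice]
    constructor
    · rintro ⟨hp, hl, hu⟩
      rcases le_or_gt (2 * d + 1) z with h4 | h4
      · exact .inr (.inr ⟨hp, h4, hu⟩)
      · rcases h1.1 ⟨hp, hl, h4.le⟩ with h5 | h5 | h5
        · exact .inl h5
        · exact .inr (.inl h5)
        · exact absurd h5 h4.ne
    · rintro (h4 | h4 | ⟨hp, hl, hu⟩)
      · obtain ⟨hp, hl, hu⟩ := h1.2 (.inl h4)
        exact ⟨hp, hl, by omega⟩
      · obtain ⟨hp, hl, hu⟩ := h1.2 (.inr (.inl h4))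
        exact ⟨hp, hl, by omega⟩
      · exact ⟨hp, by omega, hu⟩
  rcases Nat.eq_zero_or_pos r with rfl | hr0
  · convert hS.insert_left (2 * c + 1) (by omega) (by convert hdS using 1; omega)
      (fun z hz => by have := hmin z hz; omega) using 1
    ext z
    rw [key, Finset.mem_insert]
    simp only [mul_zero, mem_prog, not_lt_zero, false_and, exists_false, false_or]
  · convert IsUpperSegment.extendLeft _ (2 * d + 1) (2 * c + 1) 0 (2 * r) hS hdS hmin (by omega)
      (by have := h3 hr0; omega) (by simp) (by omega) (by omega) (by simp) using 1
    ext z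
    rw [key]
    simp only [Finset.mem_union, zero_add, prog_one, Finset.mem_singleton, mul_zero, add_zero]
    rw [show 2 * c + 1 + 3 + 1 = 2 * c + 5 by ring]
    tauto

theorem isUpperSegment_slice_reach_right (hA : K.Admissible A) {c d e : ℕ} (hcd : c ≤ d)
    (hS : IsUpperSegment (K.slice A c d)) (hd : d ∉ A) (h : K.Reach d e) :
    IsUpperSegment (K.slice A c e) := by
  induction h with
  | refl => exact hS
  | tail h hl ih =>
    exact isUpperSegment_slice_right hA (hcd.trans (Reach.le h)) ih (hA.reach h hd) hl

/-- The slices between tightly connected odd and even singletons are in `𝒰`. -/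
theorem isUpperSegment_slice (hA : K.Admissible A) {c f : ℕ} (h : K.Reach c f) (hc : c ∈ A)
    (hf : f ∉ A) : IsUpperSegment (K.slice A c f) := by
  induction h using Relation.ReflTransGen.head_induction_on with
  | refl => exact absurd hc hf
  | @head c d hl h ih =>
    by_cases hd : d ∈ A
    · exact isUpperSegment_slice_left hA (Reach.le h) (ih hd) hc hd hl
    · have := hl.lt
      exact isUpperSegment_slice_reach_right hA (by omega)
        (isUpperSegment_slice_link hA hl hc hd) hd h

end Skeleton

/-! ### Longest segments and full slices -/

/-- The interval of a Schur partition between an odd and an even singleton has the same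
singletons. -/
theorem isUpperSingleton_interval {π S : Finset ℕ} {l u : ℕ} (hπ : IsSchur π) (hl : Odd l)
    (hu : Even u) (hls : IsUpperSingleton π l) (hus : IsUpperSingleton π u)
    (hS : ∀ x, x ∈ S ↔ x ∈ π ∧ l ≤ x ∧ x ≤ u) {x : ℕ} (hx : x ∈ S) :
    IsUpperSingleton S x ↔ IsUpperSingleton π x := by
  -- At an odd singleton the run removed below has even length, and at an even singleton so does the
  -- run removed above. Cutting there preserves all run parities inside.
  have hl' : BelowEven π l := by
    have := ((isUpperSingleton_iff _ _).1 hls).2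
    grind
  have hu' : AboveEven π u := by
    have := ((isUpperSingleton_iff _ _).1 hus).2
    grind
  have hbelow : ∀ x ∈ S, BelowEven S x ↔ BelowEven π x := by
    intro x
    induction x using Nat.strong_induction_on with
    | _ x ih =>
      intro hx
      obtain ⟨hx, h1, h2⟩ := (hS x).1 hx
      rcases Nat.eq_or_lt_of_le h1 with rfl | h3
      · refine iff_of_true ((belowEven_iff _ _).2 fun n hn hm => ?_) hl'
        have := ((hS n).1 hm).2.1
        omega
      · have h4 := hπ.sep hls.mem hx h3
        rw [belowEven_iff, belowEven_iff]
        refine forall₂_congr fun n hn => ?_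
        have h5 : n ∈ S ↔ n ∈ π := by
          rw [hS, and_iff_left_iff_imp]
          omega
        rw [← h5]
        exact imp_congr_right fun hm => not_congr (ih n (by omega) hm)
  have habove : ∀ k, ∀ x ∈ S, u - x = k → (AboveEven S x ↔ AboveEven π x) := by
    intro k
    induction k using Nat.strong_induction_on with
    | _ k ih =>
      intro x hx hk
      obtain ⟨hx, h1, h2⟩ := (hS x).1 hx
      rcases Nat.eq_or_lt_of_le h2 with rfl | h3
      · refine iff_of_true ((aboveEven_iff _ _).2 fun hm => ?_) hu'
        have := ((hS _).1 hm).2.2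
        omega
      · have h4 := hπ.sep hx hus.mem h3
        rw [aboveEven_iff, aboveEven_iff π]
        have h5 : x + 3 ∈ S ↔ x + 3 ∈ π := by
          rw [hS, and_iff_left_iff_imp]
          omega
        rw [← h5]
        exact imp_congr_right fun hm => not_congr (ih _ (by omega) _ hm rfl)
  obtain ⟨hxπ, h1, h2⟩ := (hS x).1 hx
  rw [isUpperSingleton_iff, isUpperSingleton_iff, hbelow x hx, habove _ x hx rfl]
  refine and_congr (iff_of_true hx hxπ) (or_congr (and_congr_right fun ho => and_congr_left' ?_)
    (and_congr_right fun he => and_congr_left' ?_))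
  · rw [hS, not_iff_not, and_iff_left_iff_imp]
    intro _
    have h3 : x ≠ u := by rintro rfl; grind
    have := hπ.sep hxπ hus.mem (by omega)
    omega
  · refine ⟨fun h b hb hbx => h b ?_ hbx, fun h b hb => h b ((hS b).1 hb).1⟩
    have h3 : x ≠ l := by rintro rfl; grind
    have := hπ.sep hls.mem hxπ (by omega)
    exact (hS b).2 ⟨hb, by omega, by omega⟩

namespace Skeleton

variable {K : Skeleton} {A : Finset ℕ}

theorem Admissible.isSegmentOf_slice (hA : K.Admissible A) {c f : ℕ} (hc : c ∈ A)
    (hf : f ∈ K.cells) (hfA : f ∉ A) (h : K.Reach c f) :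
    IsSegmentOf (K.parts A) (K.slice A c f) := by
  refine ⟨isUpperSegment_slice hA h hc hfA, Finset.filter_subset _ _, fun x hx hx' => ?_⟩
  have hle := Reach.le h
  obtain ⟨-, h1, h2⟩ := mem_slice.1 hx
  rcases hx' with h3 | h3
  · have := h3 (2 * c + 1) (mem_slice.2 ⟨odd_mem_parts hc, le_rfl, by omega⟩)
    obtain rfl : x = 2 * c + 1 := by omega
    exact hA.isUpperSingleton_odd hc
  · have := h3 (2 * f + 2) (mem_slice.2 ⟨even_mem_parts hf hfA, by omega, le_rfl⟩)
    obtain rfl : x = 2 * f + 2 := by omega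
    exact hA.isUpperSingleton_even hf hfA

/-- A member of 𝒰 is a tight chain, so when its ends are singletons it follows links, and having no
room inside it is the whole interval. -/
theorem Admissible.exists_slice (hA : K.Admissible A) {S : Finset ℕ}
    (hS : IsSegmentOf (K.parts A) S) :
    ∃ c f, c ∈ A ∧ f ∈ K.cells ∧ f ∉ A ∧ K.Reach c f ∧ S = K.slice A c f := by
  obtain ⟨hU, hsub, hend⟩ := hS
  obtain ⟨c, f, -, ht, hb⟩ := hU.isTightSegment
  have hc := hA.odd_single_iff.1 (hend _ ht.left_mem (.inl fun z hz => (hb z hz).1))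
  have hf := hA.even_single_iff.1 (hend _ ht.right_mem (.inr fun z hz => (hb z hz).2))
  refine ⟨c, f, hc, hf.1, hf.2, hA.reach_of_isTightSegment (ht.mono hsub) hc hf.1 hf.2, ?_⟩
  ext x
  rw [mem_slice]
  exact ⟨fun hx => ⟨hsub hx, hb x hx⟩,
    fun hx => ht.mem_of_between hA.isSchur hsub hx.1 hx.2.1 hx.2.2⟩

/-- The slice between `c` and `f` contains all singletons of its component. -/
structure IsFullSlice (K : Skeleton) (A : Finset ℕ) (c f : ℕ) : Prop where
  left_mem : c ∈ A
  right_mem : f ∈ K.cells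
  right_notMem : f ∉ A
  reach : K.Reach c f
  left_le : ∀ d ∈ K.comp c, d ∈ A → c ≤ d
  le_right : ∀ d ∈ K.comp c, d ∉ A → d ≤ f

/-- An odd singleton of the chain below the left end, or an even one above the right end, would give
a strictly larger segment. -/
theorem Admissible.isFullSlice (hA : K.Admissible A) {S : Finset ℕ}
    (hS : IsLongestSegmentOf (K.parts A) S) : ∃ c f, K.IsFullSlice A c f ∧ S = K.slice A c f := by
  obtain ⟨c, f, hc, hf, hfA, hr, rfl⟩ := hA.exists_slice hS.1
  have hle := Reach.le hr
  refine ⟨c, f, ⟨hc, hf, hfA, hr, fun d hd hdA => ?_, fun d hd hdA => ?_⟩, rfl⟩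
  · by_contra hlt
    have h1 : K.Reach d c := Conn.reach_of_le (.symm _ _ (mem_comp.1 hd).2) (by omega)
    have h2 := hS.2 _ (hA.isSegmentOf_slice hdA hf hfA (h1.trans hr)) fun x hx => by
      rw [mem_slice] at hx ⊢
      exact ⟨hx.1, by omega, hx.2.2⟩
    have h3 : 2 * d + 1 ∈ K.slice A d f := mem_slice.2 ⟨odd_mem_parts hdA, le_rfl, by omega⟩
    rw [h2, mem_slice] at h3
    omega
  · by_contra hlt
    have h0 : K.Conn f d := .trans _ _ _ (.symm _ _ (Reach.conn hr)) (mem_comp.1 hd).2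
    have h1 : K.Reach f d := Conn.reach_of_le h0 (by omega)
    have h2 := hS.2 _ (hA.isSegmentOf_slice hc (mem_comp.1 hd).1 hdA (hr.trans h1)) fun x hx => by
      rw [mem_slice] at hx ⊢
      exact ⟨hx.1, hx.2.1, by omega⟩
    have h3 : 2 * d + 2 ∈ K.slice A c d :=
      mem_slice.2 ⟨even_mem_parts (mem_comp.1 hd).1 hdA, by omega, le_rfl⟩
    rw [h2, mem_slice] at h3
    omega

theorem IsFullSlice.isLongest (hA : K.Admissible A) {c f : ℕ} (h : K.IsFullSlice A c f) :
    IsLongestSegmentOf (K.parts A) (K.slice A c f) := by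
  refine ⟨hA.isSegmentOf_slice h.left_mem h.right_mem h.right_notMem h.reach, fun T hT hsub => ?_⟩
  obtain ⟨c', f', hc, hf, hfA, hr, rfl⟩ := hA.exists_slice hT
  have hle := Reach.le h.reach
  have h1 := (mem_slice.1 (hsub (mem_slice.2
    ⟨odd_mem_parts h.left_mem, le_rfl, by omega⟩ : 2 * c + 1 ∈ K.slice A c f))).2
  have h2 := (mem_slice.1 (hsub (mem_slice.2
    ⟨even_mem_parts h.right_mem h.right_notMem, by omega, le_rfl⟩ : 2 * f + 2 ∈ K.slice A c f))).2
  have h3 : K.Reach c' c := Reach.between hr (hA.1 h.left_mem) (by omega) (by omega)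
  have h4 := h.left_le c' (mem_comp.2 ⟨hA.1 hc, .symm _ _ (Reach.conn h3)⟩) hc
  have h5 := h.le_right f' (mem_comp.2 ⟨hf, .trans _ _ _ (.symm _ _ (Reach.conn h3))
    (Reach.conn hr)⟩) hfA
  obtain rfl : c' = c := by omega
  obtain rfl : f' = f := by omega
  rfl

theorem Admissible.exists_isFullSlice (hA : K.Admissible A) {d : ℕ}
    (ho : (K.comp d ∩ A).Nonempty) (he : (K.comp d \ A).Nonempty) :
    ∃ c f, K.IsFullSlice A c f ∧ K.comp d = K.comp c := by
  obtain ⟨c, hc, hmin⟩ := Finset.exists_min_image _ id ho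
  obtain ⟨f, hf, hmax⟩ := Finset.exists_max_image _ id he
  obtain ⟨hc, hcA⟩ := Finset.mem_inter.1 hc
  obtain ⟨hf, hfA⟩ := Finset.mem_sdiff.1 hf
  have hcd := (mem_comp.1 hc).2
  have hcf : K.Conn c f := .trans _ _ _ (.symm _ _ hcd) (mem_comp.1 hf).2
  refine ⟨c, f, ⟨hcA, (mem_comp.1 hf).1, hfA, ?_, fun e he heA => ?_, fun e he heA => ?_⟩,
    hcd.comp_eq⟩
  -- Odd singletons precede even ones in a chain, so the path must go up from `c` to `f`.
  · refine hcf.reach.resolve_right fun h => hA.reach h hfA hcA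
  · rw [← hcd.comp_eq] at he
    exact hmin e (Finset.mem_inter.2 ⟨he, heA⟩)
  · rw [← hcd.comp_eq] at he
    exact hmax e (Finset.mem_sdiff.2 ⟨he, heA⟩)

section FullSlice

variable {c f d : ℕ}

theorem IsFullSlice.mem_slice_odd (hA : K.Admissible A) (h : K.IsFullSlice A c f) (hd : d ∈ A) :
    2 * d + 1 ∈ K.slice A c f ↔ d ∈ K.comp c := by
  rw [mem_slice]
  constructor
  · rintro ⟨-, h1, h2⟩
    exact mem_comp.2 ⟨hA.1 hd, Reach.conn (Reach.between h.reach (hA.1 hd) (by omega) (by omega))⟩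
  · intro hdc
    have h1 := h.left_le d hdc hd
    refine ⟨odd_mem_parts hd, by omega, ?_⟩
    by_contra hlt
    have h0 : K.Conn f d := .trans _ _ _ (.symm _ _ (Reach.conn h.reach)) (mem_comp.1 hdc).2
    exact hA.reach (Conn.reach_of_le h0 (by omega)) h.right_notMem hd

theorem IsFullSlice.mem_slice_even (hA : K.Admissible A) (h : K.IsFullSlice A c f)
    (hd : d ∈ K.cells) (hdA : d ∉ A) : 2 * d + 2 ∈ K.slice A c f ↔ d ∈ K.comp c := by
  rw [mem_slice]
  constructor
  · rintro ⟨-, h1, h2⟩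
    exact mem_comp.2 ⟨hd, Reach.conn (Reach.between h.reach hd (by omega) (by omega))⟩
  · intro hdc
    have h1 := h.le_right d hdc hdA
    refine ⟨even_mem_parts hd hdA, ?_, by omega⟩
    by_contra hlt
    exact hA.reach (Conn.reach_of_le (.symm _ _ (mem_comp.1 hdc).2) (by omega)) hdA h.left_mem

theorem IsFullSlice.isUpperSingleton_slice (hA : K.Admissible A) (h : K.IsFullSlice A c f) {x : ℕ}
    (hx : x ∈ K.slice A c f) :
    IsUpperSingleton (K.slice A c f) x ↔ IsUpperSingleton (K.parts A) x :=
  isUpperSingleton_interval hA.isSchur (by simp) (by grind) (hA.isUpperSingleton_odd h.left_mem)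
    (hA.isUpperSingleton_even h.right_mem h.right_notMem) (fun _ => mem_slice) hx

theorem IsFullSlice.oddSingletons (hA : K.Admissible A) (h : K.IsFullSlice A c f) :
    oddSingletons (K.slice A c f) = (K.comp c ∩ A).image (fun d => 2 * d + 1) := by
  ext x
  simp only [AlladiSchur.oddSingletons, Finset.mem_filter, Finset.mem_image, Finset.mem_inter]
  constructor
  · rintro ⟨hx, ⟨d, rfl⟩, hs⟩
    have hd := hA.odd_single_iff.1 ((h.isUpperSingleton_slice hA hx).1 hs)
    exact ⟨d, ⟨(h.mem_slice_odd hA hd).1 hx, hd⟩, rfl⟩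
  · rintro ⟨d, ⟨hd, hdA⟩, rfl⟩
    have hx := (h.mem_slice_odd hA hdA).2 hd
    exact ⟨hx, by simp, (h.isUpperSingleton_slice hA hx).2 (hA.isUpperSingleton_odd hdA)⟩

theorem IsFullSlice.evenSingletons (hA : K.Admissible A) (h : K.IsFullSlice A c f) :
    evenSingletons (K.slice A c f) = (K.comp c \ A).image (fun d => 2 * d + 2) := by
  ext x
  simp only [AlladiSchur.evenSingletons, Finset.mem_filter, Finset.mem_image, Finset.mem_sdiff]
  constructor
  · rintro ⟨hx, he, hs⟩
    have hs' := (h.isUpperSingleton_slice hA hx).1 hs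
    rcases hA.isUpperSingleton_iff.1 hs' with ⟨d, hd, rfl⟩ | ⟨d, hd, hdA, rfl⟩
    · grind
    · exact ⟨d, ⟨(h.mem_slice_even hA hd hdA).1 hx, hdA⟩, rfl⟩
  · rintro ⟨d, ⟨hd, hdA⟩, rfl⟩
    have hdT := (mem_comp.1 hd).1
    have hx := (h.mem_slice_even hA hdT hdA).2 hd
    exact ⟨hx, by grind, (h.isUpperSingleton_slice hA hx).2 (hA.isUpperSingleton_even hdT hdA)⟩

/-! ### The reduction rule in terms of ranks -/

theorem card_filter_image_two_mul (s : Finset ℕ) (j : ℕ) (p : ℕ → Prop) [DecidablePred p] :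
    ((s.image (fun d => 2 * d + j)).filter p).card = (s.filter (fun d => p (2 * d + j))).card := by
  rw [Finset.filter_image, Finset.card_image_of_injective]
  intro a b hab
  simpa using hab

theorem card_image_two_mul (s : Finset ℕ) (j : ℕ) :
    (s.image (fun d => 2 * d + j)).card = s.card :=
  Finset.card_image_of_injective _ fun a b hab => by simpa using hab

/-- All cells of the chain below an odd one are odd, so the rank counts odd cells only. This turns
"among the largest odd singletons" into a condition on the rank. -/
theorem Admissible.rank_of_mem (hA : K.Admissible A) (hd : d ∈ A) :
    K.rank d + 1 + ((K.comp d ∩ A).filter (fun e => d < e)).card = (K.comp d ∩ A).card := by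
  have h1 : (K.comp d).filter (· < d) = (K.comp d ∩ A).filter (· < d) := by
    ext e
    simp only [Finset.mem_filter, Finset.mem_inter]
    refine ⟨fun ⟨he, hlt⟩ => ⟨⟨he, by_contra fun heA => ?_⟩, hlt⟩, fun ⟨he, hlt⟩ => ⟨he.1, hlt⟩⟩
    exact hA.reach (Conn.reach_of_le (.symm _ _ (mem_comp.1 he).2) hlt.le) heA hd
  have h2 : (K.comp d ∩ A) = insert d
      ((K.comp d ∩ A).filter (· < d) ∪ (K.comp d ∩ A).filter (fun e => d < e)) := by
    ext e
    simp only [Finset.mem_insert, Finset.mem_union, Finset.mem_filter]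
    constructor
    · intro he
      rcases lt_trichotomy e d with h | h | h
      · exact .inr (.inl ⟨he, h⟩)
      · exact .inl h
      · exact .inr (.inr ⟨he, h⟩)
    · rintro (rfl | h | h)
      · exact Finset.mem_inter.2 ⟨mem_comp.2 ⟨hA.1 hd, .refl _⟩, hd⟩
      · exact h.1
      · exact h.1
  unfold rank
  conv_rhs => rw [h2]
  rw [Finset.card_insert_of_notMem (by simp), Finset.card_union_of_disjoint, h1]
  · ring
  · rw [Finset.disjoint_left]
    intro e he he'
    simp only [Finset.mem_filter] at he he'
    omega

/-- All odd cells of the chain lie below an even one. -/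
theorem Admissible.rank_of_notMem (hA : K.Admissible A) (hdA : d ∉ A) :
    K.rank d = (K.comp d ∩ A).card + ((K.comp d \ A).filter (· < d)).card := by
  rw [← Finset.card_union_of_disjoint]
  · unfold rank
    congr 1
    ext e
    simp only [Finset.mem_filter, Finset.mem_union, Finset.mem_inter, Finset.mem_sdiff]
    constructor
    · rintro ⟨he, hlt⟩
      by_cases heA : e ∈ A
      · exact .inl ⟨he, heA⟩
      · exact .inr ⟨⟨he, heA⟩, hlt⟩
    · rintro (⟨he, heA⟩ | ⟨⟨he, heA⟩, hlt⟩)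
      · refine ⟨he, by_contra fun hle => ?_⟩
        exact hA.reach (Conn.reach_of_le (mem_comp.1 he).2 (by omega)) hdA heA
      · exact ⟨he, hlt⟩
  · rw [Finset.disjoint_left]
    intro e he he'
    simp only [Finset.mem_filter, Finset.mem_inter, Finset.mem_sdiff] at he he'
    exact he'.1.2 he.2

-- The condition for the shift 2 compares the odd cells above `d` plus all even cells with all odd
-- cells. By `Admissible.rank_of_mem` it says that the rank is at least the number of even cells,
-- which is the failure of membership in the flip.
open Classical in
theorem IsFullSlice.rhoShift_odd (hA : K.Admissible A) (h : K.IsFullSlice A c f) (hd : d ∈ A)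
    (hx : 2 * d + 1 ∈ K.slice A c f) :
    rhoShift (K.slice A c f) (2 * d + 1) = if d ∈ K.flip A then 3 else 2 := by
  have hdc := (h.mem_slice_odd hA hd).1 hx
  have hr := hA.rank_of_mem hd
  unfold rhoShift
  rw [h.oddSingletons hA, h.evenSingletons hA, card_filter_image_two_mul,
    card_filter_image_two_mul, card_image_two_mul, card_image_two_mul, (mem_comp.1 hdc).2.comp_eq]
  rw [(mem_comp.1 hdc).2.comp_eq] at hdc
  have h1 : 2 * d + 1 ∈ (K.comp d ∩ A).image (fun d => 2 * d + 1) :=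
    Finset.mem_image.2 ⟨d, Finset.mem_inter.2 ⟨hdc, hd⟩, rfl⟩
  have h2 : 2 * d + 1 ∉ (K.comp d \ A).image (fun d => 2 * d + 2) := by
    simp only [Finset.mem_image, not_exists, not_and]
    omega
  simp only [h1, h2, true_and, false_and, if_false, mem_flip, hA.1 hd, add_lt_add_iff_right,
    Nat.mul_lt_mul_left two_pos]
  split_ifs <;> omega

-- By `Admissible.rank_of_notMem` the condition for the shift 4 says that the rank is less than the
-- number of even cells, which is membership in the flip.
open Classical in
theorem IsFullSlice.rhoShift_even (hA : K.Admissible A) (h : K.IsFullSlice A c f)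
    (hd : d ∈ K.cells) (hdA : d ∉ A) (hx : 2 * d + 2 ∈ K.slice A c f) :
    rhoShift (K.slice A c f) (2 * d + 2) = if d ∈ K.flip A then 4 else 3 := by
  have hdc := (h.mem_slice_even hA hd hdA).1 hx
  have hr := hA.rank_of_notMem hdA
  unfold rhoShift
  rw [h.oddSingletons hA, h.evenSingletons hA, card_filter_image_two_mul,
    card_filter_image_two_mul, card_image_two_mul, card_image_two_mul, (mem_comp.1 hdc).2.comp_eq]
  rw [(mem_comp.1 hdc).2.comp_eq] at hdc
  have h1 : 2 * d + 2 ∈ (K.comp d \ A).image (fun d => 2 * d + 2) :=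
    Finset.mem_image.2 ⟨d, Finset.mem_sdiff.2 ⟨hdc, hdA⟩, rfl⟩
  have h2 : 2 * d + 2 ∉ (K.comp d ∩ A).image (fun d => 2 * d + 1) := by
    simp only [Finset.mem_image, not_exists, not_and]
    omega
  simp only [h1, h2, true_and, false_and, if_false, mem_flip, hd, add_lt_add_iff_right,
    Nat.mul_lt_mul_left two_pos]
  split_ifs <;> omega

end FullSlice

open Classical in
theorem Admissible.schurShift_odd (hA : K.Admissible A) {d : ℕ} (hd : d ∈ A) :
    schurShift (K.parts A) (2 * d + 1) = if d ∈ K.flip A then 3 else 2 := by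
  unfold schurShift
  by_cases h : ∃ S, IsLongestSegmentOf (K.parts A) S ∧ 2 * d + 1 ∈ S
  · rw [dif_pos h]
    -- Any longest segment is a full slice, so the value does not depend on the choice.
    obtain ⟨c, f, hf, hS⟩ := hA.isFullSlice h.choose_spec.1
    have hx := h.choose_spec.2
    rw [hS] at hx ⊢
    exact hf.rhoShift_odd hA hd hx
  · rw [dif_neg h, if_neg (hA.isUpperSingleton_odd hd).2, if_pos (by simp), if_neg]
    intro hdf
    have h1 : d ∈ K.comp d := mem_comp.2 ⟨hA.1 hd, .refl _⟩
    obtain ⟨c, f, hf, hcd⟩ := hA.exists_isFullSlice ⟨d, Finset.mem_inter.2 ⟨h1, hd⟩⟩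
      (Finset.card_pos.1 (lt_of_le_of_lt (Nat.zero_le _) (mem_flip.1 hdf).2))
    exact h ⟨_, hf.isLongest hA, (hf.mem_slice_odd hA hd).2 (hcd ▸ h1)⟩

open Classical in
theorem Admissible.schurShift_even (hA : K.Admissible A) {d : ℕ} (hd : d ∈ K.cells)
    (hdA : d ∉ A) : schurShift (K.parts A) (2 * d + 2) = if d ∈ K.flip A then 4 else 3 := by
  unfold schurShift
  by_cases h : ∃ S, IsLongestSegmentOf (K.parts A) S ∧ 2 * d + 2 ∈ S
  · rw [dif_pos h]
    obtain ⟨c, f, hf, hS⟩ := hA.isFullSlice h.choose_spec.1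
    have hx := h.choose_spec.2
    rw [hS] at hx ⊢
    exact hf.rhoShift_even hA hd hdA hx
  · rw [dif_neg h, if_neg (hA.isUpperSingleton_even hd hdA).2, if_neg (by grind), if_pos]
    have h1 : d ∈ K.comp d := mem_comp.2 ⟨hd, .refl _⟩
    -- Outside all segments the chain of an even singleton has no odd cell, so every one of its
    -- cells is flipped.
    have h2 : K.comp d ∩ A = ∅ := by
      by_contra hne
      obtain ⟨c, f, hf, hcd⟩ := hA.exists_isFullSlice (Finset.nonempty_iff_ne_empty.2 hne)
        ⟨d, Finset.mem_sdiff.2 ⟨h1, hdA⟩⟩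
      exact h ⟨_, hf.isLongest hA, (hf.mem_slice_even hA hd hdA).2 (hcd ▸ h1)⟩
    rw [mem_flip, hA.rank_of_notMem hdA, h2, Finset.card_empty, zero_add]
    refine ⟨hd, Finset.card_lt_card ⟨Finset.filter_subset _ _, fun hsub => ?_⟩⟩
    have := (Finset.mem_filter.1 (hsub (Finset.mem_sdiff.2 ⟨h1, hdA⟩))).2
    omega

theorem Admissible.schurShift_paired (hA : K.Admissible A) {x : ℕ} (hx : x ∈ K.paired) :
    schurShift (K.parts A) x = 3 := by
  have hns := hA.not_isUpperSingleton hx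
  unfold schurShift
  by_cases h : ∃ S, IsLongestSegmentOf (K.parts A) S ∧ x ∈ S
  · rw [dif_pos h]
    obtain ⟨c, f, hf, hS⟩ := hA.isFullSlice h.choose_spec.1
    have hxS := h.choose_spec.2
    rw [hS] at hxS ⊢
    have h1 : ¬ IsUpperSingleton (K.slice A c f) x := fun h' =>
      hns ((hf.isUpperSingleton_slice hA hxS).1 h')
    unfold rhoShift
    rw [if_neg, if_neg]
    · rintro ⟨h2, -⟩
      simp only [evenSingletons, Finset.mem_filter] at h2
      exact h1 h2.2.2
    · rintro ⟨h2, -⟩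
      simp only [oddSingletons, Finset.mem_filter] at h2
      exact h1 h2.2.2
  · rw [dif_neg h, if_pos (not_not.1 fun h' => hns ⟨paired_subset hx, h'⟩)]

/-- The Schur reduction map exchanges the numbers of odd and even singletons in the tight
components, up to a translation by `3`. -/
theorem Admissible.image_schurReduce (hA : K.Admissible A) :
    (schurReduce (K.parts A)).image (· + 3) = K.parts (K.flip A) := by
  classical
  have hF : ∀ x ∈ K.paired, x - schurShift (K.parts A) x + 3 = x := by
    intro x hx
    have h5 : 5 ≤ x := by
      rcases mem_pairParts.1 hx with h | ⟨y, hy, rfl⟩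
      · exact K.five_le x h
      · have := K.five_le y hy
        omega
    rw [hA.schurShift_paired hx]
    omega
  -- The shifts 2, 3 and 4 followed by adding 3 keep a singleton in its cell; they only decide which
  -- of the two numbers of the cell it becomes.
  have hO : ∀ d ∈ A, 2 * d + 1 - schurShift (K.parts A) (2 * d + 1) + 3 =
      if d ∈ K.flip A then 2 * d + 1 else 2 * d + 2 := by
    intro d hd
    have := K.two_le d (hA.1 hd)
    rw [hA.schurShift_odd hd]
    split_ifs <;> omega
  have hE : ∀ d ∈ K.cells, d ∉ A → 2 * d + 2 - schurShift (K.parts A) (2 * d + 2) + 3 =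
      if d ∈ K.flip A then 2 * d + 1 else 2 * d + 2 := by
    intro d hd hdA
    have := K.two_le d hd
    rw [hA.schurShift_even hd hdA]
    split_ifs <;> omega
  have key : ∀ d ∈ K.cells, (if d ∈ K.flip A then 2 * d + 1 else 2 * d + 2) ∈
      (schurReduce (K.parts A)).image (· + 3) := by
    intro d hd
    simp only [schurReduce, Finset.image_image, Finset.mem_image, Function.comp]
    by_cases hdA : d ∈ A
    · exact ⟨_, odd_mem_parts hdA, hO d hdA⟩
    · exact ⟨_, even_mem_parts hd hdA, hE d hd hdA⟩
  have key' : ∀ d ∈ K.cells, (if d ∈ K.flip A then 2 * d + 1 else 2 * d + 2) ∈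
      K.parts (K.flip A) := by
    intro d hd
    split_ifs with h
    · exact odd_mem_parts h
    · exact even_mem_parts hd h
  apply Finset.Subset.antisymm
  · intro y hy
    simp only [schurReduce, Finset.image_image, Finset.mem_image, Function.comp] at hy
    obtain ⟨x, hx, rfl⟩ := hy
    rcases mem_parts.1 hx with h | ⟨d, hd, rfl⟩ | ⟨d, hd, hdA, rfl⟩
    · rw [hF x h]
      exact paired_subset h
    · rw [hO d hd]
      exact key' d (hA.1 hd)
    · rw [hE d hd hdA]
      exact key' d hd
  · intro y hy
    rcases mem_parts.1 hy with h | ⟨d, hd, rfl⟩ | ⟨d, hd, hdA, rfl⟩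
    · simp only [schurReduce, Finset.image_image, Finset.mem_image, Function.comp]
      exact ⟨y, paired_subset h, hF y h⟩
    · simpa [hd] using key d (mem_flip.1 hd).1
    · simpa [hdA] using key d hd

/-! ### Counting parts -/

theorem two_mul_add_inj {j : ℕ} : Function.Injective (fun c : ℕ => 2 * c + j) :=
  fun a b h => by simpa using h

theorem sum_parts (hA : A ⊆ K.cells) (g : ℕ → ℕ) : ∑ x ∈ K.parts A, g x =
    ∑ x ∈ K.bottoms, (g x + g (x + 3)) + ∑ c ∈ A, g (2 * c + 1) +
      ∑ c ∈ K.cells \ A, g (2 * c + 2) := by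
  unfold parts paired pairParts
  rw [Finset.sum_union, Finset.sum_union, Finset.sum_union, Finset.sum_image, Finset.sum_image,
    Finset.sum_image, Finset.sum_add_distrib]
  · exact fun a _ b _ h => two_mul_add_inj h
  · exact fun a _ b _ h => two_mul_add_inj h
  · exact fun a _ b _ h => by simpa using h
  · rw [Finset.disjoint_left]
    intro x hx hx'
    obtain ⟨y, hy, rfl⟩ := Finset.mem_image.1 hx'
    exact K.disj y hy hx
  · rw [Finset.disjoint_left]
    intro x hx hx'
    obtain ⟨c, hc, rfl⟩ := Finset.mem_image.1 hx'
    have := K.cell_pair c (hA hc) _ hx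
    omega
  · rw [Finset.disjoint_left]
    intro x hx hx'
    obtain ⟨c, hc, rfl⟩ := Finset.mem_image.1 hx'
    have hc' := (Finset.mem_sdiff.1 hc).1
    rcases Finset.mem_union.1 hx with h | h
    · have := K.cell_pair c hc' _ h
      omega
    · obtain ⟨d, hd, h⟩ := Finset.mem_image.1 h
      omega

theorem partCount_eq_sum (π : Finset ℕ) :
    partCount π = ∑ x ∈ π, if Even x then 2 else 1 := by
  unfold partCount
  rw [Finset.card_filter, Finset.card_eq_sum_ones, ← Finset.sum_add_distrib]
  exact Finset.sum_congr rfl fun x _ => by split_ifs <;> rfl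

theorem partCount_parts (hA : A ⊆ K.cells) : partCount (K.parts A) =
    3 * K.bottoms.card + A.card + 2 * (K.cells \ A).card := by
  rw [partCount_eq_sum, sum_parts hA]
  have h1 : ∀ x : ℕ, ((if Even x then 2 else 1) + if Even (x + 3) then 2 else 1) = 3 := by
    intro x
    grind
  have h2 : ∀ x : ℕ, (if Even (2 * x + 1) then 2 else 1) = 1 := by
    intro x
    grind
  have h3 : ∀ x : ℕ, (if Even (2 * x + 2) then 2 else 1) = 2 := by
    intro x
    grind
  simp only [h1, h2, h3, Finset.sum_const, smul_eq_mul]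
  ring

theorem card_parts (hA : A ⊆ K.cells) : (K.parts A).card =
    2 * K.bottoms.card + A.card + (K.cells \ A).card := by
  rw [Finset.card_eq_sum_ones, sum_parts hA]
  simp
  ring

/-- The right side is independent of `A`: each odd singleton is one less than the even number of its
cell. -/
theorem weight_parts (hA : A ⊆ K.cells) : weight (K.parts A) + A.card =
    ∑ x ∈ K.bottoms, (x + (x + 3)) + ∑ c ∈ K.cells, (2 * c + 2) := by
  unfold weight
  rw [sum_parts hA, ← Finset.sum_sdiff hA]
  have : ∑ c ∈ A, (2 * c + 2) = ∑ c ∈ A, (2 * c + 1) + A.card := by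
    rw [Finset.card_eq_sum_ones, ← Finset.sum_add_distrib]
  rw [this]
  ring

end Skeleton

/-! ### Translation by `3` -/

theorem add_three_injective : Function.Injective (fun x : ℕ => x + 3) := fun a b h => by
  simpa using h

theorem mem_image_add_three {σ : Finset ℕ} {x : ℕ} : x + 3 ∈ σ.image (· + 3) ↔ x ∈ σ := by
  simp

theorem weight_image_add_three (σ : Finset ℕ) :
    weight (σ.image (· + 3)) = weight σ + 3 * σ.card := by
  unfold weight
  rw [Finset.sum_image fun a _ b _ h => add_three_injective h, Finset.sum_add_distrib]
  simp
  ring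

/-- Adding 3 changes the parity, so each part contributes 1 on one side and 2 on the other. -/
theorem partCount_image_add_three (σ : Finset ℕ) :
    partCount (σ.image (· + 3)) + partCount σ = 3 * σ.card := by
  rw [Skeleton.partCount_eq_sum, Skeleton.partCount_eq_sum,
    Finset.sum_image fun a _ b _ h => add_three_injective h, ← Finset.sum_add_distrib,
    Finset.sum_congr rfl (g := fun _ => 3) fun x _ => by grind]
  simp
  ring

theorem IsSchur.of_image_add_three {σ : Finset ℕ} (h : IsSchur (σ.image (· + 3)))
    (h4 : ∀ x ∈ σ.image (· + 3), 4 ≤ x) : IsSchur σ := by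
  refine ⟨fun x hx => ?_, fun x hx y hy hxy => ?_, fun x hx h3 hx' => ?_⟩
  · have := h4 _ (mem_image_add_three.2 hx)
    omega
  · have := h.sep (mem_image_add_three.2 hx) (mem_image_add_three.2 hy) (by omega)
    omega
  · exact h.2.2 _ (mem_image_add_three.2 hx) (by omega) (mem_image_add_three.2 hx')

theorem IsSchur.image_add_three {σ : Finset ℕ} (h : IsSchur σ) : IsSchur (σ.image (· + 3)) := by
  have hm : ∀ x ∈ σ.image (· + 3), ∃ y ∈ σ, y + 3 = x := fun x hx => by simpa using hx
  refine ⟨fun x hx => ?_, fun x hx y hy hxy => ?_, fun x hx h3 hx' => ?_⟩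
  · obtain ⟨u, hu, rfl⟩ := hm x hx
    omega
  · obtain ⟨u, hu, rfl⟩ := hm x hx
    obtain ⟨v, hv, rfl⟩ := hm y hy
    have := h.sep hu hv (by omega)
    omega
  · obtain ⟨u, hu, rfl⟩ := hm x hx
    exact h.2.2 u hu (by omega) (mem_image_add_three.1 hx')

/-- The Schur reduction map, followed by the translation by `3`. -/
noncomputable def reduceUp (π : Finset ℕ) : Finset ℕ := (schurReduce π).image (· + 3)

section FiveLe

variable {π : Finset ℕ}

theorem IsSchur.reduceUp (h : IsSchur π) (h5 : ∀ x ∈ π, 5 ≤ x) : IsSchur (reduceUp π) := by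
  obtain ⟨K, A, hA, rfl⟩ := h.exists_skeleton h5
  unfold AlladiSchur.reduceUp
  rw [hA.image_schurReduce]
  exact hA.flip.isSchur

/-- The reduced and translated partition has the same skeleton, so a second application exchanges
the same chains back. -/
theorem IsSchur.reduceUp_reduceUp (h : IsSchur π) (h5 : ∀ x ∈ π, 5 ≤ x) :
    AlladiSchur.reduceUp (AlladiSchur.reduceUp π) = π := by
  obtain ⟨K, A, hA, rfl⟩ := h.exists_skeleton h5
  unfold AlladiSchur.reduceUp
  rw [hA.image_schurReduce, hA.flip.image_schurReduce, hA.flip_flip]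

/-- The skeleton is unchanged, and a bound `2 * k + 1` on the parts forces all cells to be at least
`k`. The instances used are `k = 2` and, beside a part 3, `k = 3`. -/
theorem IsSchur.le_reduceUp (h : IsSchur π) {k : ℕ} (hk : 2 ≤ k) (h5 : ∀ x ∈ π, 2 * k + 1 ≤ x) :
    ∀ x ∈ AlladiSchur.reduceUp π, 2 * k + 1 ≤ x := by
  obtain ⟨K, A, hA, rfl⟩ := h.exists_skeleton fun x hx => by have := h5 x hx; omega
  unfold AlladiSchur.reduceUp
  rw [hA.image_schurReduce]
  intro x hx
  have hc : ∀ c ∈ K.cells, k ≤ c := by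
    intro c hc
    by_cases hcA : c ∈ A
    · have := h5 _ (Skeleton.odd_mem_parts hcA)
      omega
    · have := h5 _ (Skeleton.even_mem_parts hc hcA)
      omega
  rcases Skeleton.mem_parts.1 hx with h | ⟨c, hc', rfl⟩ | ⟨c, hc', -, rfl⟩
  · exact h5 x (Skeleton.paired_subset h)
  · have := hc c (hA.flip.1 hc')
    omega
  · have := hc c hc'
    omega

/-- With `b` pairs, `α` odd and `ε` even singletons, the translated reduction has `2b + α + ε` parts
and `partCount` equal to `3b + ε + 2α`. Undoing the translation gives `3b + α + 2ε`, the original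
value, and the weight drops by `(ε - α) + 3(2b + α + ε)`, twice that value. -/
theorem IsSchur.partCount_schurReduce (h : IsSchur π) (h5 : ∀ x ∈ π, 5 ≤ x) :
    partCount (schurReduce π) = partCount π ∧
      weight (schurReduce π) + 2 * partCount π = weight π := by
  obtain ⟨K, A, hA, rfl⟩ := h.exists_skeleton h5
  have h1 := partCount_image_add_three (schurReduce (K.parts A))
  have h2 := weight_image_add_three (schurReduce (K.parts A))
  have h3 : (schurReduce (K.parts A)).card = (K.parts (K.flip A)).card := by
    rw [← hA.image_schurReduce, Finset.card_image_of_injective _ add_three_injective]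
  rw [hA.image_schurReduce, h3] at h1 h2
  have h4 := Skeleton.card_flip (K := K) (A := A)
  have h6 := Skeleton.card_flip (K := K) (A := K.flip A)
  rw [hA.flip_flip] at h6
  rw [Skeleton.partCount_parts hA.flip.1, Skeleton.card_parts hA.flip.1] at h1
  have h7 := Skeleton.weight_parts hA.1
  have h8 := Skeleton.weight_parts hA.flip.1
  rw [Skeleton.card_parts hA.flip.1] at h2
  have h9 := Skeleton.partCount_parts hA.1
  omega

end FiveLe

/-! ### A part `3` -/

section InsertThree

variable {π : Finset ℕ}

theorem mem_insert_three_of_ne {x : ℕ} (hx : x ≠ 3) : x ∈ insert 3 π ↔ x ∈ π := by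
  simp [hx]

theorem isUpperSingleton_insert_three (h7 : ∀ x ∈ π, 7 ≤ x) {x : ℕ} (hx : x ∈ π) :
    IsUpperSingleton (insert 3 π) x ↔ IsUpperSingleton π x := by
  -- Only a part 6 would see the new part 3 directly below it, and there is none.
  have hb : ∀ y, y ≠ 6 → (BelowEven (insert 3 π) y ↔ BelowEven π y) := by
    intro y
    induction y using Nat.strong_induction_on with
    | _ y ih =>
      intro hy
      rw [belowEven_iff, belowEven_iff]
      refine forall₂_congr fun n hn => ?_
      rw [mem_insert_three_of_ne (by omega)]
      refine imp_congr_right fun hm => not_congr (ih n (by omega) ?_)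
      have := h7 n hm
      omega
  have ha : ∀ y, AboveEven (insert 3 π) (y + 1) ↔ AboveEven π (y + 1) := by
    intro y
    refine exists_congr fun l => and_congr_right fun _ => and_congr ?_ ?_
    · exact forall₂_congr fun i _ => mem_insert_three_of_ne (by omega)
    · exact not_congr (mem_insert_three_of_ne (by omega))
  have hx7 := h7 x hx
  obtain ⟨y, rfl⟩ : ∃ y, x = y + 1 := ⟨x - 1, by omega⟩
  rw [isUpperSingleton_iff, isUpperSingleton_iff, hb _ (by omega), ha,
    mem_insert_three_of_ne (by omega), mem_insert_three_of_ne (by omega)]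
  have : (∀ b ∈ insert 3 π, b + 3 ≠ y + 1) ↔ ∀ b ∈ π, b + 3 ≠ y + 1 := by
    rw [Finset.forall_mem_insert, and_iff_right_iff_imp]
    omega
  rw [this]

theorem isSegmentOf_insert_three (h7 : ∀ x ∈ π, 7 ≤ x) (S : Finset ℕ) :
    IsSegmentOf (insert 3 π) S ↔ IsSegmentOf π S := by
  refine and_congr_right fun hU => ?_
  obtain ⟨c, f, hc, -, hb⟩ := hU.isTightSegment
  have h3 : 3 ∉ S := fun h => by
    have := hb 3 h
    omega
  have hsub : S ⊆ insert 3 π ↔ S ⊆ π := Finset.subset_insert_iff_of_notMem h3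
  rw [hsub]
  exact and_congr_right fun hS => forall₂_congr fun x hx => imp_congr_right fun _ =>
    isUpperSingleton_insert_three h7 (hS hx)

theorem schurShift_insert_three (h7 : ∀ x ∈ π, 7 ≤ x) {x : ℕ} (hx : x ∈ π) :
    schurShift (insert 3 π) x = schurShift π x := by
  have h1 : IsLongestSegmentOf (insert 3 π) = IsLongestSegmentOf π := by
    funext S
    simp only [IsLongestSegmentOf, isSegmentOf_insert_three h7]
  have h2 : IsUpperPaired (insert 3 π) x = IsUpperPaired π x := by
    have := isUpperSingleton_insert_three h7 hx
    unfold IsUpperSingleton at this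
    have hx' : x ∈ insert 3 π := Finset.mem_insert_of_mem hx
    exact propext (by tauto)
  unfold schurShift
  rw [h1, h2]

/-- A segment has all its elements at least 5, so 3 is a free odd singleton. -/
theorem schurShift_three (h7 : ∀ x ∈ π, 7 ≤ x) : schurShift (insert 3 π) 3 = 2 := by
  unfold schurShift
  rw [dif_neg, if_neg, if_pos (by decide)]
  · rintro ⟨-, h | ⟨y, hy, h⟩, -⟩
    · rw [mem_insert_three_of_ne (by omega)] at h
      have := h7 _ h
      omega
    · rw [mem_insert_three_of_ne (by omega)] at hy
      have := h7 _ hy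
      omega
  · rintro ⟨S, hS, h3⟩
    obtain ⟨c, f, hc, -, hb⟩ := hS.1.1.isTightSegment
    have := hb 3 h3
    omega

theorem schurReduce_insert_three (h7 : ∀ x ∈ π, 7 ≤ x) :
    schurReduce (insert 3 π) = insert 1 (schurReduce π) := by
  unfold schurReduce
  rw [Finset.image_insert, schurShift_three h7]
  congr 1
  exact Finset.image_congr fun x hx => by
    rw [schurShift_insert_three h7 hx]

end InsertThree

/-! ### The reduction map on starred partitions -/

/-- A Schur partition with odd parts at least `3` and even parts at least `6`. -/
def IsStar (π : Finset ℕ) : Prop :=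
  IsSchur π ∧ (∀ x ∈ π, Odd x → 3 ≤ x) ∧ (∀ x ∈ π, Even x → 6 ≤ x)

theorem partCount_insert {π : Finset ℕ} {x : ℕ} (hx : x ∉ π) :
    partCount (insert x π) = (if Even x then 2 else 1) + partCount π := by
  rw [Skeleton.partCount_eq_sum, Skeleton.partCount_eq_sum, Finset.sum_insert hx]

theorem weight_insert {π : Finset ℕ} {x : ℕ} (hx : x ∉ π) :
    weight (insert x π) = x + weight π := Finset.sum_insert hx

theorem IsSchur.mono {π σ : Finset ℕ} (h : IsSchur π) (hσ : σ ⊆ π) : IsSchur σ :=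
  ⟨fun x hx => h.1 x (hσ hx), fun x hx y hy => h.2.1 x (hσ hx) y (hσ hy),
    fun x hx h3 hx' => h.2.2 x (hσ hx) h3 (hσ hx')⟩

theorem IsSchur.insert_of_lt {π : Finset ℕ} (h : IsSchur π) {a : ℕ} (ha : 0 < a)
    (hlt : ∀ x ∈ π, a + 3 ≤ x) (h3 : 3 ∣ a → a + 3 ∉ π) : IsSchur (insert a π) := by
  refine ⟨fun x hx => ?_, fun x hx y hy hxy => ?_, fun x hx hx3 hx' => ?_⟩
  · rcases Finset.mem_insert.1 hx with rfl | hx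
    · exact ha
    · exact h.1 x hx
  · rcases Finset.mem_insert.1 hx with hxa | hx <;> rcases Finset.mem_insert.1 hy with hya | hy
    · omega
    · exact hxa ▸ hlt y hy
    · have := hlt x hx
      omega
    · exact h.sep hx hy hxy
  · rcases Finset.mem_insert.1 hx with rfl | hx <;> rcases Finset.mem_insert.1 hx' with hx' | hx'
    · omega
    · exact h3 hx3 hx'
    · have := hlt x hx
      omega
    · exact h.2.2 x hx hx3 hx'

/-- A starred partition has parts at least `5`, apart from a possible part `3`. -/
theorem IsStar.cases {π : Finset ℕ} (h : IsStar π) :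
    (IsSchur π ∧ ∀ x ∈ π, 5 ≤ x) ∨
      ∃ σ, π = insert 3 σ ∧ 3 ∉ σ ∧ IsSchur σ ∧ ∀ x ∈ σ, 7 ≤ x := by
  obtain ⟨hs, ho, he⟩ := h
  by_cases h3 : 3 ∈ π
  · refine .inr ⟨π.erase 3, (Finset.insert_erase h3).symm, Finset.notMem_erase _ _,
      hs.mono (Finset.erase_subset _ _), fun x hx => ?_⟩
    obtain ⟨hne, hx⟩ := Finset.mem_erase.1 hx
    have h6 : x ≠ 6 := by
      rintro rfl
      exact hs.2.2 3 h3 (by norm_num) hx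
    have h4 : 3 ≤ x := by
      rcases Nat.even_or_odd x with h | h
      · have := he x hx h
        omega
      · exact ho x hx h
    have := hs.sep h3 hx (by omega)
    omega
  · refine .inl ⟨hs, fun x hx => ?_⟩
    rcases Nat.even_or_odd x with h | h
    · have := he x hx h
      omega
    · have h1 := ho x hx h
      have h2 : x ≠ 3 := by rintro rfl; exact h3 hx
      grind

theorem isStar_of_five_le {π : Finset ℕ} (h : IsSchur π) (h5 : ∀ x ∈ π, 5 ≤ x) : IsStar π := by
  refine ⟨h, fun x hx _ => ?_, fun x hx he => ?_⟩
  · have := h5 x hx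
    omega
  · have := h5 x hx
    grind

theorem isStar_insert_three {σ : Finset ℕ} (h : IsSchur σ) (h7 : ∀ x ∈ σ, 7 ≤ x) :
    IsStar (insert 3 σ) := by
  refine ⟨h.insert_of_lt (by norm_num) (fun x hx => ?_) fun _ h6 => ?_, fun x hx _ => ?_,
    fun x hx he => ?_⟩
  · have := h7 x hx
    omega
  · have := h7 _ h6
    omega
  · rcases Finset.mem_insert.1 hx with rfl | hx
    · exact le_rfl
    · have := h7 x hx
      omega
  · rcases Finset.mem_insert.1 hx with rfl | hx
    · exact absurd he (by decide)
    · have := h7 x hx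
      omega

theorem reduceUp_insert_three {σ : Finset ℕ} (h7 : ∀ x ∈ σ, 7 ≤ x) :
    reduceUp (insert 3 σ) = insert 4 (reduceUp σ) := by
  unfold reduceUp
  rw [schurReduce_insert_three h7, Finset.image_insert]

theorem schurReduce_eq_iff {π π' : Finset ℕ} :
    schurReduce π = schurReduce π' ↔ reduceUp π = reduceUp π' :=
  (Finset.image_injective add_three_injective).eq_iff.symm

theorem IsStar.reduceUp {π : Finset ℕ} (h : IsStar π) :
    IsSchur (reduceUp π) ∧ ∀ x ∈ AlladiSchur.reduceUp π, 4 ≤ x := by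
  rcases h.cases with ⟨hs, h5⟩ | ⟨σ, rfl, h3, hs, h7⟩
  · refine ⟨hs.reduceUp h5, fun x hx => ?_⟩
    have := hs.le_reduceUp (k := 2) le_rfl h5 x hx
    omega
  · have h7' := hs.le_reduceUp (k := 3) (by norm_num) h7
    rw [reduceUp_insert_three h7]
    refine ⟨(hs.reduceUp fun x hx => ?_).insert_of_lt (by norm_num) h7' (by norm_num),
      fun x hx => ?_⟩
    · have := h7 x hx
      omega
    · rcases Finset.mem_insert.1 hx with rfl | hx
      · exact le_rfl
      · have := h7' x hx
        omega

theorem IsStar.isSchur_schurReduce {π : Finset ℕ} (h : IsStar π) : IsSchur (schurReduce π) :=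
  IsSchur.of_image_add_three h.reduceUp.1 h.reduceUp.2

theorem IsStar.partCount_schurReduce {π : Finset ℕ} (h : IsStar π) :
    partCount (schurReduce π) = partCount π ∧
      weight (schurReduce π) + 2 * partCount π = weight π := by
  rcases h.cases with ⟨hs, h5⟩ | ⟨σ, rfl, h3, hs, h7⟩
  · exact hs.partCount_schurReduce h5
  · obtain ⟨h1, h2⟩ := hs.partCount_schurReduce fun x hx => by have := h7 x hx; omega
    have h4 : 1 ∉ schurReduce σ := fun h => by
      have := hs.le_reduceUp (k := 3) (by norm_num) h7 _ (mem_image_add_three.2 h)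
      omega
    rw [schurReduce_insert_three h7, partCount_insert h4, partCount_insert h3, weight_insert h4,
      weight_insert h3, if_neg (by decide), if_neg (by decide)]
    omega

/-- After translation a part 3 becomes 4, and nothing else does, so its presence is detected. The
rest is recovered by the involution. -/
theorem IsStar.schurReduce_inj {π π' : Finset ℕ} (h : IsStar π) (h' : IsStar π')
    (heq : schurReduce π = schurReduce π') : π = π' := by
  rw [schurReduce_eq_iff] at heq
  have not4 : ∀ {σ : Finset ℕ}, IsSchur σ → ∀ {k : ℕ}, 2 ≤ k → (∀ x ∈ σ, 2 * k + 1 ≤ x) →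
      4 ∉ AlladiSchur.reduceUp σ := fun hs k hk h5 h4 => by
    have := hs.le_reduceUp hk h5 4 h4
    omega
  rcases h.cases with ⟨hs, h5⟩ | ⟨σ, rfl, h3, hs, h7⟩ <;>
  rcases h'.cases with ⟨hs', h5'⟩ | ⟨σ', rfl, h3', hs', h7'⟩
  · rw [← hs.reduceUp_reduceUp h5, heq, hs'.reduceUp_reduceUp h5']
  · refine absurd (Finset.mem_insert_self 4 (AlladiSchur.reduceUp σ')) ?_
    rw [← reduceUp_insert_three h7', ← heq]
    exact not4 hs le_rfl h5
  · refine absurd (Finset.mem_insert_self 4 (AlladiSchur.reduceUp σ)) ?_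
    rw [← reduceUp_insert_three h7, heq]
    exact not4 hs' le_rfl h5'
  · rw [reduceUp_insert_three h7, reduceUp_insert_three h7'] at heq
    have h1 : AlladiSchur.reduceUp σ = AlladiSchur.reduceUp σ' := by
      rw [← Finset.erase_insert (not4 hs (k := 3) (by norm_num) h7), heq,
        Finset.erase_insert (not4 hs' (k := 3) (by norm_num) h7')]
    rw [← hs.reduceUp_reduceUp fun x hx => by have := h7 x hx; omega, h1,
      hs'.reduceUp_reduceUp fun x hx => by have := h7' x hx; omega]

/-- The preimage is obtained by applying the involution to the translate of `τ`, after setting aside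
a part 4, which comes from 3. -/
theorem IsSchur.exists_schurReduce_eq {τ : Finset ℕ} (h : IsSchur τ) :
    ∃ π, IsStar π ∧ schurReduce π = τ := by
  have key : ∀ π, AlladiSchur.reduceUp π = τ.image (· + 3) → schurReduce π = τ := fun π hπ =>
    Finset.image_injective add_three_injective hπ
  have hs := h.image_add_three
  have hpos : ∀ x ∈ τ.image (· + 3), 4 ≤ x := by
    intro x hx
    obtain ⟨y, hy, rfl⟩ := Finset.mem_image.1 hx
    have := h.1 y hy
    omega
  set ρ := τ.image (· + 3) with hρ
  by_cases h4 : 4 ∈ ρ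
  · have hs' := hs.mono (Finset.erase_subset 4 ρ)
    have h7 : ∀ x ∈ ρ.erase 4, 7 ≤ x := by
      intro x hx
      obtain ⟨hne, hx⟩ := Finset.mem_erase.1 hx
      have h1 := hpos x hx
      exact hs.sep h4 hx (by omega)
    have h5 : ∀ x ∈ ρ.erase 4, 5 ≤ x := fun x hx => by have := h7 x hx; omega
    have h7' := hs'.le_reduceUp (k := 3) (by norm_num) h7
    refine ⟨insert 3 (AlladiSchur.reduceUp (ρ.erase 4)),
      isStar_insert_three (hs'.reduceUp h5) h7', key _ ?_⟩
    rw [reduceUp_insert_three h7', hs'.reduceUp_reduceUp h5, Finset.insert_erase h4]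
  · have h5 : ∀ x ∈ ρ, 5 ≤ x := by
      intro x hx
      have h1 := hpos x hx
      have h2 : x ≠ 4 := by rintro rfl; exact h4 hx
      omega
    exact ⟨AlladiSchur.reduceUp ρ, isStar_of_five_le (hs.reduceUp h5)
      (hs.le_reduceUp (k := 2) le_rfl h5), key _ (hs.reduceUp_reduceUp h5)⟩

/-! ### Grouping -/

/-- The inverse of the grouping map, for a given difference `g ≤ 2` of the weights. -/
def ungroup : ℕ → Finset ℕ → Finset ℕ
  | 0, τ => τ
  | 1, τ => if 3 ∈ τ then insert 4 (τ.erase 3) else insert 1 τ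
  | _, τ => if 3 ∈ τ then insert 1 (insert 4 (τ.erase 3)) else insert 2 τ

theorem schurGroup_eq_self {τ : Finset ℕ} (h : ∀ x ∈ τ, 3 ≤ x ∧ x ≠ 4) : schurGroup τ = τ := by
  unfold schurGroup
  rw [Finset.filter_true_of_mem fun x hx => (h x hx).1]
  conv_rhs => rw [← Finset.image_id (s := τ)]
  exact Finset.image_congr fun x hx => if_neg (h x hx).2

theorem schurGroup_insert_of_lt {τ : Finset ℕ} {a : ℕ} (ha : a < 3) :
    schurGroup (insert a τ) = schurGroup τ := by
  unfold schurGroup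
  rw [Finset.filter_insert, if_neg (by omega)]

theorem schurGroup_insert_four (τ : Finset ℕ) :
    schurGroup (insert 4 τ) = insert 3 (schurGroup τ) := by
  unfold schurGroup
  rw [Finset.filter_insert, if_pos (by omega), Finset.image_insert, if_pos rfl]

theorem IsStar.le_and_ne {τ : Finset ℕ} (h : IsStar τ) : ∀ x ∈ τ, 3 ≤ x ∧ x ≠ 4 := by
  intro x hx
  rcases Nat.even_or_odd x with he | ho
  · have := h.2.2 x hx he
    omega
  · have := h.2.1 x hx ho
    exact ⟨this, by grind⟩

theorem IsStar.schurGroup_eq {τ : Finset ℕ} (h : IsStar τ) : schurGroup τ = τ :=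
  schurGroup_eq_self h.le_and_ne

theorem IsStar.ungroup_spec {τ : Finset ℕ} (h : IsStar τ) {g : ℕ} (hg : g ≤ 2) :
    IsSchur (ungroup g τ) ∧ schurGroup (ungroup g τ) = τ ∧
      weight (ungroup g τ) = weight τ + g ∧ partCount (ungroup g τ) = partCount τ + g ∧
      (g = 1 ↔ (1 ∈ ungroup g τ ∧ 4 ∉ ungroup g τ) ∨ (4 ∈ ungroup g τ ∧ 1 ∉ ungroup g τ)) ∧
      (g = 2 ↔ 2 ∈ ungroup g τ ∨ (1 ∈ ungroup g τ ∧ 4 ∈ ungroup g τ)) := by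
  have n1 : 1 ∉ τ := fun hx => absurd (h.le_and_ne _ hx).1 (by omega)
  have n2 : 2 ∉ τ := fun hx => absurd (h.le_and_ne _ hx).1 (by omega)
  have n4 : 4 ∉ τ := fun hx => (h.le_and_ne _ hx).2 rfl
  obtain rfl | rfl | rfl : g = 0 ∨ g = 1 ∨ g = 2 := by omega
  · exact ⟨h.1, h.schurGroup_eq, rfl, rfl, by simp [ungroup, n1, n4], by simp [ungroup, n1, n2]⟩
  all_goals rcases h.cases with ⟨hs, h5⟩ | ⟨σ, rfl, h3, hs, h7⟩
  · have n3 : 3 ∉ τ := fun hx => absurd (h5 _ hx) (by omega)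
    simp only [ungroup, if_neg n3]
    refine ⟨hs.insert_of_lt one_pos (fun x hx => ?_) (by omega), ?_, ?_, ?_, ?_, ?_⟩
    · have := h5 x hx
      omega
    · rw [schurGroup_insert_of_lt (by omega), h.schurGroup_eq]
    · rw [weight_insert n1, add_comm]
    · rw [partCount_insert n1, if_neg (by decide), add_comm]
    · simp [n4]
    · simp [n2, n4]
  · have m1 : 1 ∉ σ := fun hx => n1 (Finset.mem_insert_of_mem hx)
    have m2 : 2 ∉ σ := fun hx => n2 (Finset.mem_insert_of_mem hx)
    have m4 : 4 ∉ σ := fun hx => n4 (Finset.mem_insert_of_mem hx)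
    have hG : schurGroup σ = σ := schurGroup_eq_self fun x hx => by have := h7 x hx; omega
    simp only [ungroup, Finset.mem_insert_self, if_true, Finset.erase_insert h3]
    refine ⟨hs.insert_of_lt (by omega) (fun x hx => h7 x hx) (by omega), ?_, ?_, ?_, ?_, ?_⟩
    · rw [schurGroup_insert_four, hG]
    · rw [weight_insert m4, weight_insert h3]
      ring
    · rw [partCount_insert m4, partCount_insert h3, if_pos (by decide), if_neg (by decide)]
      ring
    · simp [m1]
    · simp [m1, m2]
  · have n3 : 3 ∉ τ := fun hx => absurd (h5 _ hx) (by omega)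
    simp only [ungroup, if_neg n3]
    refine ⟨hs.insert_of_lt two_pos h5 (by omega), ?_, ?_, ?_, ?_, ?_⟩
    · rw [schurGroup_insert_of_lt (by omega), h.schurGroup_eq]
    · rw [weight_insert n2, add_comm]
    · rw [partCount_insert n2, if_pos (by decide), add_comm]
    · simp [n1, n4]
    · simp
  · have m1 : 1 ∉ insert 4 σ := fun hx => n1 (by simp at hx ⊢; exact hx)
    have m4 : 4 ∉ σ := fun hx => n4 (Finset.mem_insert_of_mem hx)
    have hG : schurGroup σ = σ := schurGroup_eq_self fun x hx => by have := h7 x hx; omega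
    simp only [ungroup, Finset.mem_insert_self, if_true, Finset.erase_insert h3]
    refine ⟨(hs.insert_of_lt (by omega) (fun x hx => h7 x hx) (by omega)).insert_of_lt one_pos
      (fun x hx => ?_) (by omega), ?_, ?_, ?_, ?_, ?_⟩
    · rcases Finset.mem_insert.1 hx with rfl | hx
      · exact le_rfl
      · have := h7 x hx
        omega
    · rw [schurGroup_insert_of_lt (by omega), schurGroup_insert_four, hG]
    · rw [weight_insert m1, weight_insert m4, weight_insert h3]
      ring
    · rw [partCount_insert m1, partCount_insert m4, partCount_insert h3,
        if_neg (by decide), if_pos (by decide), if_neg (by decide)]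
      ring
    · simp
    · simp

theorem IsSchur.exists_ungroup {π : Finset ℕ} (h : IsSchur π) :
    ∃ τ g, IsStar τ ∧ g ≤ 2 ∧ π = ungroup g τ := by
  have h0 : ∀ x ∈ π, 0 < x := h.1
  by_cases h4 : 4 ∈ π
  · have hσ := h.mono (Finset.filter_subset (fun x => 7 ≤ x) π)
    have h7 : ∀ x ∈ π.filter (fun x => 7 ≤ x), 7 ≤ x := fun x hx => (Finset.mem_filter.1 hx).2
    have h3 : 3 ∉ π.filter (fun x => 7 ≤ x) := fun hx => absurd (h7 3 hx) (by omega)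
    -- Next to a part 4 only 1 and parts from 7 on are possible, so the grouped partition has 3 in
    -- its place and `g` is 1 or 2 according to the part 1.
    have hx : ∀ x ∈ π, x = 1 ∨ x = 4 ∨ 7 ≤ x := by
      intro x hx
      have h1 := h0 x hx
      have h2 := h.2.1 x hx 4 h4
      have h3 := h.2.1 4 h4 x hx
      omega
    refine ⟨insert 3 (π.filter (fun x => 7 ≤ x)), if 1 ∈ π then 2 else 1,
      isStar_insert_three hσ h7, by split_ifs <;> omega, ?_⟩
    split_ifs with h1
    · simp only [ungroup, Finset.mem_insert_self, if_true, Finset.erase_insert h3]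
      ext x
      have := hx x
      simp only [Finset.mem_insert, Finset.mem_filter]
      grind
    · simp only [ungroup, Finset.mem_insert_self, if_true, Finset.erase_insert h3]
      ext x
      have := hx x
      simp only [Finset.mem_insert, Finset.mem_filter]
      grind
  · have star : ∀ τ ⊆ π, (∀ x ∈ τ, 3 ≤ x) → IsStar τ := fun τ hτ h3 =>
      ⟨h.mono hτ, fun x hx _ => h3 x hx, fun x hx he => by
        have h1 := h3 x hx
        have h2 : x ≠ 4 := by rintro rfl; exact h4 (hτ hx)
        grind⟩
    by_cases h12 : 1 ∈ π ∨ 2 ∈ π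
    · have hx : ∀ x ∈ π, 3 ≤ x → 5 ≤ x := by
        intro x hx hx3
        have h2 : x ≠ 4 := by rintro rfl; exact h4 hx
        rcases h12 with h1 | h1
        · have := h.sep h1 hx (by omega)
          omega
        · have := h.sep h1 hx (by omega)
          omega
      have h3 : 3 ∉ π.filter (fun x => 3 ≤ x) := fun h' => by
        have := hx 3 (Finset.mem_filter.1 h').1 le_rfl
        omega
      refine ⟨π.filter (fun x => 3 ≤ x), if 1 ∈ π then 1 else 2,
        star _ (Finset.filter_subset _ _) fun x hx => (Finset.mem_filter.1 hx).2,
        by split_ifs <;> omega, ?_⟩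
      have hnot : ¬ (1 ∈ π ∧ 2 ∈ π) := fun ⟨h1, h2⟩ => by
        have := h.sep h1 h2 (by omega)
        omega
      split_ifs with h1
      · simp only [ungroup, if_neg h3]
        ext x
        have := h0 x
        simp only [Finset.mem_insert, Finset.mem_filter]
        grind
      · simp only [ungroup, if_neg h3]
        ext x
        have := h0 x
        simp only [Finset.mem_insert, Finset.mem_filter]
        grind
    · refine ⟨π, 0, star π subset_rfl fun x hx => ?_, by omega, rfl⟩
      have h1 := h0 x hx
      have h2 : x ≠ 1 := by rintro rfl; exact h12 (.inl hx)
      have h3 : x ≠ 2 := by rintro rfl; exact h12 (.inr hx)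
      omega

/-! ### The bijection -/

theorem bij_empty : bij ∅ = 0 := by
  rw [bij, dif_pos (by simp [weight])]

theorem IsSchur.eq_empty {π : Finset ℕ} (h : IsSchur π) (h0 : weight π = 0) : π = ∅ := by
  rw [Finset.eq_empty_iff_forall_notMem]
  intro x hx
  have h1 := h.1 x hx
  have h2 : x ≤ weight π := Finset.single_le_sum (f := fun x => x) (fun _ _ => Nat.zero_le _) hx
  omega

/-- The recursion of `bij` in coordinates `(g, τ)`. It matches the decomposition of an odd multiset
into its ones and the rest, and all later inductions use only this form. -/
theorem IsStar.bij_ungroup {τ : Finset ℕ} (h : IsStar τ) {g : ℕ} (hg : g ≤ 2) :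
    bij (ungroup g τ) = Multiset.replicate g 1 + (bij (schurReduce τ)).map (· + 2) := by
  obtain ⟨hs, hG, hw, -⟩ := h.ungroup_spec hg
  rw [bij]
  split_ifs with h0
  · have h1 : τ = ∅ := h.1.eq_empty (by omega)
    have h2 : g = 0 := by omega
    simp [h1, h2, schurReduce, bij_empty]
  · rw [schurPhi, hG, hw, Nat.add_sub_cancel_left]

theorem IsStar.bij_eq {τ : Finset ℕ} (h : IsStar τ) :
    bij τ = (bij (schurReduce τ)).map (· + 2) := by
  simpa [ungroup] using h.bij_ungroup (g := 0) (by omega)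

theorem alladiGroup_replicate_add (g : ℕ) (ν : Multiset ℕ) :
    alladiGroup (Multiset.replicate g 1 + ν.map (· + 2)) = ν.map (· + 2) := by
  unfold alladiGroup
  rw [Multiset.filter_add, Multiset.filter_eq_nil.2 (fun x hx => by
    simp [Multiset.eq_of_mem_replicate hx]), zero_add, Multiset.filter_eq_self]
  intro x hx
  obtain ⟨y, -, rfl⟩ := Multiset.mem_map.1 hx
  omega

theorem alladiReduce_map (ν : Multiset ℕ) : alladiReduce (ν.map (· + 2)) = ν := by
  simp [alladiReduce, Multiset.map_map]

theorem count_one_replicate_add (g : ℕ) (ν : Multiset ℕ) :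
    (Multiset.replicate g 1 + ν.map (· + 2)).count 1 = g := by
  rw [Multiset.count_add, Multiset.count_replicate_self, Nat.add_eq_left, Multiset.count_eq_zero]
  intro hx
  obtain ⟨y, -, hy⟩ := Multiset.mem_map.1 hx
  omega

theorem count_add_two_replicate_add (g x : ℕ) (ν : Multiset ℕ) :
    (Multiset.replicate g 1 + ν.map (· + 2)).count (x + 2) = ν.count x := by
  rw [Multiset.count_add, Multiset.count_replicate, if_neg (by omega), zero_add,
    Multiset.count_map_eq_count' (· + 2) ν (add_left_injective 2)]

theorem sum_map_add_two (ν : Multiset ℕ) : (ν.map (· + 2)).sum = ν.sum + 2 * ν.card := by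
  simp [Multiset.sum_map_add, mul_comm]

/-- An odd multiset is recovered from the number of its ones and from its reduction. -/
theorem eq_replicate_add_alladiPhi {μ : Multiset ℕ} (h : ∀ x ∈ μ, Odd x) :
    μ = Multiset.replicate (μ.count 1) 1 + (alladiPhi μ).map (· + 2) := by
  conv_lhs => rw [← Multiset.filter_add_not (fun x => x = 1) μ]
  congr 1
  · rw [Multiset.filter_eq']
  · unfold alladiPhi alladiReduce alladiGroup
    rw [Multiset.map_map]
    conv_lhs => rw [← Multiset.map_id (Multiset.filter _ μ)]
    refine Multiset.map_congr rfl fun x hx => ?_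
    obtain ⟨hx, hx1⟩ := Multiset.mem_filter.1 hx
    have := h x hx
    simp only [id, Function.comp]
    grind

theorem IsSchur.bij_spec {π : Finset ℕ} (h : IsSchur π) :
    (∀ x ∈ bij π, Odd x) ∧ (∀ x, (bij π).count x ≤ 2) ∧ (bij π).card = partCount π ∧
      (bij π).sum = weight π := by
  induction hn : weight π using Nat.strong_induction_on generalizing π with
  | _ n ih =>
    by_cases h0 : weight π = 0
    · obtain rfl := h.eq_empty h0
      simp [bij_empty, partCount, ← hn, h0]
    · obtain ⟨τ, g, hτ, hg, rfl⟩ := h.exists_ungroup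
      obtain ⟨-, hG, hw, hp, -⟩ := hτ.ungroup_spec hg
      have hlt := weight_schurPhi_lt _ h0
      rw [schurPhi, hG, hn] at hlt
      obtain ⟨h1, h2, h3, h4⟩ := ih _ hlt hτ.isSchur_schurReduce rfl
      obtain ⟨h5, h6⟩ := hτ.partCount_schurReduce
      rw [hτ.bij_ungroup hg]
      refine ⟨fun x hx => ?_, fun x => ?_, ?_, ?_⟩
      · rcases Multiset.mem_add.1 hx with hx | hx
        · rw [Multiset.eq_of_mem_replicate hx]
          exact odd_one
        · obtain ⟨y, hy, rfl⟩ := Multiset.mem_map.1 hx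
          have := h1 y hy
          grind
      · match x with
        | 0 =>
          rw [Multiset.count_eq_zero.2]
          · omega
          · simp [Multiset.mem_replicate]
        | 1 => rwa [count_one_replicate_add]
        | x + 2 =>
          rw [count_add_two_replicate_add]
          exact h2 x
      · rw [Multiset.card_add, Multiset.card_replicate, Multiset.card_map]
        omega
      · rw [Multiset.sum_add, Multiset.sum_replicate, sum_map_add_two, smul_eq_mul]
        omega

/-- The number of ones of the image returns `g`, and the other parts return the image of the reduced
partition, which is lighter; the reduction is injective on starred partitions. -/
theorem IsSchur.bij_inj {π π' : Finset ℕ} (h : IsSchur π) (h' : IsSchur π')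
    (heq : bij π = bij π') : π = π' := by
  induction hn : weight π using Nat.strong_induction_on generalizing π π' with
  | _ n ih =>
    by_cases h0 : weight π = 0
    · have h1 : weight π' = 0 := by rw [← h'.bij_spec.2.2.2, ← heq, h.bij_spec.2.2.2, h0]
      rw [h.eq_empty h0, h'.eq_empty h1]
    · obtain ⟨τ, g, hτ, hg, rfl⟩ := h.exists_ungroup
      obtain ⟨τ', g', hτ', hg', rfl⟩ := h'.exists_ungroup
      have hlt := weight_schurPhi_lt _ h0
      rw [schurPhi, (hτ.ungroup_spec hg).2.1, hn] at hlt
      rw [hτ.bij_ungroup hg, hτ'.bij_ungroup hg'] at heq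
      have h1 : g = g' := by
        rw [← count_one_replicate_add g (bij (schurReduce τ)), heq, count_one_replicate_add]
      have h2 : bij (schurReduce τ) = bij (schurReduce τ') := by
        rw [← alladiReduce_map (bij (schurReduce τ)), ← alladiGroup_replicate_add g, heq,
          alladiGroup_replicate_add, alladiReduce_map]
      rw [h1, hτ.schurReduce_inj hτ'
        (ih _ hlt hτ.isSchur_schurReduce hτ'.isSchur_schurReduce h2 rfl)]

theorem exists_bij_eq {μ : Multiset ℕ} (h : ∀ x ∈ μ, Odd x) (h2 : ∀ x, μ.count x ≤ 2) :
    ∃ π, IsSchur π ∧ bij π = μ := by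
  induction hn : μ.sum using Nat.strong_induction_on generalizing μ with
  | _ n ih =>
    by_cases h0 : μ = 0
    · exact ⟨∅, ⟨by simp, by simp, by simp⟩, by rw [bij_empty, h0]⟩
    · have hμ := eq_replicate_add_alladiPhi h
      have hsum : μ.sum = μ.count 1 + ((alladiPhi μ).sum + 2 * (alladiPhi μ).card) := by
        conv_lhs => rw [hμ]
        rw [Multiset.sum_add, Multiset.sum_replicate, sum_map_add_two, smul_eq_mul, mul_one]
      have hlt : (alladiPhi μ).sum < n := by
        rw [← hn, hsum]
        -- Without a decrease there would be neither ones nor larger parts, so `μ` would be empty.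
        by_contra hle
        have h3 : alladiPhi μ = 0 := Multiset.card_eq_zero.1 (by omega)
        have h4 : μ.count 1 = 0 := by omega
        rw [h3, h4] at hμ
        exact h0 (by simpa using hμ)
      have hodd : ∀ x ∈ alladiPhi μ, Odd x := by
        intro x hx
        have := h (x + 2) (by
          rw [hμ]
          exact Multiset.mem_add.2 (.inr (Multiset.mem_map_of_mem _ hx)))
        grind
      have hcount : ∀ x, (alladiPhi μ).count x ≤ 2 := by
        intro x
        have := h2 (x + 2)
        rwa [hμ, count_add_two_replicate_add] at this
      obtain ⟨σ, hσ, hbij⟩ := ih _ hlt hodd hcount rfl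
      obtain ⟨τ, hτ, rfl⟩ := hσ.exists_schurReduce_eq
      refine ⟨ungroup (μ.count 1) τ, (hτ.ungroup_spec (h2 1)).1, ?_⟩
      rw [hτ.bij_ungroup (h2 1), hbij, ← hμ]

/-! ### Graded pieces and the two diagrams -/

theorem mem_schurStarSet_iff {m n : ℤ} {π : Finset ℕ} :
    π ∈ schurStarSet m n ↔ IsStar π ∧ (partCount π : ℤ) = m ∧ (weight π : ℤ) = n := by
  simp only [schurStarSet, schurSet, IsStar, Set.mem_ofPred_eq]
  tauto

theorem mapsTo_bij (m n : ℤ) : Set.MapsTo bij (schurSet m n) (alladiSet m n) := by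
  rintro π ⟨h, rfl, rfl⟩
  obtain ⟨h1, h2, h3, h4⟩ := h.bij_spec
  exact ⟨h1, h2, by rw [h3], by rw [h4]⟩

theorem mapsTo_bij_star (m n : ℤ) :
    Set.MapsTo bij (schurStarSet m n) (alladiStarSet m n) := by
  intro π hπ
  refine ⟨mapsTo_bij m n hπ.1, fun x hx => ?_⟩
  rw [(mem_schurStarSet_iff.1 hπ).1.bij_eq] at hx
  obtain ⟨y, -, rfl⟩ := Multiset.mem_map.1 hx
  omega

theorem bijOn_bij (m n : ℤ) : Set.BijOn bij (schurSet m n) (alladiSet m n) := by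
  refine ⟨mapsTo_bij m n, fun π hπ π' hπ' h => hπ.1.bij_inj hπ'.1 h, ?_⟩
  rintro μ ⟨h1, h2, rfl, rfl⟩
  obtain ⟨π, hπ, rfl⟩ := exists_bij_eq h1 h2
  obtain ⟨-, -, h3, h4⟩ := hπ.bij_spec
  exact ⟨π, ⟨hπ, by rw [h3], by rw [h4]⟩, rfl⟩

theorem IsStar.eq_zero_iff_isStar_ungroup {τ : Finset ℕ} (h : IsStar τ) {g : ℕ} (hg : g ≤ 2) :
    g = 0 ↔ IsStar (ungroup g τ) := by
  constructor
  · rintro rfl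
    exact h
  · intro h'
    have h1 := (h.ungroup_spec hg).2.1
    have h2 := (h.ungroup_spec hg).2.2.1
    rw [h'.schurGroup_eq] at h1
    rw [h1] at h2
    omega

/-- The grading of Schur partitions is the coordinate `g` of the ungrouping, which is the number of
ones of the image. -/
theorem mem_schurGradedSet_iff {m n : ℤ} {π : Finset ℕ} (hπ : π ∈ schurSet m n) {g : ℕ}
    (hg : g ≤ 2) : π ∈ schurGradedSet m n g ↔ (bij π).count 1 = g := by
  obtain ⟨τ, k, hτ, hk, rfl⟩ := hπ.1.exists_ungroup
  rw [hτ.bij_ungroup hk, count_one_replicate_add]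
  obtain ⟨-, -, -, -, h1, h2⟩ := hτ.ungroup_spec hk
  obtain rfl | rfl | rfl : g = 0 ∨ g = 1 ∨ g = 2 := by omega
  · rw [hτ.eq_zero_iff_isStar_ungroup hk]
    exact mem_schurStarSet_iff.trans (and_iff_left hπ.2)
  · exact (and_iff_right hπ).trans h1.symm
  · exact (and_iff_right hπ).trans h2.symm

theorem image_schurGradedSet (m n : ℤ) (g : ℕ) (hg : g ≤ 2) :
    bij '' schurGradedSet m n g = alladiGradedSet m n g := by
  have hsub : schurGradedSet m n g ⊆ schurSet m n := by
    obtain rfl | rfl | rfl : g = 0 ∨ g = 1 ∨ g = 2 := by omega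
    all_goals exact fun π hπ => hπ.1
  ext μ
  constructor
  · rintro ⟨π, hπ, rfl⟩
    exact ⟨mapsTo_bij m n (hsub hπ), (mem_schurGradedSet_iff (hsub hπ) hg).1 hπ⟩
  · rintro ⟨hμ, hc⟩
    obtain ⟨π, hπ, rfl⟩ := (bijOn_bij m n).surjOn hμ
    exact ⟨π, (mem_schurGradedSet_iff hπ hg).2 hc, rfl⟩

theorem bij_schurGroup {π : Finset ℕ} (h : IsSchur π) :
    bij (schurGroup π) = alladiGroup (bij π) := by
  obtain ⟨τ, g, hτ, hg, rfl⟩ := h.exists_ungroup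
  rw [(hτ.ungroup_spec hg).2.1, hτ.bij_ungroup hg, alladiGroup_replicate_add, hτ.bij_eq]

theorem bij_schurReduce {π : Finset ℕ} (h : IsStar π) :
    bij (schurReduce π) = alladiReduce (bij π) := by
  rw [h.bij_eq, alladiReduce_map]

theorem isStar_schurGroup {π : Finset ℕ} (h : IsSchur π) : IsStar (schurGroup π) := by
  obtain ⟨τ, g, hτ, hg, rfl⟩ := h.exists_ungroup
  rwa [(hτ.ungroup_spec hg).2.1]

/-- Transported from the Schur side: the multiset is the image of a starred partition, whose
reduction has the right statistics, and `bij` intertwines the two reductions. -/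
theorem mapsTo_alladiReduce (m n : ℤ) :
    Set.MapsTo alladiReduce (alladiStarSet m n) (alladiSet m (n - 2 * m)) := by
  rintro μ ⟨hμ, h1⟩
  obtain ⟨π, hπ, rfl⟩ := (bijOn_bij m n).surjOn hμ
  have hs : IsStar π := by
    have : (bij π).count 1 = 0 := Multiset.count_eq_zero.2 fun h => lt_irrefl _ (h1 1 h)
    exact (mem_schurStarSet_iff.1 ((mem_schurGradedSet_iff hπ (Nat.zero_le 2)).2 this)).1
  obtain ⟨-, rfl, rfl⟩ := hπ
  obtain ⟨h2, h3⟩ := hs.partCount_schurReduce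
  rw [← bij_schurReduce hs]
  refine mapsTo_bij _ _ ⟨hs.isSchur_schurReduce, by rw [h2], by omega⟩

theorem mapsTo_schurReduce (m n : ℤ) :
    Set.MapsTo schurReduce (schurStarSet m n) (schurSet m (n - 2 * m)) := by
  intro π hπ
  obtain ⟨hs, rfl, rfl⟩ := mem_schurStarSet_iff.1 hπ
  obtain ⟨h2, h3⟩ := hs.partCount_schurReduce
  exact ⟨hs.isSchur_schurReduce, by rw [h2], by omega⟩

theorem mapsTo_schurGroup (m n : ℤ) : Set.MapsTo schurGroup (schurSet m n)
    (schurStarSet m n ∪ schurStarSet (m - 1) (n - 1) ∪ schurStarSet (m - 2) (n - 2)) := by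
  rintro π ⟨h, rfl, rfl⟩
  obtain ⟨τ, g, hτ, hg, rfl⟩ := h.exists_ungroup
  obtain ⟨-, hG, hw, hp, -⟩ := hτ.ungroup_spec hg
  simp only [hG, Set.mem_union, mem_schurStarSet_iff, hw, hp, hτ, true_and]
  push_cast
  omega

theorem mapsTo_bij_star_union (m n : ℤ) : Set.MapsTo bij
    (schurStarSet m n ∪ schurStarSet (m - 1) (n - 1) ∪ schurStarSet (m - 2) (n - 2))
    (alladiStarSet m n ∪ alladiStarSet (m - 1) (n - 1) ∪ alladiStarSet (m - 2) (n - 2)) := by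
  rintro π ((h | h) | h)
  · exact .inl (.inl (mapsTo_bij_star _ _ h))
  · exact .inl (.inr (mapsTo_bij_star _ _ h))
  · exact .inr (mapsTo_bij_star _ _ h)

theorem mapsTo_alladiGroup (m n : ℤ) : Set.MapsTo alladiGroup (alladiSet m n)
    (alladiStarSet m n ∪ alladiStarSet (m - 1) (n - 1) ∪ alladiStarSet (m - 2) (n - 2)) := by
  intro μ hμ
  obtain ⟨π, hπ, rfl⟩ := (bijOn_bij m n).surjOn hμ
  rw [← bij_schurGroup hπ.1]
  exact mapsTo_bij_star_union m n (mapsTo_schurGroup m n hπ)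

end AlladiSchur

open AlladiSchur
theorem mainTheorem8 (m n : ℤ) :
    -- `f` is a bijection from `𝒟(m,n)` onto `𝒞(m,n)`
    Set.BijOn bij (schurSet m n) (alladiSet m n) ∧
    -- `f ∘ φ = φ' ∘ f`
    (∀ π ∈ schurSet m n, bij (schurPhi π) = alladiPhi (bij π)) ∧
    -- `f` maps `[𝒟(m,n)]_g` onto `[𝒞(m,n)]_g`
    (∀ g : ℕ, g ≤ 2 → bij '' schurGradedSet m n g = alladiGradedSet m n g) ∧
    -- the first diagram: all four arrows are maps between the stated sets, and it commutes
    (Set.MapsTo schurReduce (schurStarSet m n) (schurSet m (n - 2 * m)) ∧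
      Set.MapsTo bij (schurStarSet m n) (alladiStarSet m n) ∧
      Set.MapsTo alladiReduce (alladiStarSet m n) (alladiSet m (n - 2 * m)) ∧
      Set.MapsTo bij (schurSet m (n - 2 * m)) (alladiSet m (n - 2 * m)) ∧
      ∀ π ∈ schurStarSet m n, bij (schurReduce π) = alladiReduce (bij π)) ∧
    -- the second diagram: all four arrows are maps between the stated sets, and it commutes
    (Set.MapsTo schurGroup (schurSet m n)
        (schurStarSet m n ∪ schurStarSet (m - 1) (n - 1) ∪ schurStarSet (m - 2) (n - 2)) ∧
      Set.MapsTo bij (schurSet m n) (alladiSet m n) ∧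
      Set.MapsTo alladiGroup (alladiSet m n)
        (alladiStarSet m n ∪ alladiStarSet (m - 1) (n - 1) ∪ alladiStarSet (m - 2) (n - 2)) ∧
      Set.MapsTo bij
        (schurStarSet m n ∪ schurStarSet (m - 1) (n - 1) ∪ schurStarSet (m - 2) (n - 2))
        (alladiStarSet m n ∪ alladiStarSet (m - 1) (n - 1) ∪ alladiStarSet (m - 2) (n - 2)) ∧
      ∀ π ∈ schurSet m n, bij (schurGroup π) = alladiGroup (bij π)) := by
  refine ⟨bijOn_bij m n, fun π hπ => ?_, image_schurGradedSet m n,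
    ⟨mapsTo_schurReduce m n, mapsTo_bij_star m n, mapsTo_alladiReduce m n, mapsTo_bij _ _,
      fun π hπ => bij_schurReduce (mem_schurStarSet_iff.1 hπ).1⟩,
    ⟨mapsTo_schurGroup m n, mapsTo_bij m n, mapsTo_alladiGroup m n, mapsTo_bij_star_union m n,
      fun π hπ => bij_schurGroup hπ.1⟩⟩
  rw [schurPhi, alladiPhi, bij_schurReduce (isStar_schurGroup hπ.1), bij_schurGroup hπ.1]
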